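/- **Half-space ASEP.** Let $q>0$, $q\neq 1$, $\alpha\ge 0$. The half-space ASEP with $\gamma=0$ is the continuous-time Markov chain $(X_t)_{t\ge0}$ on the finite subsets of $\mathbb N=\{1,2,\dots\}$ (sets of occupied sites) in which each particle jumps from $s$ to $s+1$ at rate $1$ and from $s\ge2$ to $s-1$ at rate $q$, jumps being permitted only if the target site is empty, and in which a new particle is inserted at site $1$ at rate $\alpha$ whenever that site is empty. Let $\mathbb P_t(y\to x)=\mathbb P(X_t=x\mid X_0=y)$ (where $\mathbb P(X_0=y)>0$). **Contours.** Let $\mathcal C_1,\dots,\mathcal C_N$ be positively oriented closed piecewise $C^1$ contours in $\mathbb C$ (the winding number around each point off the contour is $0$ or $1$; the interior is the set of points with winding number $1$) such that: * each $\mathcal C_i$ encloses $1$; the points $0$, $q^{-1}$ and, if $\alpha>0$, $(q+\alpha-1)/\alpha$ neither lie on $\mathcal C_i$ nor are enclosed by it; * for $i<j$, $\mathcal C_i$ is contained in the interior of $\mathcal C_j$, the image $q\,\mathcal C_j$ is disjoint from $\mathcal C_i$ and its interior, and $w_iw_j\neq1$ for all $w_i\in\mathcal C_i$, $w_j\in\mathcal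 C_j$; * for all $k,\ell$, the contours $\mathcal C_k$ and $q^{-1}\mathcal C_\ell^{-1}=\{1/(qw):w\in\mathcal C_\ell\}$ do not intersect and have disjoint interiors. **Notation.** Let $\mathcal B_N=S_N\ltimes\{\pm1\}^N$ be the group of signed permutations of $\{1,\dots,N\}$, acting on functions by $\sigma(f(w_1,\dots,w_N))=f(w_{\sigma(1)},\dots,w_{\sigma(N)})$ with $w_{-k}:=1/(qw_k)$, and let $$V_k=\frac{q^{\binom k2}(1-q)^k}{\prod_{i=1}^k(1-q^i)(1+q^{i-1})}.$$ **Theorem.** Let $N\ge M\ge0$ be integers, let $x=(x_1>\dots>x_N\ge1)$ and $y=(y_1>\dots>y_M\ge1)$ be configurations, and let $t\ge0$. Then $$\begin{aligned}\mathbb P_t(y\to x)={}&V_{N-M}\,\alpha^{N-M}e^{-\alpha t}\oint_{\mathcal C_1}\frac{dw_1}{2\pi \mathrm i}\cdots\oint_{\mathcal C_N}\frac{dw_N}{2\pi \mathrm i}\prod_{1\le i<j\le N}\left[\frac{w_j-w_i}{qw_j-w_i}\,\frac{1-qw_iw_j}{1-w_iw_j}\right]\\&\times\prod_{i=1}^N\left[\frac{1-qw_i^2}{w_i(q+\alpha-1-\alpha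 w_i)(1-qw_i)}\left(\frac{1-w_i}{1-qw_i}\right)^{x_i-1}\exp\left(\frac{(1-q)^2w_it}{(1-w_i)(1-qw_i)}\right)\right]\\&\times\sum_{\sigma\in\mathcal B_N}\sigma\left(\prod_{1\le i<j\le N}\left[\frac{w_i-qw_j}{w_i-w_j}\,\frac{1-w_iw_j}{1-qw_iw_j}\right]\prod_{i=1}^M\left[\frac{1-q-\alpha+\alpha w_i}{1-qw_i^2}\,\frac{(1-q)w_i}{1-w_i}\left(\frac{1-qw_i}{1-w_i}\right)^{y_i-1}\right]\right),\end{aligned}$$ with $0^0=1$. -/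

import Mathlib

open Set MeasureTheory Filter Topology
open scoped NNReal

noncomputable section

namespace HalfSpaceASEP

/-! ### The process -/

/-- The state space: finite sets of occupied sites of the half-line `{1, 2, 3, …}`. -/
abbrev Config : Type := Finset ℕ+

/-- The configuration with particles at the positions `x 0, …, x (n - 1)`. -/
def config {n : ℕ} (x : Fin n → ℕ+) : Config := Finset.univ.image x

/-- The configuration obtained from `S` by moving the particle at the occupied site `s` to the
empty site `s'` (that is, by interchanging the occupations of these two sites). -/
def move (S : Config) (s s' : ℕ+) : Config := insert s' (S.erase s)

/-- The generator of half-space ASEP acting on functions of the configuration: injection at site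
`1` at rate `α`, ejection from site `1` at rate `γ`, jumps to the right at rate `1` and to the left
at rate `q`, the jumps being allowed only to empty sites. -/
def generator (q α γ : ℝ) (f : Config → ℝ) (S : Config) : ℝ :=
  (if 1 ∈ S then 0 else α * (f (insert 1 S) - f S))
    + (if 1 ∈ S then γ * (f (S.erase 1) - f S) else 0)
    + (∑ s ∈ S, if s + 1 ∈ S then 0 else f (move S s (s + 1)) - f S)
    + ∑ s ∈ S, if 1 < s ∧ s - 1 ∉ S then q * (f (move S s (s - 1)) - f S) else 0

/-- The matrix element of the generator between `S` and `S'`: for `S ≠ S'` the rate of the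
transition from `S` to `S'`, for `S = S'` minus the total rate of leaving `S`. -/
def rate (q α γ : ℝ) (S S' : Config) : ℝ :=
  generator q α γ (fun T => if T = S' then 1 else 0) S

/-- `p t S S'` is the transition function of a continuous-time Markov chain on the configurations
whose rates are those of half-space ASEP. -/
structure IsTransitionFunction (q α γ : ℝ) (p : ℝ≥0 → Config → Config → ℝ) : Prop where
  nonneg : ∀ t S S', 0 ≤ p t S S'
  hasSum_one : ∀ t S, HasSum (p t S) 1
  zero : ∀ S S', p 0 S S' = if S = S' then 1 else 0
  chapman_kolmogorov : ∀ s t S S', HasSum (fun T => p s S T * p t T S') (p (s + t) S S')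
  hasRate : ∀ S S', Tendsto (fun h : ℝ≥0 => (p h S S' - p 0 S S') / (h : ℝ)) (𝓝[>] 0)
    (𝓝 (rate q α γ S S'))

/-- `X` is a half-space ASEP on the probability space `(Ω, μ)` (with an arbitrary initial law): a
time-homogeneous Markov process on the configurations with the rates of half-space ASEP. -/
structure IsProcess {Ω : Type*} [MeasurableSpace Ω] (q α γ : ℝ) (X : ℝ≥0 → Ω → Config)
    (μ : Measure Ω) : Prop where
  measurableSet : ∀ t S, MeasurableSet {ω | X t ω = S}
  markov : ∃ p : ℝ≥0 → Config → Config → ℝ, IsTransitionFunction q α γ p ∧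
    ∀ (n : ℕ) (τ : Fin (n + 1) → ℝ≥0), Monotone τ → ∀ S : Fin (n + 1) → Config,
      μ.real {ω | ∀ k, X (τ k) ω = S k}
        = μ.real {ω | X (τ 0) ω = S 0}
          * ∏ k : Fin n, p (τ k.succ - τ k.castSucc) (S k.castSucc) (S k.succ)

/-- The transition probability `ℙ(X_t = S' | X_0 = S)`. -/
def transitionProb {Ω : Type*} [MeasurableSpace Ω] (X : ℝ≥0 → Ω → Config) (μ : Measure Ω)
    (t : ℝ≥0) (S S' : Config) : ℝ :=
  (ProbabilityTheory.cond μ {ω | X 0 ω = S}).real {ω | X t ω = S'}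

/-! ### Contours -/

/-- The integral of `f` along the curve `γ`, parametrized by `[0, 1]`. -/
def curveInt (γ : ℝ → ℂ) (f : ℂ → ℂ) : ℂ := ∫ s in (0 : ℝ)..1, f (γ s) * deriv γ s

/-- The set of points on the curve `γ`. -/
def trace (γ : ℝ → ℂ) : Set ℂ := γ '' Icc 0 1

/-- The winding number of the closed curve `γ` around `z`. -/
def winding (γ : ℝ → ℂ) (z : ℂ) : ℂ :=
  (2 * Real.pi * Complex.I)⁻¹ * curveInt γ (fun w => (w - z)⁻¹)

/-- The interior of (the set of points enclosed by) the closed curve `γ`. -/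
def inside (γ : ℝ → ℂ) : Set ℂ := {z | z ∉ trace γ ∧ winding γ z ≠ 0}

/-- A positively oriented closed contour: a closed piecewise continuously differentiable curve
which winds exactly once, counterclockwise, around each of the points that it encloses. By the
Jordan curve theorem this includes all simple closed curves with the counterclockwise
orientation. -/
structure IsContour (γ : ℝ → ℂ) : Prop where
  closed : γ 0 = γ 1
  continuousOn : ContinuousOn γ (Icc 0 1)
  piecewise : ∃ (n : ℕ) (a : ℕ → ℝ), Monotone a ∧ a 0 = 0 ∧ a n = 1 ∧
    ∀ k < n, ContDiffOn ℝ 1 γ (Icc (a k) (a (k + 1)))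
  positive : ∀ z ∈ inside γ, winding γ z = 1

/-- The admissible families of nested contours `C 0, …, C (N - 1)` around the point `1`. -/
structure Admissible (q α : ℝ) {N : ℕ} (C : Fin N → ℝ → ℂ) : Prop where
  isContour : ∀ i, IsContour (C i)
  one_mem : ∀ i, 1 ∈ inside (C i)
  zero_notMem : ∀ i, 0 ∉ trace (C i) ∪ inside (C i)
  inv_notMem : ∀ i, (q : ℂ)⁻¹ ∉ trace (C i) ∪ inside (C i)
  /-- For `α ≠ 0` the excluded point is `(q + α - 1) / α`; for `α = 0` and `q ≠ 1` there is none. -/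
  pole_notMem : ∀ i, ∀ w ∈ trace (C i) ∪ inside (C i), (q : ℂ) + α - 1 - α * w ≠ 0
  nested : ∀ i j, i < j → trace (C i) ⊆ inside (C j)
  smul_outside : ∀ i j, i < j →
    Disjoint ((fun w => (q : ℂ) * w) '' trace (C j)) (trace (C i) ∪ inside (C i))
  inv_trace_disjoint : ∀ k l, Disjoint (trace (C k)) (trace fun s => ((q : ℂ) * C l s)⁻¹)
  inv_inside_disjoint : ∀ k l, Disjoint (inside (C k)) (inside fun s => ((q : ℂ) * C l s)⁻¹)
  /-- The denominators `1 - w_i w_j` of the integrand do not vanish on the contours. -/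
  mul_ne_one : ∀ i j, i < j → ∀ w ∈ trace (C i), ∀ z ∈ trace (C j), w * z ≠ 1

/-- The iterated integral
`∮_{C 0} dw_0 / (2πi) ⋯ ∮_{C (N - 1)} dw_{N - 1} / (2πi) f (w_0, …, w_{N - 1})`. -/
def nestedInt : {N : ℕ} → (Fin N → ℝ → ℂ) → ((Fin N → ℂ) → ℂ) → ℂ
  | 0, _, f => f Fin.elim0
  | _ + 1, C, f => (2 * Real.pi * Complex.I)⁻¹ *
      curveInt (C 0) fun w => nestedInt (fun i => C i.succ) fun v => f (Fin.cons w v)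

/-! ### The integrand -/

/-- The normalization
`V_k = q ^ (k choose 2) * (1 - q) ^ k / ∏_{i = 1}^k ((1 - q ^ i) * (1 + q ^ (i - 1)))`. -/
def V (q : ℝ) (k : ℕ) : ℝ :=
  q ^ k.choose 2 * (1 - q) ^ k / ∏ i ∈ Finset.range k, ((1 - q ^ (i + 1)) * (1 + q ^ i))

/-- The elements `σ = (π, ε)` of the hyperoctahedral group `S_N ⋉ {±1}^N`, as signed permutations
`σ(i) = ε(i) π(i)`. -/
abbrev SignedPerm (N : ℕ) : Type := Equiv.Perm (Fin N) × (Fin N → ℤˣ)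

/-- The alphabet `(w_{σ(1)}, …, w_{σ(N)})`, where `w_{-k} = 1 / (q w_k)`. -/
def SignedPerm.act (q : ℝ) {N : ℕ} (σ : SignedPerm N) (w : Fin N → ℂ) : Fin N → ℂ :=
  fun i => if σ.2 i = 1 then w (σ.1 i) else 1 / (q * w (σ.1 i))

/-- The one-particle function `φ_y(w)`. -/
def phi (q α : ℝ) (y : ℕ+) (w : ℂ) : ℂ :=
  (1 - q - α + α * w) / (1 - q * w ^ 2) * ((1 - q) * w / (1 - w))
    * ((1 - q * w) / (1 - w)) ^ ((y : ℕ) - 1)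

/-- The function that is symmetrized over signed permutations. -/
def summand (q α : ℝ) {M N : ℕ} (hMN : M ≤ N) (y : Fin M → ℕ+) (w : Fin N → ℂ) : ℂ :=
  (∏ i, ∏ j ∈ Finset.Ioi i,
      ((w i - q * w j) / (w i - w j) * ((1 - w i * w j) / (1 - q * w i * w j))))
    * ∏ i : Fin M, phi q α (y i) (w (Fin.castLE hMN i))

/-- The symmetrization over the hyperoctahedral group. -/
def symmetrization (q α : ℝ) {M N : ℕ} (hMN : M ≤ N) (y : Fin M → ℕ+) (w : Fin N → ℂ) : ℂ :=
  ∑ σ : SignedPerm N, summand q α hMN y (σ.act q w)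

/-- The integrand of the transition probability from `y` to `x` at time `t`. -/
def integrand (q α t : ℝ) {M N : ℕ} (hMN : M ≤ N) (y : Fin M → ℕ+) (x : Fin N → ℕ+)
    (w : Fin N → ℂ) : ℂ :=
  (∏ i, ∏ j ∈ Finset.Ioi i,
      ((w j - w i) / (q * w j - w i) * ((1 - q * w i * w j) / (1 - w i * w j))))
    * (∏ i, ((1 - q * w i ^ 2) / (w i * (q + α - 1 - α * w i) * (1 - q * w i))
        * ((1 - w i) / (1 - q * w i)) ^ ((x i : ℕ) - 1)
        * Complex.exp ((1 - q) ^ 2 * w i * t / ((1 - w i) * (1 - q * w i)))))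
    * symmetrization q α hMN y w

end HalfSpaceASEP

end

/-! For fixed `x`, the transition probability and the contour integral are both functions of the
initial configuration and of time. Both solve the Kolmogorov backward equation with the indicator of
`x` as initial value, and a solution of moderate growth is unique. So three things have to be shown.

The equation. In the variable z = (1 - q w) / (1 - w) the inversion w ↦ 1 / (q w) becomes z ↦ q / z.
The symmetrization is then a constant times a nested sum `wave` over choices of a variable and a
branch for each particle (`sum_orderedProd`), and `V` is the inverse of that constant
(`V_mul_symmConst`). The exponent of the integrand is the sum of the energies z + q / z - 1 - q. The
energy of a variable that carries a particle acts as the generator of a free walk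
(`wave_update_energy`), while the energy of the variables that carry none is the wave function of
one more particle, placed at site 1 (`energy_mul_wave`). Two linear relations remove the forbidden
jumps: `wave_exclusion` at neighbouring particles and `wave_boundary` at site 1. With the weight `α
^ (N - M)` the wave function becomes an eigenfunction of the generator, with the total energy minus
`α` as eigenvalue (`complexGenerator_configWave`); this explains the factor exp(-α t). The boundary
relation rests on the first moments of the interaction (`moment_one`, `moment_id`, `moment_sq`),
which come from a partial fraction expansion (`prod_interaction`).

The initial condition. At time zero the integrand is a sum over signs of alternating sums over
permutations (`Admissible.integrand_zero`). A term with an inverted variable vanishes after two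
integrations: first over the inverted variable of smallest index, with residues at inverses of
earlier variables, then over that earlier variable, where no pole is left
(`nestedInt_signTerm_eq_zero`). Without inverted variables, the identity permutation gives a product
of orthogonality integrals (`Admissible.curveInt_rho_mul_phi`). The other permutations are grouped
by their first moved index and its image; a group vanishes either term by term or, after residues
outside the contour, as a whole (`Admissible.nestedInt_firstMoved`). If there are fewer particles
than variables, a variable without a pole kills each term.

Uniqueness. The solution grows at most like b to the sum of the occupied sites, jumps change that
sum by at most one, and the total rate is linear in the number of particles. Iteration of the
integrated equation forces a difference of solutions to vanish on short intervals of a fixed length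
(`eq_zero_of_backward`).

The contours are general closed curves known only through winding numbers. The integrands at time
zero are rational, so the theorems of Cauchy are obtained from partial fractions and primitives, and
positions of curves are compared by constancy of winding numbers on connected sets. -/

noncomputable section

namespace HalfSpaceASEP

/-! ### Closed curves and winding numbers -/

/-- A closed curve which is differentiable with a bounded derivative off a countable set. -/
structure IsClosedCurve (γ : ℝ → ℂ) : Prop where
  closed : γ 0 = γ 1
  continuousOn : ContinuousOn γ (Icc 0 1)
  exists_deriv_bound : ∃ (B : Set ℝ) (K : ℝ), B.Countable ∧
    ∀ s ∈ Ioo (0 : ℝ) 1 \ B, DifferentiableAt ℝ γ s ∧ ‖deriv γ s‖ ≤ K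

theorem exists_mem_Ioo_of_monotone {a : ℕ → ℝ} {n : ℕ} {s : ℝ} (h0 : a 0 < s) (hn : s < a n)
    (hs : ∀ k, s ≠ a k) : ∃ k < n, s ∈ Ioo (a k) (a (k + 1)) := by
  induction n with
  | zero => exact absurd hn (not_lt.2 h0.le)
  | succ n ih =>
    rcases lt_or_gt_of_ne (hs n) with h | h
    · obtain ⟨k, hk, hk'⟩ := ih h
      exact ⟨k, hk.trans n.lt_succ_self, hk'⟩
    · exact ⟨n, n.lt_succ_self, h, hn⟩

theorem IsContour.isClosedCurve {γ : ℝ → ℂ} (h : IsContour γ) : IsClosedCurve γ := by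
  refine ⟨h.closed, h.continuousOn, ?_⟩
  obtain ⟨n, a, -, ha0, han, hd⟩ := h.piecewise
  have hK : ∀ k, ∃ K, k < n → ∀ s ∈ Icc (a k) (a (k + 1)),
      a k < a (k + 1) → ‖derivWithin γ (Icc (a k) (a (k + 1))) s‖ ≤ K := by
    intro k
    by_cases hk : k < n
    · by_cases hlt : a k < a (k + 1)
      · have hc := (hd k hk).continuousOn_derivWithin (uniqueDiffOn_Icc hlt) le_rfl
        obtain ⟨K, hK⟩ := isCompact_Icc.exists_bound_of_continuousOn hc
        exact ⟨K, fun _ s hs _ => hK s hs⟩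
      · exact ⟨0, fun _ _ _ h => absurd h hlt⟩
    · exact ⟨0, fun h => absurd h hk⟩
  choose K hK using hK
  -- The breakpoints form the exceptional set; the sum of the bounds for the pieces dominates each
  -- of them.
  refine ⟨range a, ∑ k ∈ Finset.range n, |K k|, countable_range a, fun s hs => ?_⟩
  obtain ⟨k, hk, hsk⟩ := exists_mem_Ioo_of_monotone (a := a) (n := n) (s := s)
    (by rw [ha0]; exact hs.1.1) (by rw [han]; exact hs.1.2) (fun k hk => hs.2 ⟨k, hk.symm⟩)
  have hnh : Icc (a k) (a (k + 1)) ∈ 𝓝 s := Icc_mem_nhds hsk.1 hsk.2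
  refine ⟨((hd k hk).differentiableOn one_ne_zero s ⟨hsk.1.le, hsk.2.le⟩).differentiableAt hnh, ?_⟩
  rw [← derivWithin_of_mem_nhds hnh]
  exact ((hK k hk s ⟨hsk.1.le, hsk.2.le⟩ (hsk.1.trans hsk.2)).trans (le_abs_self _)).trans
    (Finset.single_le_sum (f := fun k => |K k|) (fun _ _ => abs_nonneg _) (Finset.mem_range.2 hk))

section curve

variable {γ : ℝ → ℂ}

theorem IsClosedCurve.isCompact_trace (h : IsClosedCurve γ) : IsCompact (trace γ) :=
  isCompact_Icc.image_of_continuousOn h.continuousOn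

theorem IsClosedCurve.isPreconnected_trace (h : IsClosedCurve γ) : IsPreconnected (trace γ) :=
  isPreconnected_Icc.image _ h.continuousOn

theorem mem_trace_of_mem {s : ℝ} (hs : s ∈ Icc (0 : ℝ) 1) : γ s ∈ trace γ := mem_image_of_mem _ hs

theorem zero_mem_trace (γ : ℝ → ℂ) : γ 0 ∈ trace γ := mem_trace_of_mem (by simp)

theorem IsClosedCurve.exists_ae_bound (h : IsClosedCurve γ) :
    ∃ K, 0 ≤ K ∧ ∀ᵐ s : ℝ, s ∈ Ioc (0 : ℝ) 1 → DifferentiableAt ℝ γ s ∧ ‖deriv γ s‖ ≤ K := by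
  obtain ⟨B, K, hB, hK⟩ := h.exists_deriv_bound
  refine ⟨|K|, abs_nonneg _, ?_⟩
  have h1 : ∀ᵐ s : ℝ, s ∉ B := hB.ae_notMem _
  have h2 : ∀ᵐ s : ℝ, s ≠ 1 := by simp [ae_iff]
  filter_upwards [h1, h2] with s hs hs1 hs2
  have := hK s ⟨⟨hs2.1, lt_of_le_of_ne hs2.2 hs1⟩, hs⟩
  exact ⟨this.1, this.2.trans (le_abs_self _)⟩

theorem IsClosedCurve.intervalIntegrable (h : IsClosedCurve γ) {f : ℂ → ℂ}
    (hf : ContinuousOn f (trace γ)) :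
    IntervalIntegrable (fun s => f (γ s) * deriv γ s) volume 0 1 := by
  obtain ⟨K, hK0, hK⟩ := h.exists_ae_bound
  have hc : ContinuousOn (fun s => f (γ s)) (Icc 0 1) :=
    hf.comp h.continuousOn (fun s hs => mem_trace_of_mem hs)
  obtain ⟨B, hB⟩ := isCompact_Icc.exists_bound_of_continuousOn hc
  rw [intervalIntegrable_iff_integrableOn_Ioc_of_le zero_le_one]
  refine ⟨?_, HasFiniteIntegral.of_bounded (C := |B| * K) ?_⟩
  · exact ((hc.mono Ioc_subset_Icc_self).aestronglyMeasurable measurableSet_Ioc).mul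
      (measurable_deriv γ).aestronglyMeasurable
  · rw [ae_restrict_iff' measurableSet_Ioc]
    filter_upwards [hK] with s hs hs'
    rw [norm_mul]
    exact mul_le_mul ((hB s (Ioc_subset_Icc_self hs')).trans (le_abs_self _)) (hs hs').2
      (norm_nonneg _) (abs_nonneg _)

theorem curveInt_congr {f g : ℂ → ℂ} (hfg : EqOn f g (trace γ)) : curveInt γ f = curveInt γ g := by
  refine intervalIntegral.integral_congr fun s hs => ?_
  rw [uIcc_of_le zero_le_one] at hs
  simp only [hfg (mem_trace_of_mem hs)]

theorem curveInt_const_mul (c : ℂ) (f : ℂ → ℂ) :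
    curveInt γ (fun w => c * f w) = c * curveInt γ f := by
  simp only [curveInt, mul_assoc, intervalIntegral.integral_const_mul]

theorem curveInt_zero : curveInt γ (fun _ => 0) = 0 := by simp [curveInt]

theorem IsClosedCurve.curveInt_add (h : IsClosedCurve γ) {f g : ℂ → ℂ}
    (hf : ContinuousOn f (trace γ)) (hg : ContinuousOn g (trace γ)) :
    curveInt γ (fun w => f w + g w) = curveInt γ f + curveInt γ g := by
  simp only [curveInt, add_mul]
  exact intervalIntegral.integral_add (h.intervalIntegrable hf) (h.intervalIntegrable hg)

theorem IsClosedCurve.curveInt_sum (h : IsClosedCurve γ) {ι : Type*} (s : Finset ι)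
    {f : ι → ℂ → ℂ} (hf : ∀ i ∈ s, ContinuousOn (f i) (trace γ)) :
    curveInt γ (fun w => ∑ i ∈ s, f i w) = ∑ i ∈ s, curveInt γ (f i) := by
  simp only [curveInt, Finset.sum_mul]
  exact intervalIntegral.integral_finsetSum fun i hi => h.intervalIntegrable (hf i hi)

/-- The fundamental theorem of calculus tolerates a countable exceptional set, which is why
`IsClosedCurve` asks for no more. Together with vanishing winding numbers it is the source of the
vanishing integrals in Cauchy's theorem below. -/
theorem IsClosedCurve.curveInt_eq_zero_of_hasDerivAt (h : IsClosedCurve γ) {F f : ℂ → ℂ}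
    (hf : ContinuousOn f (trace γ)) (hF : ∀ w ∈ trace γ, HasDerivAt F (f w) w) :
    curveInt γ f = 0 := by
  obtain ⟨B, K, hB, hK⟩ := h.exists_deriv_bound
  have := integral_eq_of_hasDerivAt_off_countable (fun s => F (γ s))
    (fun s => f (γ s) * deriv γ s) (a := 0) (b := 1) hB ?_ ?_ (h.intervalIntegrable hf)
  · rw [curveInt, this, h.closed, sub_self]
  · rw [uIcc_of_le zero_le_one]
    have hc : ContinuousOn F (trace γ) := fun w hw => (hF w hw).continuousAt.continuousWithinAt
    exact hc.comp h.continuousOn fun s hs => mem_trace_of_mem hs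
  · intro s hs
    rw [min_eq_left zero_le_one, max_eq_right zero_le_one] at hs
    exact (hF _ (mem_trace_of_mem (Ioo_subset_Icc_self hs.1))).comp s (hK s hs).1.hasDerivAt

theorem curveInt_inv_sub (γ : ℝ → ℂ) (z : ℂ) :
    curveInt γ (fun w => (w - z)⁻¹) = 2 * Real.pi * Complex.I * winding γ z := by
  rw [winding, mul_inv_cancel_left₀ Complex.two_pi_I_ne_zero]

/-- The image of a closed curve under a differentiable map. -/
theorem IsClosedCurve.comp (h : IsClosedCurve γ) {g g' : ℂ → ℂ}
    (hg : ∀ w ∈ trace γ, HasDerivAt g (g' w) w) (hg' : ContinuousOn g' (trace γ)) :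
    IsClosedCurve fun s => g (γ s) := by
  obtain ⟨B, K, hB, hK⟩ := h.exists_deriv_bound
  have hc : ContinuousOn g (trace γ) := fun w hw => (hg w hw).continuousAt.continuousWithinAt
  obtain ⟨L, hL⟩ := h.isCompact_trace.exists_bound_of_continuousOn hg'
  refine ⟨by simp only [h.closed], hc.comp h.continuousOn fun s hs => mem_trace_of_mem hs, B, |L| * K,
    hB, fun s hs => ?_⟩
  have hm : γ s ∈ trace γ := mem_trace_of_mem (Ioo_subset_Icc_self hs.1)
  have hd : HasDerivAt (fun s => g (γ s)) (g' (γ s) * deriv γ s) s :=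
    (hg _ hm).comp s (hK s hs).1.hasDerivAt
  refine ⟨hd.differentiableAt, ?_⟩
  rw [hd.deriv, norm_mul]
  exact mul_le_mul ((hL _ hm).trans (le_abs_self _)) (hK s hs).2 (norm_nonneg _) (abs_nonneg _)

theorem IsClosedCurve.curveInt_comp (h : IsClosedCurve γ) {g g' : ℂ → ℂ}
    (hg : ∀ w ∈ trace γ, HasDerivAt g (g' w) w) (f : ℂ → ℂ) :
    curveInt (fun s => g (γ s)) f = curveInt γ fun w => f (g w) * g' w := by
  obtain ⟨K, -, hK⟩ := h.exists_ae_bound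
  refine intervalIntegral.integral_congr_ae ?_
  filter_upwards [hK] with s hs hs'
  rw [uIoc_of_le zero_le_one] at hs'
  have hd : HasDerivAt (fun s => g (γ s)) (g' (γ s) * deriv γ s) s :=
    (hg _ (mem_trace_of_mem (Ioc_subset_Icc_self hs'))).comp s (hs hs').1.hasDerivAt
  rw [hd.deriv, mul_assoc]

theorem trace_comp (γ : ℝ → ℂ) (g : ℂ → ℂ) : trace (fun s => g (γ s)) = g '' trace γ := by
  rw [trace, trace, image_image]

theorem IsClosedCurve.norm_curveInt_le (h : IsClosedCurve γ) :
    ∃ K, 0 ≤ K ∧ ∀ (f : ℂ → ℂ) (B : ℝ), (∀ w ∈ trace γ, ‖f w‖ ≤ B) → ‖curveInt γ f‖ ≤ K * B := by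
  obtain ⟨K, hK0, hK⟩ := h.exists_ae_bound
  refine ⟨K, hK0, fun f B hB => ?_⟩
  have := intervalIntegral.norm_integral_le_of_norm_le_const_ae (a := 0) (b := 1) (C := K * B)
    (f := fun s => f (γ s) * deriv γ s) ?_
  · simpa [curveInt] using this
  · filter_upwards [hK] with s hs hs'
    rw [uIoc_of_le zero_le_one] at hs'
    rw [norm_mul, mul_comm]
    have hB0 := hB _ (mem_trace_of_mem (Ioc_subset_Icc_self hs'))
    exact mul_le_mul (hs hs').2 hB0 (norm_nonneg _) hK0

theorem IsClosedCurve.continuousOn_winding (h : IsClosedCurve γ) :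
    ContinuousOn (winding γ) (trace γ)ᶜ := by
  intro z hz
  refine ContinuousAt.continuousWithinAt ?_
  obtain ⟨K, hK0, hK⟩ := h.exists_ae_bound
  obtain ⟨r, hr, hball⟩ := Metric.isOpen_iff.1 h.isCompact_trace.isClosed.isOpen_compl z hz
  have hdist : ∀ w ∈ trace γ, ∀ x ∈ Metric.ball z (r / 2), r / 2 ≤ ‖w - x‖ := by
    intro w hw x hx
    by_contra! hlt
    refine hball (a := w) ?_ hw
    rw [Metric.mem_ball] at hx ⊢
    rw [← dist_eq_norm] at hlt
    linarith [dist_triangle w x z]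
  have hcont : ∀ x ∈ Metric.ball z (r / 2), ContinuousOn (fun w => (w - x)⁻¹) (trace γ) := by
    intro x hx
    refine ContinuousOn.inv₀ (by fun_prop) fun w hw h0 => ?_
    have := hdist w hw x hx
    rw [h0, norm_zero] at this
    linarith
  have hb : Metric.ball z (r / 2) ∈ 𝓝 z := Metric.ball_mem_nhds _ (half_pos hr)
  refine ContinuousAt.mul continuousAt_const ?_
  refine intervalIntegral.continuousAt_of_dominated_interval (bound := fun _ => (r / 2)⁻¹ * K)
    ?_ ?_ intervalIntegrable_const ?_
  · filter_upwards [hb] with x hx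
    rw [uIoc_of_le zero_le_one]
    exact (h.intervalIntegrable (hcont x hx)).1.1
  · filter_upwards [hb] with x hx
    filter_upwards [hK] with s hs hs'
    rw [uIoc_of_le zero_le_one] at hs'
    rw [norm_mul, norm_inv]
    exact mul_le_mul (inv_anti₀ (half_pos hr) (hdist _ (mem_trace_of_mem
      (Ioc_subset_Icc_self hs')) x hx)) (hs hs').2 (norm_nonneg _) (by positivity)
  · refine Eventually.of_forall fun s hs => ?_
    rw [uIoc_of_le zero_le_one] at hs
    refine ContinuousAt.mul (ContinuousAt.inv₀ (by fun_prop) ?_) continuousAt_const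
    rw [sub_ne_zero]
    rintro rfl
    exact hz (mem_trace_of_mem (Ioc_subset_Icc_self hs))

/-- A closed curve all of whose winding numbers are `0` or `1`. -/
structure IsSimpleWinding (γ : ℝ → ℂ) : Prop extends IsClosedCurve γ where
  winding_eq : ∀ z ∉ trace γ, winding γ z = 0 ∨ winding γ z = 1

theorem IsContour.isSimpleWinding {γ : ℝ → ℂ} (h : IsContour γ) : IsSimpleWinding γ := by
  refine ⟨h.isClosedCurve, fun z hz => ?_⟩
  by_cases h0 : winding γ z = 0
  · exact .inl h0
  · exact .inr (h.positive z ⟨hz, h0⟩)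

/-- A continuous function with values in the discrete set {0, 1} is constant on connected sets. This
takes the place of the Jordan curve theorem. -/
theorem IsSimpleWinding.winding_eq_of_isPreconnected (h : IsSimpleWinding γ) {S : Set ℂ}
    (hS : IsPreconnected S) (hd : Disjoint S (trace γ)) {z z' : ℂ} (hz : z ∈ S) (hz' : z' ∈ S) :
    winding γ z = winding γ z' := by
  have hdisc : IsDiscrete ({0, 1} : Set ℂ) := (Set.toFinite _).isDiscrete
  obtain ⟨c, -, hc⟩ := hS.eqOn_const_of_mapsTo hdisc
    (h.continuousOn_winding.mono fun x hx => disjoint_left.1 hd hx)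
    (fun x hx => by simpa using h.winding_eq x (disjoint_left.1 hd hx)) ⟨0, by simp⟩
  exact (hc hz).trans (hc hz').symm

/-- At distance at least K + 1 from the curve the defining integral has norm at most K / (K + 1) <
2π, so the winding number cannot be 1. -/
theorem IsSimpleWinding.exists_winding_eq_zero (h : IsSimpleWinding γ) :
    ∃ R, ∀ z, R < ‖z‖ → z ∉ trace γ ∧ winding γ z = 0 := by
  obtain ⟨K, hK0, hK⟩ := h.norm_curveInt_le
  obtain ⟨R, hR⟩ := h.isCompact_trace.isBounded.exists_norm_le
  refine ⟨R + K + 1, fun z hz => ?_⟩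
  have hlow : ∀ w ∈ trace γ, K + 1 ≤ ‖w - z‖ := fun w hw => by
    have := norm_sub_norm_le z w
    rw [norm_sub_rev] at this
    linarith [hR w hw]
  have hzt : z ∉ trace γ := fun hz' => by
    have := hlow z hz'
    rw [sub_self, norm_zero] at this
    linarith
  refine ⟨hzt, (h.winding_eq z hzt).resolve_right fun h1 => ?_⟩
  have h2 := hK (fun w => (w - z)⁻¹) (K + 1)⁻¹ fun w hw => by
    rw [norm_inv]
    exact inv_anti₀ (by linarith) (hlow w hw)
  rw [curveInt_inv_sub, h1, mul_one, norm_mul, norm_mul, Complex.norm_I, Complex.norm_real,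
    Complex.norm_ofNat, Real.norm_eq_abs, abs_of_pos Real.pi_pos] at h2
  have h3 : K * (K + 1)⁻¹ ≤ 1 := by
    rw [← div_eq_mul_inv, div_le_one (by linarith)]
    linarith
  linarith [Real.pi_gt_three]

/-- From every point off the curve there is a segment to the curve that meets it only at its
end. -/
theorem IsClosedCurve.exists_segment (h : IsClosedCurve γ) {z p : ℂ}
    (hp : p ∈ trace γ) :
    ∃ c ∈ trace γ, c ∈ segment ℝ z p ∧ segment ℝ z c \ {c} ⊆ (trace γ)ᶜ := by
  set S : Set ℝ := Icc 0 1 ∩ (fun t : ℝ => AffineMap.lineMap z p t) ⁻¹' trace γ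
  have hS : IsCompact S := isCompact_Icc.inter_right
    (h.isCompact_trace.isClosed.preimage AffineMap.lineMap_continuous)
  -- The first parameter at which the segment meets the curve.
  obtain ⟨t, ht, hmin⟩ := hS.exists_isLeast ⟨1, by simp, by simpa using hp⟩
  refine ⟨AffineMap.lineMap z p t, ht.2, ?_, ?_⟩
  · rw [segment_eq_image_lineMap]
    exact ⟨t, ht.1, rfl⟩
  · rintro w ⟨hw, hwc⟩ hwt
    rw [segment_eq_image_lineMap] at hw
    obtain ⟨u, hu, rfl⟩ := hw
    have hut : AffineMap.lineMap z (AffineMap.lineMap z p t : ℂ) u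
        = (AffineMap.lineMap z p (u * t) : ℂ) := by
      simp only [AffineMap.lineMap_apply, vsub_eq_sub, vadd_eq_add, smul_smul,
        add_sub_cancel_right]
    rw [hut] at hwt hwc
    have hle := hmin ⟨⟨mul_nonneg hu.1 ht.1.1, mul_le_one₀ hu.2 ht.1.1 ht.1.2⟩, hwt⟩
    have : u * t = t := le_antisymm (mul_le_of_le_one_left ht.1.1 hu.2) hle
    exact hwc (by rw [this]; rfl)

variable {δ : ℝ → ℂ}

/-- If `δ` misses the contour `γ` and everything on the side of `γ` on which `z` lies, then `δ`
winds around `z` as it winds around the points of `γ`. -/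
theorem winding_eq_of_side (hγ : IsSimpleWinding γ) (hδ : IsSimpleWinding δ)
    (hd : Disjoint (trace γ) (trace δ)) {z c : ℂ} (hc : c ∈ trace γ)
    (hside : ∀ w ∉ trace γ, winding γ w = winding γ z → w ∉ trace δ) :
    winding δ z = winding δ c := by
  -- The path from z to c follows a segment up to its first point c' on `γ`, then the curve `γ`
  -- itself. Before c' the segment stays on the side of z, so `δ` misses the whole path.
  obtain ⟨c', hc', -, hseg⟩ := hγ.exists_segment (z := z) (zero_mem_trace γ)
  rw [hδ.winding_eq_of_isPreconnected hγ.isPreconnected_trace hd hc hc']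
  refine hδ.winding_eq_of_isPreconnected (convex_segment z c').isPreconnected
    (disjoint_left.2 fun w hw => ?_) (left_mem_segment ℝ z c') (right_mem_segment ℝ z c')
  by_cases hwc : w = c'
  · rw [hwc]
    exact disjoint_left.1 hd hc'
  · have hw' := hseg ⟨hw, hwc⟩
    refine hside w hw' ?_
    refine hγ.winding_eq_of_isPreconnected (convex_segment z w).isPreconnected
      (disjoint_left.2 fun u hu hut => ?_) (right_mem_segment ℝ z w) (left_mem_segment ℝ z w)
    by_cases huc : u = c'
    · subst huc
      have h1 : segment ℝ z w ⊆ segment ℝ z u :=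
        (convex_segment z u).segment_subset (left_mem_segment ℝ z u) hw
      -- `u` between `z` and `w`, `w` between `z` and `u`
      have hw2 : Wbtw ℝ z w u := by rwa [← mem_segment_iff_wbtw]
      have hu2 : Wbtw ℝ z u w := by rwa [← mem_segment_iff_wbtw]
      exact hwc ((Wbtw.swap_right_iff hw2).1 hu2)
    · exact hseg ⟨(convex_segment z c').segment_subset (left_mem_segment ℝ z c') hw hu, huc⟩ hut

theorem mem_inside_iff (hγ : IsSimpleWinding γ) {z : ℂ} :
    z ∈ inside γ ↔ z ∉ trace γ ∧ winding γ z = 1 := by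
  refine ⟨fun h => ⟨h.1, (hγ.winding_eq z h.1).resolve_left h.2⟩, fun h => ⟨h.1, ?_⟩⟩
  rw [h.2]
  exact one_ne_zero

theorem winding_eq_of_disjoint_inside (hγ : IsSimpleWinding γ) (hδ : IsSimpleWinding δ)
    (hd : Disjoint (trace δ) (trace γ ∪ inside γ)) {z c : ℂ} (hz : z ∈ inside γ)
    (hc : c ∈ trace γ) : winding δ z = winding δ c := by
  rw [disjoint_union_right] at hd
  refine winding_eq_of_side hγ hδ hd.1.symm hc fun w hw hwz hwd => ?_
  exact disjoint_left.1 hd.2 hwd ⟨hw, hwz ▸ hz.2⟩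

/-- No point with winding number 0 around it under `γ` lies on `δ`. A distant point of this kind
shows that `δ` has winding number 0 around the points of `γ`, and from there the value carries over
to every point not enclosed. -/
theorem winding_eq_zero_of_subset_inside (hγ : IsSimpleWinding γ) (hδ : IsSimpleWinding δ)
    (hd : trace δ ⊆ inside γ) {z : ℂ} (hz : z ∉ inside γ) : winding δ z = 0 := by
  have hd' : Disjoint (trace γ) (trace δ) := disjoint_left.2 fun w hw hw' => (hd hw').1 hw
  have key : ∀ w ∉ trace γ, winding γ w = 0 → ∀ c ∈ trace γ, winding δ w = winding δ c :=
    fun w hw hw0 c hc => winding_eq_of_side hγ hδ hd' hc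
      fun u hu hu0 hud => (hd hud).2 (hu0.trans hw0)
  obtain ⟨R, hR⟩ := hγ.exists_winding_eq_zero
  obtain ⟨R', hR'⟩ := hδ.exists_winding_eq_zero
  have hfar : max R R' < ‖((|max R R'| + 1 : ℝ) : ℂ)‖ := by
    rw [Complex.norm_real, Real.norm_eq_abs, abs_of_pos (by positivity)]
    linarith [le_abs_self (max R R')]
  have h1 := hR _ ((le_max_left _ _).trans_lt hfar)
  have h2 := hR' _ ((le_max_right _ _).trans_lt hfar)
  have hc0 : ∀ c ∈ trace γ, winding δ c = 0 := fun c hc => by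
    rw [← key _ h1.1 h1.2 c hc, h2.2]
  by_cases hzt : z ∈ trace γ
  · exact hc0 z hzt
  · have hz0 : winding γ z = 0 := by
      by_contra h0
      exact hz ⟨hzt, h0⟩
    rw [key z hzt hz0 _ (zero_mem_trace γ), hc0 _ (zero_mem_trace γ)]

end curve

/-! ### Rational functions and their contour integrals -/

open Polynomial in
/-- `f` is on `Y` a rational function without poles in `Y`. -/
def RegOn (Y : Set ℂ) (f : ℂ → ℂ) : Prop :=
  ∃ P Q : ℂ[X], (∀ b ∈ Y, Q.eval b ≠ 0) ∧ ∀ w ∈ Y, f w = P.eval w / Q.eval w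

section RegOn

open Polynomial

variable {Y : Set ℂ} {f g : ℂ → ℂ}

theorem RegOn.const (c : ℂ) : RegOn Y fun _ => c := ⟨C c, 1, by simp, by simp⟩

theorem RegOn.id : RegOn Y fun w => w := ⟨X, 1, by simp, by simp⟩

theorem RegOn.add (hf : RegOn Y f) (hg : RegOn Y g) : RegOn Y fun w => f w + g w := by
  obtain ⟨P, Q, hQ, hf⟩ := hf
  obtain ⟨P', Q', hQ', hg⟩ := hg
  refine ⟨P * Q' + Q * P', Q * Q', fun b hb => ?_, fun w hw => ?_⟩
  · rw [eval_mul]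
    exact mul_ne_zero (hQ b hb) (hQ' b hb)
  · simp only [hf w hw, hg w hw]
    rw [div_add_div _ _ (hQ w hw) (hQ' w hw)]
    simp

theorem RegOn.mul (hf : RegOn Y f) (hg : RegOn Y g) : RegOn Y fun w => f w * g w := by
  obtain ⟨P, Q, hQ, hf⟩ := hf
  obtain ⟨P', Q', hQ', hg⟩ := hg
  refine ⟨P * P', Q * Q', fun b hb => ?_, fun w hw => ?_⟩
  · rw [eval_mul]
    exact mul_ne_zero (hQ b hb) (hQ' b hb)
  · simp only [hf w hw, hg w hw]
    rw [div_mul_div_comm]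
    simp

theorem RegOn.inv (hf : RegOn Y f) (h0 : ∀ w ∈ Y, f w ≠ 0) : RegOn Y fun w => (f w)⁻¹ := by
  obtain ⟨P, Q, hQ, hf⟩ := hf
  refine ⟨Q, P, fun b hb hP => h0 b hb ?_, fun w hw => ?_⟩
  · rw [hf b hb, hP, zero_div]
  · simp only [hf w hw, inv_div]

theorem RegOn.div (hf : RegOn Y f) (hg : RegOn Y g) (h0 : ∀ w ∈ Y, g w ≠ 0) :
    RegOn Y fun w => f w / g w := by
  simpa only [div_eq_mul_inv] using hf.mul (hg.inv h0)

theorem RegOn.neg (hf : RegOn Y f) : RegOn Y fun w => -f w := by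
  simpa only [neg_one_mul] using (RegOn.const (-1)).mul hf

theorem RegOn.sub (hf : RegOn Y f) (hg : RegOn Y g) : RegOn Y fun w => f w - g w := by
  simpa only [sub_eq_add_neg] using hf.add hg.neg

theorem RegOn.pow (hf : RegOn Y f) (n : ℕ) : RegOn Y fun w => f w ^ n := by
  induction n with
  | zero => simpa only [pow_zero] using RegOn.const 1
  | succ n ih => simpa only [pow_succ] using ih.mul hf

theorem RegOn.continuousOn (hf : RegOn Y f) : ContinuousOn f Y := by
  obtain ⟨P, Q, hQ, hf⟩ := hf
  exact (P.continuous.continuousOn.div Q.continuous.continuousOn hQ).congr hf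

end RegOn

/-- The contour together with the points that it encloses. -/
def disc (γ : ℝ → ℂ) : Set ℂ := trace γ ∪ inside γ

section integrals

variable {γ : ℝ → ℂ}

theorem trace_subset_disc : trace γ ⊆ disc γ := subset_union_left

theorem winding_eq_zero_of_notMem_disc {z : ℂ} (hz : z ∉ disc γ) : winding γ z = 0 := by
  by_contra h
  exact hz (.inr ⟨fun h' => hz (.inl h'), h⟩)

theorem notMem_disc_iff {z : ℂ} : z ∉ disc γ ↔ z ∉ trace γ ∧ winding γ z = 0 := by
  refine ⟨fun h => ⟨fun h' => h (.inl h'), winding_eq_zero_of_notMem_disc h⟩, fun h h' => ?_⟩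
  rcases h' with h' | h'
  exacts [h.1 h', h'.2 h.2]

theorem continuousOn_inv_sub_pow {S : Set ℂ} {b : ℂ} (hb : b ∉ S) (n : ℕ) :
    ContinuousOn (fun w => ((w - b) ^ n)⁻¹) S :=
  ContinuousOn.inv₀ (by fun_prop) fun w hw => pow_ne_zero _
    (sub_ne_zero.2 fun h => hb (h ▸ hw))

theorem IsClosedCurve.curveInt_inv_sub_pow (h : IsClosedCurve γ) {b : ℂ} (hb : b ∉ trace γ)
    (n : ℕ) : curveInt γ (fun w => ((w - b) ^ (n + 2))⁻¹) = 0 := by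
  refine h.curveInt_eq_zero_of_hasDerivAt (F := fun w => -(n + 1 : ℂ)⁻¹ * ((w - b) ^ (n + 1))⁻¹)
    (continuousOn_inv_sub_pow hb _) fun w hw => ?_
  have hwb : w - b ≠ 0 := sub_ne_zero.2 fun h => hb (h ▸ hw)
  have h1 : HasDerivAt (fun w : ℂ => (w - b) ^ (n + 1)) (((n + 1 : ℕ) : ℂ) * (w - b) ^ n * 1) w := by
    exact ((hasDerivAt_id w).sub_const b).fun_pow (n + 1)
  have hn : ((n : ℂ) + 1) ≠ 0 := by exact_mod_cast n.succ_ne_zero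
  refine ((h1.fun_inv (pow_ne_zero _ hwb)).const_mul (-(n + 1 : ℂ)⁻¹)).congr_deriv ?_
  push_cast
  field_simp
  ring

theorem IsClosedCurve.curveInt_polynomial (h : IsClosedCurve γ) (P : Polynomial ℂ) :
    curveInt γ (fun w => P.eval w) = 0 := by
  induction P using Polynomial.induction_on' with
  | add p q hp hq =>
    simp only [Polynomial.eval_add]
    rw [h.curveInt_add p.continuous.continuousOn q.continuous.continuousOn, hp, hq, add_zero]
  | monomial n a =>
    simp only [Polynomial.eval_monomial]
    refine h.curveInt_eq_zero_of_hasDerivAt (F := fun w => a * (n + 1 : ℂ)⁻¹ * w ^ (n + 1))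
      (by fun_prop) fun w _ => ?_
    have hn : ((n : ℂ) + 1) ≠ 0 := by exact_mod_cast n.succ_ne_zero
    refine (((hasDerivAt_id w).fun_pow (n + 1)).const_mul (a * (n + 1 : ℂ)⁻¹)).congr_deriv ?_
    push_cast
    simp only [id_eq, mul_one]
    field_simp

theorem continuousOn_inv_multiset_prod {S : Set ℂ} {m : Multiset ℂ} (hm : ∀ b ∈ m, b ∉ S) :
    ContinuousOn (fun w => ((m.map fun b => w - b).prod)⁻¹) S := by
  refine ContinuousOn.inv₀ ?_ fun w hw h0 => ?_
  · refine (continuous_multiset_prod (f := fun b w => w - b) m fun b _ => by fun_prop).continuousOn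
  · rw [Multiset.prod_eq_zero_iff, Multiset.mem_map] at h0
    obtain ⟨b, hb, h⟩ := h0
    exact hm b hb (sub_eq_zero.1 h ▸ hw)

/-- Two distinct roots b, b' are separated by 1/((w - b)(w - b')) = (1/(w - b) - 1/(w - b'))/(b -
b'), which lowers the number of factors. If all roots coincide, a simple pole gives a winding
number, here 0, and a higher one has a primitive. -/
theorem IsClosedCurve.curveInt_inv_multiset_prod (h : IsClosedCurve γ) (m : Multiset ℂ)
    (hm : ∀ b ∈ m, b ∉ disc γ) : curveInt γ (fun w => ((m.map fun b => w - b).prod)⁻¹) = 0 := by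
  have hmt : ∀ b ∈ m, b ∉ trace γ := fun b hb => (notMem_disc_iff.1 (hm b hb)).1
  induction hk : m.card generalizing m with
  | zero =>
    rw [Multiset.card_eq_zero] at hk
    subst hk
    simpa using h.curveInt_polynomial 1
  | succ k ih =>
    obtain ⟨b, hb⟩ := Multiset.card_pos_iff_exists_mem.1 (by rw [hk]; exact k.succ_pos)
    by_cases hall : ∀ b' ∈ m, b' = b
    · rw [Multiset.eq_replicate.2 ⟨hk, hall⟩]
      simp only [Multiset.map_replicate, Multiset.prod_replicate]
      rcases k with _ | k
      · simp only [zero_add, pow_one]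
        rw [curveInt_inv_sub, winding_eq_zero_of_notMem_disc (hm b hb), mul_zero]
      · exact h.curveInt_inv_sub_pow (hmt b hb) k
    · push Not at hall
      obtain ⟨b', hb', hne⟩ := hall
      obtain ⟨m', rfl⟩ := Multiset.exists_cons_of_mem hb
      rw [Multiset.mem_cons] at hb'
      obtain ⟨m, rfl⟩ := Multiset.exists_cons_of_mem (hb'.resolve_left hne)
      simp only [Multiset.card_cons, Nat.add_right_cancel_iff] at hk
      have hs : ∀ c, c = b ∨ c = b' → (∀ a ∈ c ::ₘ m, a ∉ disc γ) ∧ ∀ a ∈ c ::ₘ m, a ∉ trace γ := by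
        intro c hc
        have : ∀ a ∈ c ::ₘ m, a ∈ b ::ₘ b' ::ₘ m := by
          intro a ha
          simp only [Multiset.mem_cons] at ha ⊢
          rcases hc with rfl | rfl <;> tauto
        exact ⟨fun a ha => hm a (this a ha), fun a ha => hmt a (this a ha)⟩
      have h1 := ih (b ::ₘ m) (hs b (.inl rfl)).1 (hs b (.inl rfl)).2 (by simp [hk])
      have h2 := ih (b' ::ₘ m) (hs b' (.inr rfl)).1 (hs b' (.inr rfl)).2 (by simp [hk])
      have hbb : b - b' ≠ 0 := sub_ne_zero.2 (Ne.symm hne)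
      calc _ = curveInt γ (fun w => (b - b')⁻¹ * (((b ::ₘ m).map fun a => w - a).prod)⁻¹
            + -(b - b')⁻¹ * (((b' ::ₘ m).map fun a => w - a).prod)⁻¹) := by
            refine curveInt_congr fun w hw => ?_
            have hwb : w - b ≠ 0 := sub_ne_zero.2 fun h => hmt b (by simp) (h ▸ hw)
            have hwb' : w - b' ≠ 0 := sub_ne_zero.2 fun h => hmt b' (by simp) (h ▸ hw)
            simp only [Multiset.map_cons, Multiset.prod_cons, mul_inv]
            field_simp
            ring
        _ = 0 := by
            rw [h.curveInt_add, curveInt_const_mul, curveInt_const_mul, h1, h2]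
            · simp
            · exact continuousOn_const.mul (continuousOn_inv_multiset_prod (hs b (.inl rfl)).2)
            · exact continuousOn_const.mul (continuousOn_inv_multiset_prod (hs b' (.inr rfl)).2)

/-- Division of the numerator by X - b cancels one factor of the denominator and leaves a term with
constant numerator. -/
theorem IsClosedCurve.curveInt_div_multiset_prod (h : IsClosedCurve γ) (m : Multiset ℂ)
    (hm : ∀ b ∈ m, b ∉ disc γ) (P : Polynomial ℂ) :
    curveInt γ (fun w => P.eval w * ((m.map fun b => w - b).prod)⁻¹) = 0 := by
  have hmt : ∀ b ∈ m, b ∉ trace γ := fun b hb => (notMem_disc_iff.1 (hm b hb)).1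
  induction m using Multiset.induction_on generalizing P with
  | empty => simpa using h.curveInt_polynomial P
  | cons b m ih =>
    have hm' : ∀ b ∈ m, b ∉ trace γ := fun b hb => hmt b (by simp [hb])
    have key := Polynomial.X_sub_C_mul_divByMonic_eq_sub_modByMonic P b
    rw [Polynomial.modByMonic_X_sub_C_eq_C_eval] at key
    calc _ = curveInt γ (fun w => (P /ₘ (Polynomial.X - Polynomial.C b)).eval w
            * ((m.map fun b => w - b).prod)⁻¹
            + P.eval b * (((b ::ₘ m).map fun b => w - b).prod)⁻¹) := by
          refine curveInt_congr fun w hw => ?_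
          have hwb : w - b ≠ 0 := sub_ne_zero.2 fun h => hmt b (by simp) (h ▸ hw)
          have hev := congrArg (Polynomial.eval w) key
          simp only [Polynomial.eval_mul, Polynomial.eval_sub, Polynomial.eval_X,
            Polynomial.eval_C] at hev
          have hP : P.eval w = (w - b) * (P /ₘ (Polynomial.X - Polynomial.C b)).eval w
            + P.eval b := by rw [hev]; ring
          simp only [Multiset.map_cons, Multiset.prod_cons, mul_inv]
          rw [hP]
          field_simp
      _ = 0 := by
          rw [h.curveInt_add, curveInt_const_mul, h.curveInt_inv_multiset_prod _ hm,
            ih (fun b hb => hm b (by simp [hb])) _ hm', mul_zero, add_zero]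
          · exact (Polynomial.continuous _).continuousOn.mul (continuousOn_inv_multiset_prod hm')
          · exact continuousOn_const.mul (continuousOn_inv_multiset_prod hmt)

/-- Cauchy's theorem for rational functions. -/
theorem IsClosedCurve.curveInt_eq_zero (h : IsClosedCurve γ) {f : ℂ → ℂ} (hf : RegOn (disc γ) f) :
    curveInt γ f = 0 := by
  obtain ⟨P, Q, hQ, hf⟩ := hf
  have hQ0 : Q ≠ 0 := by
    rintro rfl
    exact hQ _ (.inl (zero_mem_trace γ)) (by simp)
  have hroots : ∀ b ∈ Q.roots, b ∉ disc γ := fun b hb hb' =>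
    hQ b hb' (Polynomial.isRoot_of_mem_roots hb)
  have := h.curveInt_div_multiset_prod Q.roots hroots P
  rw [← mul_zero (Q.leadingCoeff)⁻¹, ← this, ← curveInt_const_mul]
  refine curveInt_congr fun w hw => ?_
  rw [hf w (.inl hw), (IsAlgClosed.splits Q).eval_eq_prod_roots w, div_eq_mul_inv, mul_inv]
  ring

/-- Cauchy's integral formula for rational functions. -/
theorem IsClosedCurve.curveInt_mul_inv_sub (h : IsClosedCurve γ) {f : ℂ → ℂ}
    (hf : RegOn (disc γ) f) {c : ℂ} (hc : c ∉ trace γ) :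
    curveInt γ (fun w => f w * (w - c)⁻¹) = 2 * Real.pi * Complex.I * winding γ c * f c := by
  by_cases hcd : c ∈ disc γ
  · obtain ⟨P, Q, hQ, hf⟩ := hf
    -- Up to denominators this is f(w) - f(c), so it is divisible by w - c.
    set R : Polynomial ℂ := Polynomial.C (Q.eval c) * P - Polynomial.C (P.eval c) * Q
    have hR : R.IsRoot c := by
      simp only [R, Polynomial.IsRoot, Polynomial.eval_sub, Polynomial.eval_mul, Polynomial.eval_C]
      ring
    rw [← Polynomial.mul_divByMonic_eq_iff_isRoot] at hR
    set S := R /ₘ (Polynomial.X - Polynomial.C c)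
    have hreg : RegOn (disc γ) fun w => S.eval w / (Q.eval w * Q.eval c) :=
      ⟨S, Q * Polynomial.C (Q.eval c), fun b hb => by simpa using ⟨hQ b hb, hQ c hcd⟩,
        fun w _ => by simp⟩
    have hfc : EqOn (fun w => f w * (w - c)⁻¹)
        (fun w => S.eval w / (Q.eval w * Q.eval c) + f c * (w - c)⁻¹) (trace γ) := by
      intro w hw
      have hwc : w - c ≠ 0 := sub_ne_zero.2 fun h => hc (h ▸ hw)
      have hev := congrArg (Polynomial.eval w) hR
      simp only [R, Polynomial.eval_mul, Polynomial.eval_sub, Polynomial.eval_X,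
        Polynomial.eval_C] at hev
      have h1 := hQ w (.inl hw)
      have h2 := hQ c hcd
      simp only
      rw [hf w (.inl hw), hf c hcd]
      field_simp
      linear_combination -hev
    rw [curveInt_congr hfc, h.curveInt_add (hreg.continuousOn.mono trace_subset_disc),
      curveInt_const_mul, curveInt_inv_sub, h.curveInt_eq_zero hreg]
    · ring
    · exact continuousOn_const.mul (by simpa using continuousOn_inv_sub_pow hc 1)
  · rw [winding_eq_zero_of_notMem_disc hcd, mul_zero, zero_mul]
    exact h.curveInt_eq_zero (hf.mul ((RegOn.id.sub (RegOn.const c)).inv fun w hw =>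
      sub_ne_zero.2 fun h => hcd (h ▸ hw)))

/-- Lagrange interpolation of the constant 1 at the nodes `c`, divided by the nodal polynomial. -/
theorem prod_inv_sub_eq_sum {ι : Type*} [DecidableEq ι] {s : Finset ι} (hs : s.Nonempty)
    {c : ι → ℂ} (hc : InjOn c s) {w : ℂ} (hw : ∀ i ∈ s, w ≠ c i) :
    ∏ i ∈ s, (w - c i)⁻¹ = ∑ i ∈ s, (∏ k ∈ s.erase i, (c i - c k)⁻¹) * (w - c i)⁻¹ := by
  have h1 := Lagrange.eval_interpolate_not_at_node (s := s) (v := c) (fun _ => 1) hw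
  have h2 : (Lagrange.interpolate s c) (fun _ => 1) = 1 := by
    simp only [Lagrange.interpolate_apply, map_one, one_mul]
    exact Lagrange.sum_basis hc hs
  rw [h2, Polynomial.eval_one, Lagrange.eval_nodal] at h1
  have h3 : ∏ i ∈ s, (w - c i) ≠ 0 := Finset.prod_ne_zero_iff.2 fun i hi => sub_ne_zero.2 (hw i hi)
  rw [Finset.prod_inv_distrib, inv_eq_of_mul_eq_one_right h1.symm]
  refine Finset.sum_congr rfl fun i _ => ?_
  rw [Lagrange.nodalWeight, mul_one]

/-- The residue theorem for rational functions with simple poles. -/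
theorem IsClosedCurve.curveInt_mul_prod_inv_sub (h : IsClosedCurve γ) {f : ℂ → ℂ}
    (hf : RegOn (disc γ) f) {ι : Type*} [DecidableEq ι] (s : Finset ι) {c : ι → ℂ}
    (hc : InjOn c s) (hct : ∀ i ∈ s, c i ∉ trace γ) :
    curveInt γ (fun w => f w * ∏ i ∈ s, (w - c i)⁻¹) = 2 * Real.pi * Complex.I *
      ∑ i ∈ s, winding γ (c i) * f (c i) * ∏ k ∈ s.erase i, (c i - c k)⁻¹ := by
  rcases s.eq_empty_or_nonempty with rfl | hs
  · simpa using h.curveInt_eq_zero hf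
  have hft := hf.continuousOn.mono trace_subset_disc
  calc _ = curveInt γ (fun w => ∑ i ∈ s, (∏ k ∈ s.erase i, (c i - c k)⁻¹)
        * (f w * (w - c i)⁻¹)) := by
        refine curveInt_congr fun w hw => ?_
        rw [prod_inv_sub_eq_sum hs hc fun i hi h => hct i hi (h ▸ hw), Finset.mul_sum]
        exact Finset.sum_congr rfl fun i _ => by ring
    _ = _ := by
        rw [h.curveInt_sum, Finset.mul_sum]
        · refine Finset.sum_congr rfl fun i hi => ?_
          rw [curveInt_const_mul, h.curveInt_mul_inv_sub hf (hct i hi)]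
          ring
        · exact fun i hi => continuousOn_const.mul
            (hft.mul (by simpa using continuousOn_inv_sub_pow (hct i hi) 1))

/-- By the degree bound, expansion in powers of w - 1 leaves only exponents at most -2, and these
have primitives. -/
theorem curveInt_poly_div_pow (h : IsClosedCurve γ) (h1 : (1 : ℂ) ∉ trace γ) (m : ℕ)
    (P : Polynomial ℂ) (hP : P.degree < m) :
    curveInt γ (fun w => P.eval w * ((w - 1) ^ (m + 1))⁻¹) = 0 := by
  induction m generalizing P with
  | zero =>
    have : P = 0 := by
      rw [← Polynomial.degree_eq_bot]
      exact Nat.WithBot.lt_zero_iff.1 (by simpa using hP)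
    simp [this, curveInt_zero]
  | succ m ih =>
    have key := Polynomial.X_sub_C_mul_divByMonic_eq_sub_modByMonic P 1
    rw [Polynomial.modByMonic_X_sub_C_eq_C_eval] at key
    set P' := P /ₘ (Polynomial.X - Polynomial.C 1)
    have hdeg : P'.degree < m := by
      by_cases hP0 : P' = 0
      · rw [hP0, Polynomial.degree_zero]
        exact WithBot.bot_lt_coe m
      have hPne : P ≠ 0 := by
        rintro rfl
        exact hP0 (by simp [P'])
      have h2 := Polynomial.natDegree_divByMonic P (Polynomial.monic_X_sub_C (1 : ℂ))
      rw [Polynomial.natDegree_X_sub_C] at h2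
      rw [Polynomial.degree_eq_natDegree hP0]
      have h4 : P.natDegree < m + 1 := by
        rw [Polynomial.degree_eq_natDegree hPne] at hP
        exact_mod_cast hP
      have h5 : P.natDegree ≠ 0 := by
        intro h0
        refine hP0 ((Polynomial.divByMonic_eq_zero_iff (Polynomial.monic_X_sub_C 1)).2 ?_)
        rw [Polynomial.degree_X_sub_C, Polynomial.degree_eq_natDegree hPne, h0]
        norm_num
      have : P'.natDegree < m := by
        change (P /ₘ _).natDegree < m
        omega
      exact_mod_cast this
    calc _ = curveInt γ (fun w => P'.eval w * ((w - 1) ^ (m + 1))⁻¹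
          + P.eval 1 * ((w - 1) ^ (m + 2))⁻¹) := by
          refine curveInt_congr fun w hw => ?_
          have hwb : w - 1 ≠ 0 := sub_ne_zero.2 fun h => h1 (h ▸ hw)
          have hev := congrArg (Polynomial.eval w) key
          simp only [Polynomial.eval_mul, Polynomial.eval_sub, Polynomial.eval_X,
            Polynomial.eval_C] at hev
          have hP : P.eval w = (w - 1) * P'.eval w + P.eval 1 := by rw [hev]; ring
          rw [hP, pow_succ _ (m + 1)]
          field_simp
      _ = 0 := by
          rw [h.curveInt_add, ih _ hdeg, curveInt_const_mul, h.curveInt_inv_sub_pow h1,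
            mul_zero, add_zero]
          · exact (Polynomial.continuous _).continuousOn.mul (continuousOn_inv_sub_pow h1 _)
          · exact continuousOn_const.mul (continuousOn_inv_sub_pow h1 _)

/-- Partial fractions for 1/((w - 1)(w - b)) give a recursion in the order of the pole at 1; the
winding number around 1 enters only at its first step. -/
theorem curveInt_inv_pow_mul_inv_sub (h : IsClosedCurve γ) (h1 : (1 : ℂ) ∉ trace γ)
    (h1w : winding γ 1 = 1) {b : ℂ} (hb : b ∉ disc γ) (m : ℕ) :
    curveInt γ (fun w => ((w - 1) ^ (m + 1))⁻¹ * (w - b)⁻¹)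
      = -(2 * Real.pi * Complex.I) * ((b - 1) ^ (m + 1))⁻¹ := by
  obtain ⟨hbt, hbw⟩ := notMem_disc_iff.1 hb
  have hb1 : b - 1 ≠ 0 := sub_ne_zero.2 fun h' => by
    rw [h', h1w] at hbw
    exact one_ne_zero hbw
  have hcb : ContinuousOn (fun w => (w - b)⁻¹) (trace γ) := by
    simpa using continuousOn_inv_sub_pow hbt 1
  have hstep : ∀ m : ℕ, curveInt γ (fun w => ((w - 1) ^ (m + 1))⁻¹ * (w - b)⁻¹)
      = (b - 1)⁻¹ * (curveInt γ (fun w => ((w - 1) ^ m)⁻¹ * (w - b)⁻¹)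
        + -1 * curveInt γ (fun w => ((w - 1) ^ (m + 1))⁻¹)) := by
    intro m
    rw [← curveInt_const_mul, ← h.curveInt_add (f := fun w => ((w - 1) ^ m)⁻¹ * (w - b)⁻¹)
      (g := fun w => -1 * ((w - 1) ^ (m + 1))⁻¹) ((continuousOn_inv_sub_pow h1 _).mul hcb)
      (continuousOn_const.mul (continuousOn_inv_sub_pow h1 _)), ← curveInt_const_mul]
    refine curveInt_congr fun w hw => ?_
    have hw1 : w - 1 ≠ 0 := sub_ne_zero.2 fun h => h1 (h ▸ hw)
    have hwb : w - b ≠ 0 := sub_ne_zero.2 fun h => hbt (h ▸ hw)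
    simp only [pow_succ]
    field_simp
    ring
  induction m with
  | zero =>
    rw [hstep 0]
    simp only [pow_zero, inv_one, one_mul, zero_add, pow_one]
    rw [curveInt_inv_sub, curveInt_inv_sub, hbw, h1w]
    ring
  | succ m ih =>
    rw [hstep (m + 1), ih, h.curveInt_inv_sub_pow h1 m, pow_succ _ (m + 1), mul_inv]
    ring

/-- A rational function that is `O(w⁻²)` at infinity, whose only pole inside the contour is `1`, is
integrated by the residues at its simple poles outside. -/
theorem curveInt_eq_sum_outside (h : IsClosedCurve γ) (h1 : (1 : ℂ) ∉ trace γ)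
    (h1w : winding γ 1 = 1) {ι : Type*} [DecidableEq ι] (s : Finset ι) {b : ι → ℂ}
    (hb : InjOn b s) (hbd : ∀ i ∈ s, b i ∉ disc γ) (m : ℕ) (P : Polynomial ℂ)
    (hP : P.degree < (m + s.card : ℕ)) :
    curveInt γ (fun w => P.eval w * ((w - 1) ^ (m + 1))⁻¹ * ∏ i ∈ s, (w - b i)⁻¹)
      = -(2 * Real.pi * Complex.I) * ∑ i ∈ s, P.eval (b i) * ((b i - 1) ^ (m + 1))⁻¹
          * ∏ k ∈ s.erase i, (b i - b k)⁻¹ := by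
  have hbt : ∀ i ∈ s, b i ∉ trace γ := fun i hi => (notMem_disc_iff.1 (hbd i hi)).1
  have hmon : (Lagrange.nodal s b).Monic := Lagrange.nodal_monic
  -- `P` is divided by the nodal polynomial. The quotient has degree below m and integrates to zero;
  -- the remainder interpolates `P` at the outer poles and supplies the residues.
  set N := Lagrange.nodal s b
  have hdegN : N.degree = s.card := Lagrange.degree_nodal
  have hmod : (P %ₘ N) = (Lagrange.interpolate s b) (fun i => P.eval (b i)) := by
    refine Lagrange.eq_interpolate_of_eval_eq _ hb ?_ fun i hi => ?_
    · rw [← hdegN]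
      exact Polynomial.degree_modByMonic_lt _ hmon
    · have := congrArg (Polynomial.eval (b i)) (Polynomial.modByMonic_add_div P N)
      rw [Polynomial.eval_add, Polynomial.eval_mul, Lagrange.eval_nodal_at_node hi, zero_mul,
        add_zero] at this
      exact this
  have hdiv : (P /ₘ N).degree < m := by
    by_cases hlt : P.degree < N.degree
    · rw [(Polynomial.divByMonic_eq_zero_iff hmon).2 hlt, Polynomial.degree_zero]
      exact WithBot.bot_lt_coe m
    · have h2 := Polynomial.degree_add_divByMonic hmon (not_lt.1 hlt)
      rw [hdegN] at h2
      rw [← h2, Nat.cast_add, add_comm (m : WithBot ℕ)] at hP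
      exact lt_of_add_lt_add_left hP
  calc _ = curveInt γ (fun w => (P /ₘ N).eval w * ((w - 1) ^ (m + 1))⁻¹
        + ∑ i ∈ s, (P.eval (b i) * ∏ k ∈ s.erase i, (b i - b k)⁻¹)
          * (((w - 1) ^ (m + 1))⁻¹ * (w - b i)⁻¹)) := by
        refine curveInt_congr fun w hw => ?_
        have hwb : ∀ i ∈ s, w ≠ b i := fun i hi h => hbt i hi (h ▸ hw)
        have hN0 : N.eval w ≠ 0 := by
          rw [Lagrange.eval_nodal]
          exact Finset.prod_ne_zero_iff.2 fun i hi => sub_ne_zero.2 (hwb i hi)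
        have hev := congrArg (Polynomial.eval w) (Polynomial.modByMonic_add_div P N)
        rw [Polynomial.eval_add, Polynomial.eval_mul, hmod,
          Lagrange.eval_interpolate_not_at_node _ hwb] at hev
        rw [← hev, Finset.prod_inv_distrib, ← Lagrange.eval_nodal]
        change (N.eval w * _ + N.eval w * _) * _ * (N.eval w)⁻¹ = _
        have : ∑ i ∈ s, (P.eval (b i) * ∏ k ∈ s.erase i, (b i - b k)⁻¹)
            * (((w - 1) ^ (m + 1))⁻¹ * (w - b i)⁻¹) = ((w - 1) ^ (m + 1))⁻¹ *
            ∑ i ∈ s, Lagrange.nodalWeight s b i * (w - b i)⁻¹ * P.eval (b i) := by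
          rw [Finset.mul_sum]
          exact Finset.sum_congr rfl fun i _ => by rw [Lagrange.nodalWeight]; ring
        rw [this]
        field_simp
        ring
    _ = _ := by
        have hc : ∀ i ∈ s, ContinuousOn (fun w => (P.eval (b i) * ∏ k ∈ s.erase i, (b i - b k)⁻¹)
          * (((w - 1) ^ (m + 1))⁻¹ * (w - b i)⁻¹)) (trace γ) := fun i hi =>
          continuousOn_const.mul ((continuousOn_inv_sub_pow h1 _).mul
            (by simpa using continuousOn_inv_sub_pow (hbt i hi) 1))
        rw [h.curveInt_add (f := fun w => (P /ₘ N).eval w * ((w - 1) ^ (m + 1))⁻¹)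
          ((Polynomial.continuous _).continuousOn.mul
          (continuousOn_inv_sub_pow h1 _)) (continuousOn_finsetSum _ hc), h.curveInt_sum _ hc,
          curveInt_poly_div_pow h h1 m _ hdiv, zero_add, Finset.mul_sum]
        refine Finset.sum_congr rfl fun i hi => ?_
        rw [curveInt_const_mul, curveInt_inv_pow_mul_inv_sub h h1 h1w (hbd i hi)]
        ring

end integrals

/-! ### Nested contour integrals -/

/-- The curve is extended constantly beyond [0, 1] and its velocity is cut off where it exceeds an
almost everywhere bound. No integral changes, but the points become continuous and the velocities
bounded and measurable everywhere, as needed for Fubini. -/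
theorem IsClosedCurve.exists_parametrization {γ : ℝ → ℂ} (h : IsClosedCurve γ) :
    ∃ (c g : ℝ → ℂ) (K : ℝ), Continuous c ∧ (∀ s, c s ∈ trace γ) ∧ Measurable g ∧
      (∀ s, ‖g s‖ ≤ K) ∧ ∀ f, curveInt γ f = ∫ s, f (c s) * g s ∂volume.restrict (Ioc 0 1) := by
  obtain ⟨K, hK0, hK⟩ := h.exists_ae_bound
  have hm : Measurable (deriv γ) := measurable_deriv γ
  refine ⟨fun s => γ (projIcc (0 : ℝ) 1 zero_le_one s),
    fun s => if ‖deriv γ s‖ ≤ K then deriv γ s else 0, K, ?_, ?_, ?_, ?_, ?_⟩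
  · exact h.continuousOn.comp_continuous (by fun_prop) fun s => Subtype.prop _
  · exact fun s => mem_trace_of_mem (Subtype.prop _)
  · exact Measurable.ite (measurableSet_le hm.norm measurable_const) hm measurable_const
  · intro s
    dsimp only
    split_ifs with h
    · exact h
    · simpa using hK0
  · intro f
    rw [curveInt, intervalIntegral.integral_of_le zero_le_one]
    refine setIntegral_congr_ae measurableSet_Ioc ?_
    filter_upwards [hK] with s hs hs'
    rw [if_pos (hs hs').2, projIcc_of_mem zero_le_one (Ioc_subset_Icc_self hs')]

/-- The product of the contours. -/
def torus {N : ℕ} (C : Fin N → ℝ → ℂ) : Set (Fin N → ℂ) := {w | ∀ i, w i ∈ trace (C i)}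

section nested

variable {N : ℕ} {C : Fin N → ℝ → ℂ}

theorem cons_mem_torus {C : Fin (N + 1) → ℝ → ℂ} {w : ℂ} (hw : w ∈ trace (C 0)) {v : Fin N → ℂ}
    (hv : v ∈ torus fun i => C i.succ) : (Fin.cons w v : Fin (N + 1) → ℂ) ∈ torus C := by
  intro i
  refine Fin.cases ?_ (fun j => ?_) i
  · simpa using hw
  · simpa using hv j

theorem update_mem_torus {w : Fin N → ℂ} (hw : w ∈ torus C) {p : Fin N} {z : ℂ}
    (hz : z ∈ trace (C p)) : Function.update w p z ∈ torus C := by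
  intro i
  by_cases h : i = p
  · subst h
    simpa using hz
  · simpa [h] using hw i

theorem nestedInt_congr {f g : (Fin N → ℂ) → ℂ} (h : EqOn f g (torus C)) :
    nestedInt C f = nestedInt C g := by
  induction N with
  | zero => exact h fun i => i.elim0
  | succ N ih =>
    simp only [nestedInt]
    congr 1
    exact curveInt_congr fun w hw => ih fun v hv => h (cons_mem_torus hw hv)

theorem nestedInt_const_mul (c : ℂ) (f : (Fin N → ℂ) → ℂ) :
    nestedInt C (fun w => c * f w) = c * nestedInt C f := by
  induction N with
  | zero => rfl
  | succ N ih =>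
    simp only [nestedInt, ih, curveInt_const_mul]
    ring

theorem nestedInt_zero : nestedInt C (fun _ => 0) = 0 := by
  simpa using nestedInt_const_mul (C := C) 0 fun _ => 0

theorem nestedInt_prod (f : Fin N → ℂ → ℂ) : nestedInt C (fun w => ∏ i, f i (w i))
    = ∏ i, ((2 * Real.pi * Complex.I)⁻¹ * curveInt (C i) (f i)) := by
  induction N with
  | zero => simp [nestedInt]
  | succ N ih =>
    simp only [nestedInt, Fin.prod_univ_succ, Fin.cons_zero, Fin.cons_succ, nestedInt_const_mul]
    rw [ih (C := fun i => C i.succ) fun i => f i.succ]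
    rw [curveInt_congr (g := fun w => (∏ i : Fin N, ((2 * Real.pi * Complex.I)⁻¹
      * curveInt (C i.succ) (f i.succ))) * f 0 w) fun w _ => mul_comm _ _, curveInt_const_mul]
    ring

theorem exists_norm_nestedInt_le (hC : ∀ i, IsClosedCurve (C i)) :
    ∃ K, 0 ≤ K ∧ ∀ (f : (Fin N → ℂ) → ℂ) (B : ℝ), (∀ w ∈ torus C, ‖f w‖ ≤ B) →
      ‖nestedInt C f‖ ≤ K * B := by
  induction N with
  | zero => exact ⟨1, zero_le_one, fun f B h => by
      simpa [nestedInt] using h _ fun i => i.elim0⟩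
  | succ N ih =>
    obtain ⟨K, hK0, hK⟩ := ih fun i => hC i.succ
    obtain ⟨L, hL0, hL⟩ := (hC 0).norm_curveInt_le
    refine ⟨‖(2 * Real.pi * Complex.I : ℂ)⁻¹‖ * (L * K), by positivity, fun f B h => ?_⟩
    rw [nestedInt, norm_mul, mul_assoc ‖_‖ (L * K), mul_assoc L]
    refine mul_le_mul_of_nonneg_left (hL _ _ fun w hw => ?_) (norm_nonneg _)
    exact hK _ _ fun v hv => h _ (cons_mem_torus hw hv)

/-- The measure on the parameters of the contours. -/
abbrev paramMeasure : Measure ℝ := volume.restrict (Ioc 0 1)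

/-- The data of `IsClosedCurve.exists_parametrization` for a family of curves. -/
structure Parametrization (C : Fin N → ℝ → ℂ) where
  /-- the points -/
  c : Fin N → ℝ → ℂ
  /-- the velocities -/
  g : Fin N → ℝ → ℂ
  /-- bounds for the velocities -/
  K : Fin N → ℝ
  continuous : ∀ i, Continuous (c i)
  mem : ∀ i s, c i s ∈ trace (C i)
  measurable : ∀ i, Measurable (g i)
  bound : ∀ i s, ‖g i s‖ ≤ K i
  curveInt_eq : ∀ i f, curveInt (C i) f = ∫ s, f (c i s) * g i s ∂paramMeasure

theorem exists_parametrization (hC : ∀ i, IsClosedCurve (C i)) :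
    Nonempty (Parametrization C) := by
  choose c g K h1 h2 h3 h4 h5 using fun i => (hC i).exists_parametrization
  exact ⟨⟨c, g, K, h1, h2, h3, h4, h5⟩⟩

namespace Parametrization

/-- The point of the torus with the given parameters. -/
def point (P : Parametrization C) (s : Fin N → ℝ) : Fin N → ℂ := fun i => P.c i (s i)

/-- The integrand in terms of the parameters. -/
def pull (P : Parametrization C) (f : (Fin N → ℂ) → ℂ) (s : Fin N → ℝ) : ℂ :=
  f (P.point s) * ∏ i, P.g i (s i)

theorem point_mem (P : Parametrization C) (s : Fin N → ℝ) : P.point s ∈ torus C :=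
  fun i => P.mem i (s i)

theorem continuous_point (P : Parametrization C) : Continuous P.point :=
  continuous_pi fun i => (P.continuous i).comp (continuous_apply i)

theorem norm_prod_le (P : Parametrization C) (s : Fin N → ℝ) :
    ‖∏ i, P.g i (s i)‖ ≤ ∏ i, P.K i := by
  rw [norm_prod]
  exact Finset.prod_le_prod (fun _ _ => norm_nonneg _) fun i _ => P.bound i (s i)

end Parametrization

theorem isCompact_torus (hC : ∀ i, IsClosedCurve (C i)) : IsCompact (torus C) := by
  have : torus C = univ.pi fun i => trace (C i) := by
    ext w
    simp [torus]
  rw [this]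
  exact isCompact_univ_pi fun i => (hC i).isCompact_trace

theorem Parametrization.integrable (P : Parametrization C) (hC : ∀ i, IsClosedCurve (C i))
    {f : (Fin N → ℂ) → ℂ} (hf : ContinuousOn f (torus C)) :
    Integrable (P.pull f) (Measure.pi fun _ => paramMeasure) := by
  have hc : Continuous fun s => f (P.point s) :=
    hf.comp_continuous P.continuous_point P.point_mem
  obtain ⟨B, hB⟩ := (isCompact_torus hC).exists_bound_of_continuousOn hf
  refine ⟨?_, HasFiniteIntegral.of_bounded (C := |B| * ∏ i, P.K i) (Eventually.of_forall
    fun s => ?_)⟩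
  · refine hc.aestronglyMeasurable.mul (Measurable.aestronglyMeasurable ?_)
    exact Finset.measurable_prod _ fun i _ => (P.measurable i).comp (measurable_pi_apply i)
  · rw [Parametrization.pull, norm_mul]
    exact mul_le_mul ((hB _ (P.point_mem s)).trans (le_abs_self _)) (P.norm_prod_le s)
      (norm_nonneg _) (abs_nonneg _)

theorem integral_pi_eq_insertNth {μ : Measure ℝ} [SigmaFinite μ] (p : Fin (N + 1))
    (F : (Fin (N + 1) → ℝ) → ℂ) :
    ∫ s, F s ∂(Measure.pi fun _ => μ)
      = ∫ x, F (p.insertNth x.1 x.2) ∂(μ.prod (Measure.pi fun _ : Fin N => μ)) := by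
  have h := (measurePreserving_piFinSuccAbove (fun _ : Fin (N + 1) => μ) p).symm
  rw [← h.integral_comp (MeasurableEquiv.measurableEmbedding _)]
  rfl

theorem integrable_insertNth {μ : Measure ℝ} [SigmaFinite μ] (p : Fin (N + 1))
    {F : (Fin (N + 1) → ℝ) → ℂ} (hF : Integrable F (Measure.pi fun _ => μ)) :
    Integrable (fun x : ℝ × (Fin N → ℝ) => F (p.insertNth x.1 x.2))
      (μ.prod (Measure.pi fun _ : Fin N => μ)) := by
  have h := (measurePreserving_piFinSuccAbove (fun _ : Fin (N + 1) => μ) p).symm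
  exact (h.integrable_comp_emb (MeasurableEquiv.measurableEmbedding _)).2 hF

/-- The passage from iterated integrals to one integral over a finite product measure. Additivity,
exchange of variables and differentiation under the integral are inherited through it. -/
theorem nestedInt_eq_integral (P : Parametrization C) (hC : ∀ i, IsClosedCurve (C i))
    {f : (Fin N → ℂ) → ℂ} (hf : ContinuousOn f (torus C)) :
    nestedInt C f = (2 * Real.pi * Complex.I)⁻¹ ^ N *
      ∫ s, P.pull f s ∂(Measure.pi fun _ => paramMeasure) := by
  induction N with
  | zero =>
    rw [Measure.pi_of_empty _ (fun i => i.elim0), integral_dirac]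
    simp only [nestedInt, Parametrization.pull, pow_zero, Finset.univ_eq_empty, Finset.prod_empty,
      mul_one, one_mul]
    congr 1
    exact Subsingleton.elim _ _
  | succ N ih =>
    set P' : Parametrization fun i : Fin N => C i.succ :=
      ⟨fun i => P.c i.succ, fun i => P.g i.succ, fun i => P.K i.succ, fun i => P.continuous _,
        fun i => P.mem _, fun i => P.measurable _, fun i => P.bound _, fun i => P.curveInt_eq _⟩
    rw [integral_pi_eq_insertNth 0, integral_prod _ (integrable_insertNth 0 (P.integrable hC hf)),
      nestedInt, P.curveInt_eq, pow_succ', mul_assoc (2 * Real.pi * Complex.I : ℂ)⁻¹]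
    congr 1
    rw [← integral_const_mul]
    refine integral_congr_ae (Eventually.of_forall fun s => ?_)
    simp only
    rw [ih P' (fun i => hC i.succ), mul_assoc, mul_comm (∫ s, _ ∂_) _, ← integral_const_mul]
    · congr 2
      ext s'
      simp only [Parametrization.pull, Fin.prod_univ_succ, Fin.insertNth_zero, Fin.cons_zero,
        Fin.cons_succ]
      rw [mul_left_comm]
      congr 2
      ext i
      refine Fin.cases ?_ (fun j => ?_) i <;> simp [Parametrization.point, P']
    · refine hf.comp ?_ fun v hv => cons_mem_torus (P.mem 0 s) hv
      refine Continuous.continuousOn (continuous_pi fun i => ?_)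
      refine Fin.cases ?_ (fun j => ?_) i
      · simpa using continuous_const
      · simpa using continuous_apply j

theorem nestedInt_add (hC : ∀ i, IsClosedCurve (C i)) {f g : (Fin N → ℂ) → ℂ}
    (hf : ContinuousOn f (torus C)) (hg : ContinuousOn g (torus C)) :
    nestedInt C (fun w => f w + g w) = nestedInt C f + nestedInt C g := by
  obtain ⟨P⟩ := exists_parametrization hC
  have hfg : ContinuousOn (fun w => f w + g w) (torus C) := hf.add hg
  rw [nestedInt_eq_integral P hC hf, nestedInt_eq_integral P hC hg,
    nestedInt_eq_integral P hC hfg, ← mul_add,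
    ← integral_add (P.integrable hC hf) (P.integrable hC hg)]
  simp only [Parametrization.pull, add_mul]

theorem nestedInt_sum (hC : ∀ i, IsClosedCurve (C i)) {ι : Type*} (s : Finset ι)
    {f : ι → (Fin N → ℂ) → ℂ} (hf : ∀ i ∈ s, ContinuousOn (f i) (torus C)) :
    nestedInt C (fun w => ∑ i ∈ s, f i w) = ∑ i ∈ s, nestedInt C (f i) := by
  classical
  induction s using Finset.induction_on with
  | empty => simpa using nestedInt_zero
  | insert a s ha ih =>
    simp only [Finset.sum_insert ha]
    rw [nestedInt_add hC (hf a (by simp)) (continuousOn_finsetSum _ fun i hi => hf i (by simp [hi])),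
      ih fun i hi => hf i (by simp [hi])]

/-- A nested integral only depends on the integral over any one of the variables. -/
theorem nestedInt_congr_curveInt (hC : ∀ i, IsClosedCurve (C i)) (p : Fin N)
    {f g : (Fin N → ℂ) → ℂ} (hf : ContinuousOn f (torus C)) (hg : ContinuousOn g (torus C))
    (h : ∀ w ∈ torus C, curveInt (C p) (fun z => f (Function.update w p z))
      = curveInt (C p) (fun z => g (Function.update w p z))) :
    nestedInt C f = nestedInt C g := by
  obtain ⟨P⟩ := exists_parametrization hC
  rw [nestedInt_eq_integral P hC hf, nestedInt_eq_integral P hC hg]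
  congr 1
  obtain ⟨N, rfl⟩ : ∃ n, N = n + 1 := ⟨N - 1, by have := p.pos; omega⟩
  -- Fubini makes the variable `p` the innermost one.
  rw [integral_pi_eq_insertNth p, integral_pi_eq_insertNth p,
    integral_prod_symm _ (integrable_insertNth p (P.integrable hC hf)),
    integral_prod_symm _ (integrable_insertNth p (P.integrable hC hg))]
  refine integral_congr_ae (Eventually.of_forall fun s' => ?_)
  have key : ∀ k : (Fin (N + 1) → ℂ) → ℂ, ∫ s, P.pull k (p.insertNth s s') ∂paramMeasure
      = curveInt (C p) (fun z => k (Function.update (P.point (p.insertNth 0 s')) p z))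
        * ∏ j : Fin N, P.g (p.succAbove j) (s' j) := by
    intro k
    rw [P.curveInt_eq, ← integral_mul_const]
    congr 1
    ext s
    rw [Parametrization.pull, Fin.prod_univ_succAbove _ p]
    simp only [Fin.insertNth_apply_same, Fin.insertNth_apply_succAbove]
    rw [← mul_assoc]
    congr 3
    ext i
    refine Fin.succAboveCases p ?_ (fun j => ?_) i <;> simp [Parametrization.point]
  simp only
  rw [key, key, h _ (P.point_mem _)]

theorem nestedInt_eq_zero (hC : ∀ i, IsClosedCurve (C i)) (p : Fin N) {f : (Fin N → ℂ) → ℂ}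
    (hf : ContinuousOn f (torus C))
    (h : ∀ w ∈ torus C, curveInt (C p) (fun z => f (Function.update w p z)) = 0) :
    nestedInt C f = 0 := by
  rw [nestedInt_congr_curveInt hC p hf (g := fun _ => 0) continuousOn_const
    fun w hw => by rw [h w hw, curveInt_zero], nestedInt_zero]

theorem hasDerivAt_nestedInt_exp (hC : ∀ i, IsClosedCurve (C i)) {g E : (Fin N → ℂ) → ℂ}
    (hg : ContinuousOn g (torus C)) (hE : ContinuousOn E (torus C)) (t : ℝ) :
    HasDerivAt (fun t : ℝ => nestedInt C fun w => g w * Complex.exp (E w * t))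
      (nestedInt C fun w => E w * (g w * Complex.exp (E w * t))) t := by
  obtain ⟨P⟩ := exists_parametrization hC
  have hc : ∀ t : ℝ, ContinuousOn (fun w => g w * Complex.exp (E w * t)) (torus C) :=
    fun t => hg.mul ((hE.mul continuousOn_const).cexp)
  have hc' : ContinuousOn (fun w => E w * (g w * Complex.exp (E w * t))) (torus C) := hE.mul (hc t)
  simp only [fun t => nestedInt_eq_integral P hC (hc t), nestedInt_eq_integral P hC hc']
  refine HasDerivAt.const_mul _ ?_
  obtain ⟨L, hL⟩ := (isCompact_torus hC).exists_bound_of_continuousOn hE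
  obtain ⟨G, hG⟩ := (isCompact_torus hC).exists_bound_of_continuousOn hg
  -- For |u - t| < 1 the exponential is bounded by exp(|L| (|t| + 1)), which gives a constant
  -- dominating function.
  refine (hasDerivAt_integral_of_dominated_loc_of_deriv_le (s := Metric.ball t 1)
    (bound := fun _ => |L| * (|G| * Real.exp (|L| * (|t| + 1))) * ∏ i, P.K i)
    (F' := fun t s => P.pull (fun w => E w * (g w * Complex.exp (E w * t))) s)
    (Metric.ball_mem_nhds t one_pos) ?_ (P.integrable hC (hc t)) (P.integrable hC hc').1 ?_
    (integrable_const _) ?_).2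
  · exact Eventually.of_forall fun t => (P.integrable hC (hc t)).1
  · refine Eventually.of_forall fun s u hu => ?_
    have hm := P.point_mem s
    have hEL : ‖E (P.point s)‖ ≤ |L| := (hL _ hm).trans (le_abs_self _)
    have hu' : |u| ≤ |t| + 1 := by
      rw [Metric.mem_ball, Real.dist_eq] at hu
      linarith [abs_sub_abs_le_abs_sub u t]
    rw [Parametrization.pull, norm_mul, norm_mul, norm_mul, Complex.norm_exp]
    refine mul_le_mul (mul_le_mul hEL (mul_le_mul ((hG _ hm).trans (le_abs_self _)) ?_
      (Real.exp_nonneg _) (abs_nonneg _)) (by positivity) (abs_nonneg _)) (P.norm_prod_le s)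
      (norm_nonneg _) (by positivity)
    rw [Real.exp_le_exp]
    calc (E (P.point s) * u).re ≤ ‖E (P.point s) * u‖ := Complex.re_le_norm _
      _ = ‖E (P.point s)‖ * |u| := by rw [norm_mul, Complex.norm_real, Real.norm_eq_abs]
      _ ≤ _ := mul_le_mul hEL hu' (abs_nonneg _) (abs_nonneg _)
  · refine Eventually.of_forall fun s u _ => ?_
    have h1 : HasDerivAt (fun u : ℝ => E (P.point s) * (u : ℂ)) (E (P.point s)) u := by
      simpa using (Complex.ofRealCLM.hasDerivAt (x := u)).const_mul (E (P.point s))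
    refine ((h1.cexp.const_mul (g (P.point s))).mul_const (∏ i, P.g i (s i))).congr_deriv ?_
    rw [Parametrization.pull]
    ring

end nested

/-! ### Scaling and inversion of contours -/

section transform

variable {γ : ℝ → ℂ}

theorem hasDerivAt_inv_const_mul {c w : ℂ} (hc : c ≠ 0) (hw : w ≠ 0) :
    HasDerivAt (fun w => (c * w)⁻¹) (-c / (c * w) ^ 2) w := by
  have h : HasDerivAt (fun w => c * w) c w := by simpa using (hasDerivAt_id w).const_mul c
  exact h.fun_inv (mul_ne_zero hc hw)

theorem ne_zero_of_zero_notMem {S : Set ℂ} (h0 : (0 : ℂ) ∉ S) {w : ℂ} (hw : w ∈ S) : w ≠ 0 :=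
  fun h => h0 (h ▸ hw)

theorem IsClosedCurve.const_mul (h : IsClosedCurve γ) (c : ℂ) :
    IsClosedCurve fun s => c * γ s :=
  h.comp (g := fun w => c * w) (g' := fun _ => c)
    (fun w _ => by simpa using (hasDerivAt_id w).const_mul c) continuousOn_const

theorem IsClosedCurve.inv_const_mul (h : IsClosedCurve γ) (h0 : (0 : ℂ) ∉ trace γ) {c : ℂ}
    (hc : c ≠ 0) : IsClosedCurve fun s => (c * γ s)⁻¹ :=
  h.comp (g := fun w => (c * w)⁻¹)
    (fun w hw => hasDerivAt_inv_const_mul hc (ne_zero_of_zero_notMem h0 hw))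
    (ContinuousOn.div (by fun_prop) (by fun_prop) fun w hw =>
      pow_ne_zero _ (mul_ne_zero hc (ne_zero_of_zero_notMem h0 hw)))

theorem IsClosedCurve.winding_const_mul (h : IsClosedCurve γ) {c : ℂ} (hc : c ≠ 0) (z : ℂ) :
    winding (fun s => c * γ s) (c * z) = winding γ z := by
  rw [winding, winding, h.curveInt_comp (g := fun w => c * w) (g' := fun _ => c)
    fun w _ => by simpa using (hasDerivAt_id w).const_mul c]
  congr 2
  ext w
  rw [← mul_sub, mul_inv]
  field_simp

/-- The function 1/(c w) - 1/(c z) of w has logarithmic derivative 1/(w - z) - 1/w. -/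
theorem IsClosedCurve.winding_inv_const_mul (h : IsClosedCurve γ) (h0 : (0 : ℂ) ∉ trace γ)
    {c : ℂ} (hc : c ≠ 0) {z : ℂ} (hz : z ≠ 0) (hzt : z ∉ trace γ) :
    winding (fun s => (c * γ s)⁻¹) (c * z)⁻¹ = winding γ z - winding γ 0 := by
  have hadd := h.curveInt_add (f := fun w => (w - z)⁻¹) (g := fun w => -1 * (w - 0)⁻¹)
    (by simpa using continuousOn_inv_sub_pow hzt 1)
    (continuousOn_const.mul (by simpa using continuousOn_inv_sub_pow h0 1))
  rw [curveInt_const_mul] at hadd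
  rw [winding, winding, winding, h.curveInt_comp (g := fun w => (c * w)⁻¹)
    fun w hw => hasDerivAt_inv_const_mul hc (ne_zero_of_zero_notMem h0 hw), ← mul_sub,
    sub_eq_add_neg, ← neg_one_mul (curveInt _ _), ← hadd]
  congr 1
  refine curveInt_congr fun w hw => ?_
  have hw0 := ne_zero_of_zero_notMem h0 hw
  have hwz : w - z ≠ 0 := sub_ne_zero.2 fun h => hzt (h ▸ hw)
  have hwz' : z - w ≠ 0 := sub_ne_zero.2 fun h => hzt (h ▸ hw)
  have : (c * w)⁻¹ - (c * z)⁻¹ = (z - w) / (c * w * z) := by field_simp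
  rw [this, sub_zero]
  field_simp
  ring

theorem IsClosedCurve.winding_inv_const_mul_zero (h : IsClosedCurve γ) (h0 : (0 : ℂ) ∉ trace γ)
    {c : ℂ} (hc : c ≠ 0) : winding (fun s => (c * γ s)⁻¹) 0 = -winding γ 0 := by
  rw [winding, winding, h.curveInt_comp (g := fun w => (c * w)⁻¹)
    fun w hw => hasDerivAt_inv_const_mul hc (ne_zero_of_zero_notMem h0 hw),
    ← mul_neg, ← neg_one_mul (curveInt _ fun w => (w - 0)⁻¹), ← curveInt_const_mul (-1)]
  congr 1
  refine curveInt_congr fun w hw => ?_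
  have hw0 := ne_zero_of_zero_notMem h0 hw
  rw [sub_zero, sub_zero]
  field_simp

theorem IsSimpleWinding.const_mul (h : IsSimpleWinding γ) {c : ℂ} (hc : c ≠ 0) :
    IsSimpleWinding fun s => c * γ s := by
  refine ⟨h.toIsClosedCurve.const_mul c, fun z hz => ?_⟩
  rw [show z = c * (c⁻¹ * z) by field_simp, h.winding_const_mul hc]
  refine h.winding_eq _ fun hz' => hz ?_
  rw [trace_comp γ fun w => c * w]
  exact ⟨_, hz', by field_simp⟩

theorem IsSimpleWinding.inv_const_mul (h : IsSimpleWinding γ) (h0 : (0 : ℂ) ∉ disc γ) {c : ℂ}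
    (hc : c ≠ 0) : IsSimpleWinding fun s => (c * γ s)⁻¹ := by
  obtain ⟨h0t, h0w⟩ := notMem_disc_iff.1 h0
  refine ⟨h.toIsClosedCurve.inv_const_mul h0t hc, fun z hz => ?_⟩
  by_cases hz0 : z = 0
  · rw [hz0, h.winding_inv_const_mul_zero h0t hc, h0w, neg_zero]
    exact .inl rfl
  · have hzt : (c * z)⁻¹ ∉ trace γ := fun hz' => hz (by
      rw [trace_comp γ fun w => (c * w)⁻¹]
      exact ⟨_, hz', by field_simp⟩)
    rw [show z = (c * (c * z)⁻¹)⁻¹ by field_simp, h.winding_inv_const_mul h0t hc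
      (inv_ne_zero (mul_ne_zero hc hz0)) hzt, h0w, sub_zero]
    exact h.winding_eq _ hzt

end transform

/-! ### The position of the contours relative to each other -/

namespace Admissible

variable {q α : ℝ} {N : ℕ} {C : Fin N → ℝ → ℂ} (hC : Admissible q α C)
include hC

theorem simple (i : Fin N) : IsSimpleWinding (C i) := (hC.isContour i).isSimpleWinding

theorem isClosedCurve (i : Fin N) : IsClosedCurve (C i) := (hC.isContour i).isClosedCurve

theorem one_notMem_trace (i : Fin N) : (1 : ℂ) ∉ trace (C i) := (hC.one_mem i).1

theorem winding_one (i : Fin N) : winding (C i) 1 = 1 :=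
  (hC.isContour i).positive 1 (hC.one_mem i)

theorem ne_zero {i : Fin N} {b : ℂ} (hb : b ∈ disc (C i)) : b ≠ 0 :=
  ne_zero_of_zero_notMem (hC.zero_notMem i) hb

theorem ne_one {i : Fin N} {b : ℂ} (hb : b ∈ trace (C i)) : b ≠ 1 :=
  fun h => hC.one_notMem_trace i (h ▸ hb)

theorem pole_ne_zero {i : Fin N} {b : ℂ} (hb : b ∈ disc (C i)) : (q : ℂ) + α - 1 - α * b ≠ 0 :=
  hC.pole_notMem i b hb

theorem one_sub_mul_ne_zero {i : Fin N} {b : ℂ} (hb : b ∈ disc (C i)) :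
    1 - (q : ℂ) * b ≠ 0 := fun h => hC.inv_notMem i (by
  have : b = (q : ℂ)⁻¹ := by
    rw [sub_eq_zero] at h
    exact eq_inv_of_mul_eq_one_right h.symm
  exact this ▸ hb)

theorem disc_subset_inside {i j : Fin N} (hij : i < j) : disc (C i) ⊆ inside (C j) := by
  rintro z (hz | hz)
  · exact hC.nested i j hij hz
  · by_contra h
    exact hz.2 (winding_eq_zero_of_subset_inside (hC.simple j) (hC.simple i)
      (hC.nested i j hij) h)

theorem notMem_disc_of_mem_trace {i j : Fin N} (hij : i < j) {w : ℂ} (hw : w ∈ trace (C j)) :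
    w ∉ disc (C i) := fun h => (hC.disc_subset_inside hij h).1 hw

theorem ne_of_lt {i j : Fin N} (hij : i < j) {w z : ℂ} (hw : w ∈ trace (C i))
    (hz : z ∈ trace (C j)) : w ≠ z := fun h => (hC.nested i j hij hw).1 (h ▸ hz)

/-- The curve q `C j` has constant winding number around the points on and inside `C i`. Around 1
this is the winding number of `C j` around 1/q, which is 0. But around q b, for b enclosed by `C j`,
the curve does wind. -/
theorem smul_notMem_disc (hq : q ≠ 0) {i j : Fin N} (hij : i < j) {b : ℂ} (hb : b ∈ disc (C j)) :
    (q : ℂ) * b ∉ disc (C i) := by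
  have hq' : (q : ℂ) ≠ 0 := by exact_mod_cast hq
  have htr := trace_comp (C j) fun w => (q : ℂ) * w
  have hd : Disjoint (trace fun s => (q : ℂ) * C j s) (trace (C i) ∪ inside (C i)) := by
    rw [htr]
    exact hC.smul_outside i j hij
  intro hbi
  have hconst : ∀ c ∈ trace (C i), winding (fun s => (q : ℂ) * C j s) c = 0 := fun c hc => by
    rw [← winding_eq_of_disjoint_inside (hC.simple i) ((hC.simple j).const_mul hq') hd
      (hC.one_mem i) hc]
    have := (hC.isClosedCurve j).winding_const_mul hq' (q : ℂ)⁻¹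
    rw [mul_inv_cancel₀ hq'] at this
    rw [this, winding_eq_zero_of_notMem_disc (hC.inv_notMem j)]
  have hw : winding (fun s => (q : ℂ) * C j s) (q * b) = 0 := by
    rcases hbi with hbi | hbi
    · exact hconst _ hbi
    · rw [winding_eq_of_disjoint_inside (hC.simple i) ((hC.simple j).const_mul hq') hd hbi
        (zero_mem_trace _)]
      exact hconst _ (zero_mem_trace _)
  rw [(hC.isClosedCurve j).winding_const_mul hq'] at hw
  rcases hb with hb | hb
  · exact disjoint_left.1 hd (htr ▸ ⟨b, hb, rfl⟩) hbi
  · exact hb.2 hw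

theorem div_notMem_disc (hq : q ≠ 0) {i j : Fin N} (hij : i < j) {b : ℂ} (hb : b ∈ disc (C i)) :
    b / q ∉ disc (C j) := fun h => hC.smul_notMem_disc hq hij h (by
  have hq' : (q : ℂ) ≠ 0 := by exact_mod_cast hq
  rwa [mul_div_cancel₀ _ hq'])

theorem sub_smul_ne_zero (hq : q ≠ 0) {i j : Fin N} (hij : i < j) {b c : ℂ} (hb : b ∈ disc (C i))
    (hc : c ∈ disc (C j)) : b - q * c ≠ 0 :=
  sub_ne_zero.2 fun h => hC.smul_notMem_disc hq hij hc (h ▸ hb)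

theorem ne_q (hq : q ≠ 0) {i j : Fin N} (hij : i < j) {b : ℂ} (hb : b ∈ disc (C i)) : b ≠ q :=
  fun h => hC.smul_notMem_disc hq hij (.inr (hC.one_mem j)) (by rwa [mul_one, ← h])

/-- The inverted curve is connected and misses `C p`, so it lies entirely inside as soon as one of
its points does. -/
theorem inv_subset_inside {i p : Fin N} (hd : ∀ w ∈ trace (C i), w⁻¹ ∉ trace (C p)) {c : ℂ}
    (hc : c ∈ trace (C i)) (hcp : c⁻¹ ∈ inside (C p)) {b : ℂ} (hb : b ∈ trace (C i)) :
    b⁻¹ ∈ inside (C p) := by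
  have h0 : (0 : ℂ) ∉ trace (C i) := fun h => hC.zero_notMem i (.inl h)
  have hcl := (hC.isClosedCurve i).inv_const_mul h0 one_ne_zero
  have htr : trace (fun s => (1 * C i s)⁻¹) = (fun w => w⁻¹) '' trace (C i) := by
    simpa using trace_comp (C i) fun w => w⁻¹
  refine ⟨hd b hb, ?_⟩
  rw [(hC.simple p).winding_eq_of_isPreconnected hcl.isPreconnected_trace ?_ (z' := c⁻¹) (htr ▸ ⟨b, hb, rfl⟩)
    (htr ▸ ⟨c, hc, rfl⟩)]
  · exact hcp.2
  · rw [htr, disjoint_left]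
    rintro _ ⟨w, hw, rfl⟩
    exact hd w hw

theorem inv_mem_inside_iff {i j : Fin N} (hij : i < j) {b c : ℂ} (hb : b ∈ trace (C i))
    (hc : c ∈ trace (C i)) : b⁻¹ ∈ inside (C j) ↔ c⁻¹ ∈ inside (C j) := by
  have hd : ∀ w ∈ trace (C i), w⁻¹ ∉ trace (C j) := fun w hw h =>
    hC.mul_ne_one i j hij w hw _ h (mul_inv_cancel₀ (hC.ne_zero (.inl hw)))
  exact ⟨fun h => hC.inv_subset_inside hd hb h hc, fun h => hC.inv_subset_inside hd hc h hb⟩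

/-- If `γ⁻¹` lies inside `C p` then so does the inverse of everything inside `γ`. -/
theorem inv_mem_inside_of_trace {i p : Fin N} (h : ∀ w ∈ trace (C i), w⁻¹ ∈ inside (C p)) {b : ℂ}
    (hb : b ∈ disc (C i)) : b⁻¹ ∈ inside (C p) := by
  have h0 : (0 : ℂ) ∉ trace (C i) := fun h => hC.zero_notMem i (.inl h)
  rcases hb with hb | hb
  · exact h b hb
  · by_contra hbp
    have hδ := (hC.simple i).inv_const_mul (hC.zero_notMem i) one_ne_zero
    have h1 := winding_eq_zero_of_subset_inside (hC.simple p) hδ (z := (1 * b)⁻¹) (by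
      have htr : trace (fun s => (1 * C i s)⁻¹) = (fun w => w⁻¹) '' trace (C i) := by
        simpa using trace_comp (C i) fun w => w⁻¹
      rw [htr]
      rintro _ ⟨w, hw, rfl⟩
      exact h w hw) (by rwa [one_mul])
    rw [(hC.isClosedCurve i).winding_inv_const_mul h0 one_ne_zero (hC.ne_zero (.inr hb)) hb.1,
      winding_eq_zero_of_notMem_disc (hC.zero_notMem i), sub_zero] at h1
    exact hb.2 h1

/-- If w⁻¹ were inside `C i`, the whole inverse of `C j` would be, and with it the inverses of all
points enclosed by `C j`. One of these points is w⁻¹, because `C i` is nested in `C j`; hence w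
itself would be inside `C i`, although it lies on the outer contour. -/
theorem inv_notMem_disc {i j : Fin N} (hij : i < j) {w : ℂ} (hw : w ∈ trace (C j)) :
    w⁻¹ ∉ disc (C i) := by
  have hd : ∀ w ∈ trace (C j), w⁻¹ ∉ trace (C i) := fun w hw h =>
    hC.mul_ne_one i j hij _ h w hw (inv_mul_cancel₀ (hC.ne_zero (.inl hw)))
  rintro (h | h)
  · exact hd w hw h
  · have h1 := hC.disc_subset_inside hij (.inr h)
    have h2 := hC.inv_mem_inside_of_trace (fun c hc => hC.inv_subset_inside hd hw h hc) (.inr h1)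
    rw [inv_inv] at h2
    exact hC.notMem_disc_of_mem_trace hij hw (.inr h2)

theorem mul_ne_one_of_mem_disc {i j : Fin N} (hij : i < j) {b w : ℂ} (hb : b ∈ disc (C i))
    (hw : w ∈ trace (C j)) : 1 - b * w ≠ 0 := fun h => hC.inv_notMem_disc hij hw (by
  rw [← eq_inv_of_mul_eq_one_left (sub_eq_zero.1 h).symm]
  exact hb)

/-- Otherwise the whole curve 1/(q `C k`) would lie inside `C i` and could not wind around 1/q, a
point outside `C i`. But it does so once, as `C k` winds once around 1 and not around 0. -/
theorem ne_inv_mul_of_mem_trace (hq : q ≠ 0) {i k : Fin N} {b c : ℂ} (hb : b ∈ disc (C i))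
    (hc : c ∈ trace (C k)) : b ≠ (q * c)⁻¹ := by
  have hq' : (q : ℂ) ≠ 0 := by exact_mod_cast hq
  have h0 : (0 : ℂ) ∉ trace (C k) := fun h => hC.zero_notMem k (.inl h)
  have htr := trace_comp (C k) fun w => ((q : ℂ) * w)⁻¹
  have hd := hC.inv_trace_disjoint i k
  have hδ := (hC.simple k).inv_const_mul (hC.zero_notMem k) hq'
  have hmem : ((q : ℂ) * c)⁻¹ ∈ trace fun s => ((q : ℂ) * C k s)⁻¹ := htr ▸ ⟨c, hc, rfl⟩
  rintro rfl
  rcases hb with hb | hb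
  · exact disjoint_left.1 hd hb hmem
  · have h1 := winding_eq_zero_of_subset_inside (hC.simple i) hδ (z := ((q : ℂ) * 1)⁻¹) ?_
      (by rw [mul_one]; exact fun h => hC.inv_notMem i (.inr h))
    · rw [(hC.isClosedCurve k).winding_inv_const_mul h0 hq' one_ne_zero (hC.one_notMem_trace k),
        winding_eq_zero_of_notMem_disc (hC.zero_notMem k), sub_zero, hC.winding_one] at h1
      exact one_ne_zero h1
    · intro z hz
      refine ⟨disjoint_right.1 hd hz, ?_⟩
      rw [(hC.simple i).winding_eq_of_isPreconnected hδ.isPreconnected_trace hd.symm hz hmem]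
      exact hb.2

theorem mul_mul_ne_one (hq : q ≠ 0) {i k : Fin N} {b c : ℂ} (hb : b ∈ disc (C i))
    (hc : c ∈ disc (C k)) : 1 - (q : ℂ) * b * c ≠ 0 := by
  have hq' : (q : ℂ) ≠ 0 := by exact_mod_cast hq
  have hb0 := hC.ne_zero hb
  have hc0 := hC.ne_zero hc
  intro h
  have hbc : b = (q * c)⁻¹ := eq_inv_of_mul_eq_one_left (by linear_combination -h)
  have hcb : c = (q * b)⁻¹ := eq_inv_of_mul_eq_one_left (by linear_combination -h)
  rcases hc with hc | hc
  · exact hC.ne_inv_mul_of_mem_trace hq hb hc hbc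
  · rcases hb with hb | hb
    · exact hC.ne_inv_mul_of_mem_trace hq (.inr hc) hb hcb
    -- With both points strictly inside, b would be enclosed by `C i` and by 1/(q `C k`) at once.
    · refine disjoint_left.1 (hC.inv_inside_disjoint i k) hb ⟨?_, ?_⟩
      · rw [trace_comp (C k) fun w => ((q : ℂ) * w)⁻¹]
        rintro ⟨w, hw, hwb⟩
        simp only at hwb
        rw [hbc] at hwb
        have : w = c := mul_left_cancel₀ hq' (inv_injective hwb)
        exact hc.1 (this ▸ hw)
      · rw [hbc, (hC.isClosedCurve k).winding_inv_const_mul (fun h => hC.zero_notMem k (.inl h)) hq'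
          hc0 hc.1, winding_eq_zero_of_notMem_disc (hC.zero_notMem k), sub_zero]
        exact hc.2

theorem one_sub_mul_sq_ne_zero (hq : q ≠ 0) {i : Fin N} {b : ℂ} (hb : b ∈ disc (C i)) :
    1 - (q : ℂ) * b ^ 2 ≠ 0 := by
  rw [sq, ← mul_assoc]
  exact hC.mul_mul_ne_one hq hb hb

end Admissible

/-! ### Rational functions of several variables -/

section RatOn

variable {ι : Type*} {S : Set (ι → ℂ)} {f g : (ι → ℂ) → ℂ}

/-- On the set `S` the function `f` agrees with a rational function whose denominator has no zeros
there. -/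
def RatOn (S : Set (ι → ℂ)) (f : (ι → ℂ) → ℂ) : Prop :=
  ∃ P Q : MvPolynomial ι ℂ, (∀ w ∈ S, MvPolynomial.eval w Q ≠ 0) ∧
    ∀ w ∈ S, f w = MvPolynomial.eval w P / MvPolynomial.eval w Q

theorem RatOn.const (c : ℂ) : RatOn S fun _ => c := ⟨.C c, 1, by simp, by simp⟩

theorem RatOn.coord (i : ι) : RatOn S fun w => w i := ⟨.X i, 1, by simp, by simp⟩

theorem RatOn.add (hf : RatOn S f) (hg : RatOn S g) : RatOn S fun w => f w + g w := by
  obtain ⟨P, Q, hQ, hf⟩ := hf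
  obtain ⟨P', Q', hQ', hg⟩ := hg
  refine ⟨P * Q' + P' * Q, Q * Q', fun w hw => by simpa using ⟨hQ w hw, hQ' w hw⟩,
    fun w hw => ?_⟩
  have h1 := hQ w hw
  have h2 := hQ' w hw
  simp only [hf w hw, hg w hw, map_add, map_mul]
  field_simp

theorem RatOn.mul (hf : RatOn S f) (hg : RatOn S g) : RatOn S fun w => f w * g w := by
  obtain ⟨P, Q, hQ, hf⟩ := hf
  obtain ⟨P', Q', hQ', hg⟩ := hg
  refine ⟨P * P', Q * Q', fun w hw => by simpa using ⟨hQ w hw, hQ' w hw⟩, fun w hw => ?_⟩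
  have h1 := hQ w hw
  have h2 := hQ' w hw
  simp only [hf w hw, hg w hw, map_mul]
  field_simp

theorem RatOn.inv (hf : RatOn S f) (h0 : ∀ w ∈ S, f w ≠ 0) : RatOn S fun w => (f w)⁻¹ := by
  obtain ⟨P, Q, hQ, hf⟩ := hf
  refine ⟨Q, P, fun w hw h => h0 w hw (by rw [hf w hw, h, zero_div]), fun w hw => ?_⟩
  simp only [hf w hw, inv_div]

theorem RatOn.div (hf : RatOn S f) (hg : RatOn S g) (h0 : ∀ w ∈ S, g w ≠ 0) :
    RatOn S fun w => f w / g w := by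
  simpa only [div_eq_mul_inv] using hf.mul (hg.inv h0)

theorem RatOn.neg (hf : RatOn S f) : RatOn S fun w => -f w := by
  simpa using (RatOn.const (-1)).mul hf

theorem RatOn.sub (hf : RatOn S f) (hg : RatOn S g) : RatOn S fun w => f w - g w := by
  simpa only [sub_eq_add_neg] using hf.add hg.neg

theorem RatOn.pow (hf : RatOn S f) (n : ℕ) : RatOn S fun w => f w ^ n := by
  induction n with
  | zero => simpa using RatOn.const 1
  | succ n ih => simpa only [pow_succ] using ih.mul hf

theorem RatOn.sum {κ : Type*} (s : Finset κ) {F : κ → (ι → ℂ) → ℂ} (h : ∀ i ∈ s, RatOn S (F i)) :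
    RatOn S fun w => ∑ i ∈ s, F i w := by
  classical
  induction s using Finset.induction_on with
  | empty => simpa using RatOn.const 0
  | insert a s ha ih =>
    simp only [Finset.sum_insert ha]
    exact (h a (by simp)).add (ih fun i hi => h i (by simp [hi]))

theorem RatOn.prod {κ : Type*} (s : Finset κ) {F : κ → (ι → ℂ) → ℂ} (h : ∀ i ∈ s, RatOn S (F i)) :
    RatOn S fun w => ∏ i ∈ s, F i w := by
  classical
  induction s using Finset.induction_on with
  | empty => simpa using RatOn.const 1
  | insert a s ha ih =>
    simp only [Finset.prod_insert ha]
    exact (h a (by simp)).mul (ih fun i hi => h i (by simp [hi]))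

theorem RatOn.continuousOn (hf : RatOn S f) : ContinuousOn f S := by
  obtain ⟨P, Q, hQ, hf⟩ := hf
  refine ContinuousOn.congr ?_ hf
  exact (MvPolynomial.continuous_eval P).continuousOn.div
    (MvPolynomial.continuous_eval Q).continuousOn hQ

/-- Freezing all coordinates but one turns multivariate numerators and denominators into univariate
ones, so the residue theorem for rational functions applies to single variables. -/
theorem RatOn.regOn_update [DecidableEq ι] (hf : RatOn S f) {w : ι → ℂ} {i : ι} {Y : Set ℂ}
    (hY : ∀ z ∈ Y, Function.update w i z ∈ S) : RegOn Y fun z => f (Function.update w i z) := by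
  obtain ⟨P, Q, hQ, hf⟩ := hf
  set φ : MvPolynomial ι ℂ → Polynomial ℂ :=
    MvPolynomial.eval₂ Polynomial.C (Function.update (fun j => Polynomial.C (w j)) i Polynomial.X)
  have hφ : ∀ (P : MvPolynomial ι ℂ) (z : ℂ),
      (φ P).eval z = MvPolynomial.eval (Function.update w i z) P := by
    intro P z
    rw [← Polynomial.coe_evalRingHom, MvPolynomial.hom_eval₂]
    rw [show (Polynomial.evalRingHom z).comp Polynomial.C = RingHom.id ℂ by ext; simp]
    rw [MvPolynomial.eval, MvPolynomial.coe_eval₂Hom]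
    congr 1
    ext j
    by_cases hj : j = i
    · subst hj; simp
    · simp [hj]
  refine ⟨φ P, φ Q, fun z hz => ?_, fun z hz => ?_⟩
  · rw [hφ]
    exact hQ _ (hY z hz)
  · rw [hφ, hφ]
    exact hf _ (hY z hz)

/-- On `S` the function `f` is rational with a zero of order at least `m` along `w i = 1` and no
other poles. -/
def RatOrd (S : Set (ι → ℂ)) (i : ι) (m : ℤ) (f : (ι → ℂ) → ℂ) : Prop :=
  ∃ g, RatOn S g ∧ ∀ w ∈ S, w i ≠ 1 → f w = (1 - w i) ^ m * g w

variable {i : ι} {m n : ℤ}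

theorem RatOn.ratOrd (hf : RatOn S f) : RatOrd S i 0 f := ⟨f, hf, fun w _ _ => by simp⟩

theorem RatOrd.mul (hf : RatOrd S i m f) (hg : RatOrd S i n g) :
    RatOrd S i (m + n) fun w => f w * g w := by
  obtain ⟨f', hf', hf⟩ := hf
  obtain ⟨g', hg', hg⟩ := hg
  refine ⟨_, hf'.mul hg', fun w hw h1 => ?_⟩
  have h0 : 1 - w i ≠ 0 := sub_ne_zero.2 (Ne.symm h1)
  simp only [hf w hw h1, hg w hw h1, zpow_add₀ h0]
  ring

theorem RatOrd.mono (hf : RatOrd S i m f) (h : n ≤ m) : RatOrd S i n f := by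
  obtain ⟨f', hf', hf⟩ := hf
  obtain ⟨k, rfl⟩ := Int.le.dest h
  refine ⟨fun w => (1 - w i) ^ k * f' w, (((RatOn.const 1).sub (RatOn.coord i)).pow k).mul hf',
    fun w hw h1 => ?_⟩
  have h0 : 1 - w i ≠ 0 := sub_ne_zero.2 (Ne.symm h1)
  simp only [hf w hw h1, zpow_add₀ h0, zpow_natCast]
  ring

theorem RatOrd.sum {κ : Type*} (s : Finset κ) {F : κ → (ι → ℂ) → ℂ}
    (h : ∀ k ∈ s, RatOrd S i m (F k)) : RatOrd S i m fun w => ∑ k ∈ s, F k w := by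
  classical
  choose! G hG hF using h
  refine ⟨_, RatOn.sum s hG, fun w hw h1 => ?_⟩
  rw [Finset.mul_sum]
  exact Finset.sum_congr rfl fun k hk => hF k hk w hw h1

theorem RatOrd.prod {κ : Type*} (s : Finset κ) {F : κ → (ι → ℂ) → ℂ} {o : κ → ℤ}
    (h : ∀ k ∈ s, RatOrd S i (o k) (F k)) :
    RatOrd S i (∑ k ∈ s, o k) fun w => ∏ k ∈ s, F k w := by
  classical
  induction s using Finset.induction_on with
  | empty => simpa using (RatOn.const (S := S) 1).ratOrd (i := i)
  | insert a s ha ih =>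
    simp only [Finset.prod_insert ha, Finset.sum_insert ha]
    exact (h a (by simp)).mul (ih fun k hk => h k (by simp [hk]))

theorem RatOrd.congr (hf : RatOrd S i m f) (h : ∀ w ∈ S, w i ≠ 1 → g w = f w) :
    RatOrd S i m g := by
  obtain ⟨f', hf', hf⟩ := hf
  exact ⟨f', hf', fun w hw h1 => (h w hw h1).trans (hf w hw h1)⟩

theorem ratOrd_one_sub_pow (n : ℕ) : RatOrd S i n fun w => (1 - w i) ^ n :=
  ⟨fun _ => 1, RatOn.const 1, fun w _ _ => by simp⟩

theorem ratOrd_inv_one_sub_pow (n : ℕ) : RatOrd S i (-n) fun w => ((1 - w i) ^ n)⁻¹ :=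
  ⟨fun _ => 1, RatOn.const 1, fun w _ _ => by simp⟩

theorem RatOrd.zero : RatOrd S i m fun _ => 0 := ⟨fun _ => 0, RatOn.const 0, fun w _ _ => by simp⟩

end RatOn

/-! ### Vanishing criteria for nested integrals -/

section vanishing

variable {N : ℕ} {C : Fin N → ℝ → ℂ}

/-- The points of the torus, except that the coordinate `i` may also be inside its contour. -/
def solidTorus (C : Fin N → ℝ → ℂ) (i : Fin N) : Set (Fin N → ℂ) :=
  {w | w i ∈ disc (C i) ∧ ∀ j ≠ i, w j ∈ trace (C j)}

theorem torus_subset_solidTorus (i : Fin N) : torus C ⊆ solidTorus C i :=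
  fun _ hw => ⟨.inl (hw i), fun j _ => hw j⟩

theorem update_mem_solidTorus {w : Fin N → ℂ} (hw : w ∈ torus C) {i : Fin N} {z : ℂ}
    (hz : z ∈ disc (C i)) : Function.update w i z ∈ solidTorus C i :=
  ⟨by simpa using hz, fun j hj => by simpa [hj] using hw j⟩

theorem mem_disc_of_mem_solidTorus {w : Fin N → ℂ} {i : Fin N} (hw : w ∈ solidTorus C i)
    (j : Fin N) : w j ∈ disc (C j) := by
  by_cases h : j = i
  · exact h ▸ hw.1
  · exact .inl (hw.2 j h)

variable {q α : ℝ} (hC : Admissible q α C)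
include hC

theorem Admissible.injOn_coord {w : Fin N → ℂ} (hw : w ∈ torus C) : Function.Injective w := by
  intro a b hab
  rcases lt_trichotomy a b with h | h | h
  · exact absurd hab (hC.ne_of_lt h (hw a) (hw b))
  · exact h
  · exact absurd hab.symm (hC.ne_of_lt h (hw b) (hw a))

theorem Admissible.notMem_trace {w : Fin N → ℂ} (hw : w ∈ torus C) {a i : Fin N} (h : a ≠ i) :
    w a ∉ trace (C i) := fun h' => by
  rcases lt_or_gt_of_ne h with h | h
  · exact hC.ne_of_lt h (hw a) h' rfl
  · exact hC.ne_of_lt h h' (hw a) rfl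

/-- In the variable i the only possible poles inside the contour are the points w a, and their
residues vanish with `Ψ`. The point 1 is harmless because the order there is at least 0, and w a ≠ 1
allows the evaluation of `Ψ` and of its regular representative to be exchanged. -/
theorem Admissible.nestedInt_eq_zero_of_ratOrd (i : Fin N) (s : Finset (Fin N)) (hs : i ∉ s)
    {f Ψ : (Fin N → ℂ) → ℂ} (hf : ∀ w ∈ torus C, f w = Ψ w * ∏ a ∈ s, (w i - w a)⁻¹)
    (hΨ : RatOrd (solidTorus C i) i 0 Ψ)
    (h0 : ∀ w ∈ solidTorus C i, ∀ a ∈ s, w i = w a → Ψ w = 0) : nestedInt C f = 0 := by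
  obtain ⟨g, hg, hΨg⟩ := hΨ
  have hfg : ∀ w ∈ torus C, f w = g w * ∏ a ∈ s, (w i - w a)⁻¹ := fun w hw => by
    rw [hf w hw, hΨg w (torus_subset_solidTorus i hw) (hC.ne_one (hw i)), zpow_zero, one_mul]
  have hne : ∀ w ∈ torus C, ∀ a ∈ s, w i - w a ≠ 0 := fun w hw a ha =>
    sub_ne_zero.2 fun h => hs (hC.injOn_coord hw h ▸ ha)
  rw [nestedInt_congr hfg]
  refine nestedInt_eq_zero hC.isClosedCurve i ?_ fun w hw => ?_
  · refine (hg.continuousOn.mono (torus_subset_solidTorus i)).mul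
      (continuousOn_finsetProd _ fun a ha => ContinuousOn.inv₀ (by fun_prop) fun w hw => hne w hw a ha)
  · have hreg := hg.regOn_update (w := w) (i := i) (Y := disc (C i))
      fun z hz => update_mem_solidTorus hw hz
    have h1 := (hC.isClosedCurve i).curveInt_mul_prod_inv_sub hreg s (c := w)
      (hC.injOn_coord hw).injOn fun a ha => hC.notMem_trace hw (by rintro rfl; exact hs ha)
    calc _ = _ := curveInt_congr fun z _ => by
            rw [Finset.prod_congr rfl fun a ha => ?_]
            have : a ≠ i := by rintro rfl; exact hs ha
            rw [Function.update_self, Function.update_of_ne this]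
      _ = _ := h1
      _ = 0 := by
        rw [Finset.sum_eq_zero, mul_zero]
        intro a ha
        have hai : a ≠ i := by rintro rfl; exact hs ha
        by_cases had : w a ∈ disc (C i)
        · have hm := update_mem_solidTorus hw had
          have hz := hΨg _ hm (by simpa using hC.ne_one (hw a))
          rw [h0 _ hm a ha (by simp [hai]), zpow_zero, one_mul] at hz
          simp only [← hz, mul_zero, zero_mul]
        · rw [winding_eq_zero_of_notMem_disc had, zero_mul, zero_mul]

/-- Integration over w p leaves functions g a that no longer depend on w p. The factor 1/(w p - 1),
whose integral over `C p` is 2πi, restores an integral over all the contours, so that a second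
integration can be done in the same setting. -/
theorem Admissible.nestedInt_eq_zero_of_residues (p : Fin N) (s : Finset (Fin N))
    {f : (Fin N → ℂ) → ℂ} {g : Fin N → (Fin N → ℂ) → ℂ} (hf : ContinuousOn f (torus C))
    (hg : ∀ a ∈ s, ContinuousOn (g a) (torus C))
    (hgp : ∀ a ∈ s, ∀ w z, g a (Function.update w p z) = g a w)
    (hfg : ∀ w ∈ torus C, curveInt (C p) (fun z => f (Function.update w p z))
      = 2 * Real.pi * Complex.I * ∑ a ∈ s, g a w)
    (h0 : ∀ a ∈ s, nestedInt C (fun w => g a w * (w p - 1)⁻¹) = 0) : nestedInt C f = 0 := by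
  have hp1 : ContinuousOn (fun w : Fin N → ℂ => (w p - 1)⁻¹) (torus C) :=
    ContinuousOn.inv₀ (by fun_prop) fun w hw => sub_ne_zero.2 (hC.ne_one (hw p))
  have hgc : ∀ a ∈ s, ContinuousOn (fun w => g a w * (w p - 1)⁻¹) (torus C) :=
    fun a ha => (hg a ha).mul hp1
  rw [nestedInt_congr_curveInt hC.isClosedCurve p (g := fun w => ∑ a ∈ s, g a w * (w p - 1)⁻¹) hf
    (continuousOn_finsetSum _ hgc), nestedInt_sum hC.isClosedCurve s hgc, Finset.sum_eq_zero h0]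
  intro w hw
  rw [hfg w hw]
  have : EqOn (fun z => ∑ a ∈ s, g a (Function.update w p z) * (Function.update w p z p - 1)⁻¹)
      (fun z => (∑ a ∈ s, g a w) * (z - 1)⁻¹) (trace (C p)) := fun z _ => by
    simp only [Function.update_self, Finset.sum_mul]
    exact Finset.sum_congr rfl fun a ha => by rw [hgp a ha]
  rw [curveInt_congr this, curveInt_const_mul, curveInt_inv_sub, hC.winding_one]
  ring

end vanishing

section integrand

/-! ### The integrand at time zero -/

/-- The variables `w` and `1 / (q w)`. -/
def flip (q : ℝ) (ε : ℤˣ) (w : ℂ) : ℂ := if ε = 1 then w else 1 / (q * w)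

/-- The factor of the integrand that depends on the position `x`. -/
def rho (q α : ℝ) (x : ℕ+) (w : ℂ) : ℂ :=
  (1 - q * w ^ 2) / (w * (q + α - 1 - α * w) * (1 - q * w))
    * ((1 - w) / (1 - q * w)) ^ ((x : ℕ) - 1)

/-- The signed sum over a set of permutations of the variables. -/
def altSum {N : ℕ} (P : Finset (Equiv.Perm (Fin N))) (G : (Fin N → ℂ) → ℂ) (v : Fin N → ℂ) : ℂ :=
  ∑ π ∈ P, ((Equiv.Perm.sign π : ℤ) : ℂ) * G fun i => v (π i)

/-- Composition with the transposition of c and d pairs equal terms with opposite signs. The set of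
permutations need only be stable under this operation; besides the full group this covers
`firstMoved`. -/
theorem altSum_eq_zero {N : ℕ} {P : Finset (Equiv.Perm (Fin N))} (G : (Fin N → ℂ) → ℂ)
    {v : Fin N → ℂ} {c d : Fin N} (hcd : c ≠ d) (hP : ∀ π ∈ P, Equiv.swap c d * π ∈ P)
    (hv : v c = v d) : altSum P G v = 0 := by
  refine Finset.sum_involution (fun π _ => Equiv.swap c d * π) (fun π _ => ?_) (fun π _ _ h => ?_)
    hP fun π _ => by rw [← mul_assoc, Equiv.swap_mul_self, one_mul]
  · have : ∀ i, v ((Equiv.swap c d * π) i) = v (π i) := by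
      intro i
      rw [Equiv.Perm.mul_apply, Equiv.swap_apply_def]
      split_ifs with h1 h2
      · rw [h1, hv]
      · rw [h2, hv]
      · rfl
    simp only [this]
    rw [Equiv.Perm.sign_mul, Equiv.Perm.sign_swap hcd]
    push_cast
    ring
  · exact hcd (Equiv.swap_eq_one_iff.1 (mul_eq_right.1 h))

/-- The numerator of a Bethe wave function. -/
def bethe (q : ℝ) {N : ℕ} (ψ : Fin N → ℂ → ℂ) (v : Fin N → ℂ) : ℂ :=
  (∏ i, ∏ j ∈ Finset.Ioi i, (v i - q * v j)) * ∏ i, ψ i (v i)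

/-- The function of the variable at position `i`. -/
def psi (q α : ℝ) {M N : ℕ} (y : Fin M → ℕ+) (i : Fin N) (w : ℂ) : ℂ :=
  if h : (i : ℕ) < M then phi q α (y ⟨i, h⟩) w else 1

/-- The interaction of two variables with given signs. -/
def pairFactor (q : ℝ) (ε δ : ℤˣ) (a b : ℂ) : ℂ :=
  if δ = 1 then
    if ε = 1 then (a - q * b)⁻¹ else (q * a - b) * a / ((1 - a * b) * (a - q * b))
  else if ε = 1 then b / (a * b - 1)
    else (q ^ 2 * a * b - 1) * (a * b) / ((1 - a * b) * (a - q * b))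

/-- Most of the prefactor cancels against the antisymmetric factor of the symmetrized function. The
denominator 1 - a b survives exactly when a variable of the pair is inverted; this is the new pole
to be dealt with. -/
theorem pairFactor_eq {q : ℝ} (hq : q ≠ 0) (ε δ : ℤˣ) {a b : ℂ} (ha : a ≠ 0) (hb : b ≠ 0)
    (hab : a ≠ b) (h1 : 1 - a * b ≠ 0) (h2 : a - q * b ≠ 0) (h3 : 1 - q * a * b ≠ 0) :
    (b - a) / (q * b - a) * ((1 - q * a * b) / (1 - a * b))
      * ((1 - flip q ε a * flip q δ b)
        / ((flip q ε a - flip q δ b) * (1 - q * flip q ε a * flip q δ b)))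
      = pairFactor q ε δ a b := by
  have hq' : (q : ℂ) ≠ 0 := by exact_mod_cast hq
  have h4 : b - a ≠ 0 := sub_ne_zero.2 hab.symm
  have hmm : (-1 : ℤˣ) ≠ 1 := by decide
  have n1 : q * b - a = -(a - q * b) := by ring
  have n2 : a * b - 1 = -(1 - a * b) := by ring
  rcases Int.units_eq_one_or ε with rfl | rfl <;> rcases Int.units_eq_one_or δ with rfl | rfl
  · simp only [flip, pairFactor, if_true]
    rw [n1, show a - b = -(b - a) by ring]
    generalize a - q * b = X at *
    generalize 1 - a * b = Y at *
    generalize 1 - q * a * b = Z at *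
    generalize b - a = W at *
    field_simp
  · simp only [flip, pairFactor, if_true, hmm, if_false]
    have e1 : 1 - a * (1 / (q * b)) = (q * b - a) / (q * b) := by field_simp
    have e2 : a - 1 / (q * b) = -(1 - q * a * b) / (q * b) := by field_simp; ring
    have e3 : 1 - q * a * (1 / (q * b)) = (b - a) / b := by field_simp
    rw [e1, e2, e3, n1, n2]
    generalize a - q * b = X at *
    generalize 1 - a * b = Y at *
    generalize 1 - q * a * b = Z at *
    generalize b - a = W at *
    field_simp
  · simp only [flip, pairFactor, if_true, hmm, if_false]
    have e1 : 1 - 1 / (q * a) * b = (q * a - b) / (q * a) := by field_simp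
    have e2 : 1 / (q * a) - b = (1 - q * a * b) / (q * a) := by field_simp
    have e3 : 1 - q * (1 / (q * a)) * b = -(b - a) / a := by field_simp; ring
    rw [e1, e2, e3, n1]
    generalize a - q * b = X at *
    generalize 1 - a * b = Y at *
    generalize 1 - q * a * b = Z at *
    generalize b - a = W at *
    field_simp
  · simp only [flip, pairFactor, hmm, if_false]
    have e1 : 1 - 1 / (q * a) * (1 / (q * b)) = (q ^ 2 * a * b - 1) / (q ^ 2 * a * b) := by
      field_simp
    have e2 : 1 / (q * a) - 1 / (q * b) = (b - a) / (q * a * b) := by field_simp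
    have e3 : 1 - q * (1 / (q * a)) * (1 / (q * b)) = -(1 - q * a * b) / (q * a * b) := by
      field_simp; ring
    rw [e1, e2, e3, n1]
    generalize a - q * b = X at *
    generalize 1 - a * b = Y at *
    generalize 1 - q * a * b = Z at *
    generalize b - a = W at *
    field_simp

variable {q α : ℝ} {M N : ℕ} {C : Fin N → ℝ → ℂ}

/-- The factor split off changes sign under exchange of two variables, so a permutation acts on it
by its sign and the symmetrization becomes an alternating sum of `bethe`. -/
theorem summand_eq (hMN : M ≤ N) (y : Fin M → ℕ+) (v : Fin N → ℂ) :
    summand q α hMN y v = bethe q (psi q α y) v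
      * ∏ i, ∏ j ∈ Finset.Ioi i, ((1 - v i * v j) / ((v i - v j) * (1 - q * v i * v j))) := by
  have h1 : ∏ i : Fin M, phi q α (y i) (v (Fin.castLE hMN i))
      = ∏ i : Fin N, psi q α y i (v i) := by
    have hinj : Function.Injective (Fin.castLE hMN) := Fin.castLE_injective hMN
    refine Eq.trans ?_ (Finset.prod_subset (s₁ := Finset.univ.map ⟨_, hinj⟩)
      (Finset.subset_univ _) ?_)
    · rw [Finset.prod_map]
      refine Finset.prod_congr rfl fun i _ => ?_
      simp [psi]
    · intro i _ hi
      have : ¬ (i : ℕ) < M := fun h => hi (Finset.mem_map.2 ⟨⟨i, h⟩, by simp, rfl⟩)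
      simp [psi, this]
  rw [summand, bethe, h1, mul_right_comm]
  congr 1
  rw [← Finset.prod_mul_distrib]
  refine Finset.prod_congr rfl fun i _ => ?_
  rw [← Finset.prod_mul_distrib]
  refine Finset.prod_congr rfl fun j _ => ?_
  rw [div_mul_div_comm, mul_div_assoc]

/-- The signs are reindexed by variables instead of positions. For fixed signs the permutations then
act on fixed arguments. -/
theorem sum_signedPerm (q : ℝ) (w : Fin N → ℂ) (F : (Fin N → ℂ) → ℂ) :
    ∑ σ : SignedPerm N, F (σ.act q w)
      = ∑ ε : Fin N → ℤˣ, ∑ π : Equiv.Perm (Fin N), F fun i => flip q (ε (π i)) (w (π i)) := by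
  rw [Fintype.sum_prod_type, Finset.sum_comm (s := (Finset.univ : Finset (Fin N → ℤˣ)))]
  refine Finset.sum_congr rfl fun π _ => ?_
  exact (Equiv.sum_comp (Equiv.arrowCongr π.symm (Equiv.refl ℤˣ))
    fun ε => F (SignedPerm.act q (π, ε) w)).symm

/-- The contribution of the signs `ε` to the integrand at time zero. -/
def signTerm (q α : ℝ) {M N : ℕ} (y : Fin M → ℕ+) (x : Fin N → ℕ+) (ε : Fin N → ℤˣ)
    (w : Fin N → ℂ) : ℂ :=
  (∏ a, rho q α (x a) (w a)) * (∏ a, ∏ b ∈ Finset.Ioi a, pairFactor q (ε a) (ε b) (w a) (w b))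
    * altSum Finset.univ (bethe q (psi q α y)) fun a => flip q (ε a) (w a)

theorem Admissible.integrand_zero (hC : Admissible q α C) (hq : q ≠ 0) (hMN : M ≤ N)
    (y : Fin M → ℕ+) (x : Fin N → ℕ+) {w : Fin N → ℂ} (hw : w ∈ torus C) :
    integrand q α 0 hMN y x w = ∑ ε, signTerm q α y x ε w := by
  have hd : ∀ i, w i ∈ disc (C i) := fun i => .inl (hw i)
  rw [integrand, symmetrization, sum_signedPerm q w, Finset.mul_sum]
  refine Finset.sum_congr rfl fun ε _ => ?_
  simp only [signTerm, altSum]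
  rw [Finset.mul_sum, Finset.mul_sum]
  refine Finset.sum_congr rfl fun π _ => ?_
  have hs := π.prod_Ioi_comp_eq_sign_mul_prod (f := fun i j =>
    (1 - flip q (ε i) (w i) * flip q (ε j) (w j)) / ((flip q (ε i) (w i) - flip q (ε j) (w j))
      * (1 - q * flip q (ε i) (w i) * flip q (ε j) (w j)))) fun i j => by
        rw [← div_neg]
        congr 1 <;> ring
  rw [summand_eq, hs]
  have hp : ∀ a, ∀ b ∈ Finset.Ioi a, pairFactor q (ε a) (ε b) (w a) (w b)
      = (w b - w a) / (q * w b - w a) * ((1 - q * w a * w b) / (1 - w a * w b))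
      * ((1 - flip q (ε a) (w a) * flip q (ε b) (w b)) / ((flip q (ε a) (w a) - flip q (ε b) (w b))
        * (1 - q * flip q (ε a) (w a) * flip q (ε b) (w b)))) := fun a b hab => by
    rw [Finset.mem_Ioi] at hab
    exact (pairFactor_eq hq _ _ (hC.ne_zero (hd a)) (hC.ne_zero (hd b))
      (hC.ne_of_lt hab (hw a) (hw b)) (hC.mul_ne_one_of_mem_disc hab (hd a) (hw b))
      (hC.sub_smul_ne_zero hq hab (hd a) (hd b)) (hC.mul_mul_ne_one hq (hd a) (hd b))).symm
  rw [Finset.prod_congr rfl fun a _ => Finset.prod_congr rfl (hp a)]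
  simp only [Finset.prod_mul_distrib, rho, Complex.ofReal_zero, mul_zero, zero_div,
    Complex.exp_zero, mul_one]
  ring

end integrand

/-! ### Terms with at least one inverted variable. -/

section signs

variable {ι : Type*} {S : Set (ι → ℂ)} {u v : (ι → ℂ) → ℂ} {q α : ℝ} {M N : ℕ} {C : Fin N → ℝ → ℂ}

theorem RatOn.comp_rho (hu : RatOn S u) (x : ℕ+) (h0 : ∀ w ∈ S, u w ≠ 0)
    (h1 : ∀ w ∈ S, (q : ℂ) + α - 1 - α * u w ≠ 0) (h2 : ∀ w ∈ S, 1 - (q : ℂ) * u w ≠ 0) :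
    RatOn S fun w => rho q α x (u w) := by
  have hqu : RatOn S fun w => 1 - (q : ℂ) * u w := (RatOn.const 1).sub ((RatOn.const _).mul hu)
  refine (RatOn.div ?_ ?_ fun w hw => ?_).mul ((RatOn.div ?_ hqu h2).pow _)
  · exact (RatOn.const 1).sub ((RatOn.const _).mul (hu.pow 2))
  · exact (hu.mul ((RatOn.const _).sub ((RatOn.const _).mul hu))).mul hqu
  · exact mul_ne_zero (mul_ne_zero (h0 w hw) (h1 w hw)) (h2 w hw)
  · exact (RatOn.const 1).sub hu

theorem RatOn.comp_phi (hu : RatOn S u) (y : ℕ+) (h1 : ∀ w ∈ S, 1 - (q : ℂ) * u w ^ 2 ≠ 0)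
    (h2 : ∀ w ∈ S, 1 - u w ≠ 0) : RatOn S fun w => phi q α y (u w) := by
  have h1u : RatOn S fun w => 1 - u w := (RatOn.const 1).sub hu
  refine ((RatOn.div ?_ ?_ h1).mul (RatOn.div ((RatOn.const _).mul hu) h1u h2)).mul
    ((RatOn.div ?_ h1u h2).pow _)
  · exact (RatOn.const _).add ((RatOn.const _).mul hu)
  · exact (RatOn.const 1).sub ((RatOn.const _).mul (hu.pow 2))
  · exact (RatOn.const 1).sub ((RatOn.const _).mul hu)

theorem RatOn.comp_flip (hq : q ≠ 0) (hu : RatOn S u) (ε : ℤˣ) (h0 : ∀ w ∈ S, u w ≠ 0) :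
    RatOn S fun w => flip q ε (u w) := by
  have hq' : (q : ℂ) ≠ 0 := by exact_mod_cast hq
  unfold flip
  split_ifs
  · exact hu
  · exact (RatOn.const 1).div ((RatOn.const _).mul hu) fun w hw => mul_ne_zero hq' (h0 w hw)

theorem RatOn.comp_pairFactor (hu : RatOn S u) (hv : RatOn S v) (ε δ : ℤˣ)
    (h1 : (ε = 1 ∧ δ = 1) ∨ ∀ w ∈ S, 1 - u w * v w ≠ 0) (h2 : ∀ w ∈ S, u w - q * v w ≠ 0) :
    RatOn S fun w => pairFactor q ε δ (u w) (v w) := by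
  have hd : RatOn S fun w => u w - q * v w := hu.sub ((RatOn.const _).mul hv)
  have huv : RatOn S fun w => u w * v w := hu.mul hv
  unfold pairFactor
  split_ifs with hδ hε hε
  · exact hd.inv h2
  · have h1' := h1.resolve_left fun h => hε h.1
    exact RatOn.div ((((RatOn.const _).mul hu).sub hv).mul hu)
      (((RatOn.const 1).sub huv).mul hd) fun w hw => mul_ne_zero (h1' w hw) (h2 w hw)
  · have h1' := h1.resolve_left fun h => hδ h.2
    exact hv.div (huv.sub (RatOn.const 1)) fun w hw h => h1' w hw (by linear_combination -h)
  · have h1' := h1.resolve_left fun h => hδ h.2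
    exact RatOn.div (((((RatOn.const _).mul hu).mul hv).sub (RatOn.const 1)).mul huv)
      (((RatOn.const 1).sub huv).mul hd) fun w hw => mul_ne_zero (h1' w hw) (h2 w hw)

theorem RatOrd.continuousOn {N : ℕ} {C : Fin N → ℝ → ℂ} (hC : Admissible q α C) {i : Fin N}
    {f : (Fin N → ℂ) → ℂ} (hf : RatOrd (solidTorus C i) i 0 f) : ContinuousOn f (torus C) := by
  obtain ⟨g, hg, hfg⟩ := hf
  refine (hg.continuousOn.mono (torus_subset_solidTorus i)).congr fun w hw => ?_
  rw [hfg w (torus_subset_solidTorus i hw) (hC.ne_one (hw i)), zpow_zero, one_mul]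

theorem ratOrd_phi {i : ι} (y : ℕ+) (h1 : ∀ w ∈ S, 1 - (q : ℂ) * w i ^ 2 ≠ 0) :
    RatOrd S i (-(y : ℤ)) fun w => phi q α y (w i) := by
  have hc : RatOn S fun w => w i := RatOn.coord i
  have hreg : RatOn S fun w => (1 - q - α + α * w i) / (1 - q * w i ^ 2) * ((1 - q) * w i)
      * (1 - q * w i) ^ ((y : ℕ) - 1) := by
    refine (RatOn.mul (RatOn.div ?_ ?_ h1) ((RatOn.const _).mul hc)).mul (RatOn.pow ?_ _)
    · exact (RatOn.const _).add ((RatOn.const _).mul hc)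
    · exact (RatOn.const 1).sub ((RatOn.const _).mul (hc.pow 2))
    · exact (RatOn.const 1).sub ((RatOn.const _).mul hc)
  have := (hreg.ratOrd (i := i)).mul (ratOrd_inv_one_sub_pow (S := S) (i := i) (y : ℕ))
  rw [zero_add] at this
  refine this.congr fun w _ h => ?_
  have h0 : 1 - w i ≠ 0 := sub_ne_zero.2 (Ne.symm h)
  obtain ⟨k, hk⟩ : ∃ k : ℕ, (y : ℕ) = k + 1 := ⟨y - 1, by have := y.pos; omega⟩
  rw [phi, hk, Nat.add_sub_cancel, div_pow, pow_succ]
  field_simp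
  ring

/-- The inverted variable at 1/w i takes the value w i / q, and 1 - q (w i / q) = 1 - w i. The power
that produces a pole of `phi` at 1 for an uninverted variable thus becomes a zero. -/
theorem ratOrd_phi_flip_inv (hq : q ≠ 0) {i : ι} (y : ℕ+) (h0 : ∀ w ∈ S, w i ≠ 0)
    (h1 : ∀ w ∈ S, q - w i ^ 2 ≠ 0) (h2 : ∀ w ∈ S, q - w i ≠ 0) :
    RatOrd S i ((y : ℤ) - 1) fun w => phi q α y (flip q (-1) (w i)⁻¹) := by
  have hq' : (q : ℂ) ≠ 0 := by exact_mod_cast hq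
  have hmm : (-1 : ℤˣ) ≠ 1 := by decide
  have hc : RatOn S fun w => w i := RatOn.coord i
  have hreg : RatOn S fun w => (1 - q - α + α * (w i / q)) * q / (q - w i ^ 2)
      * ((1 - q) * w i / (q - w i)) * ((q / (q - w i)) ^ ((y : ℕ) - 1)) := by
    have hqc : RatOn S fun w => q - w i := (RatOn.const _).sub hc
    refine (RatOn.mul (RatOn.div ?_ ?_ h1) (RatOn.div ((RatOn.const _).mul hc) hqc h2)).mul
      (RatOn.pow (RatOn.div (RatOn.const _) hqc h2) _)
    · exact ((RatOn.const _).add ((RatOn.const _).mul (hc.div (RatOn.const _)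
        fun _ _ => hq'))).mul (RatOn.const _)
    · exact (RatOn.const _).sub (hc.pow 2)
  have := (hreg.ratOrd (i := i)).mul (ratOrd_one_sub_pow (S := S) (i := i) ((y : ℕ) - 1))
  rw [zero_add, Nat.cast_sub y.pos, Nat.cast_one] at this
  refine this.congr fun w hw _ => ?_
  have e0 : flip q (-1) (w i)⁻¹ = w i / q := by
    have := h0 w hw
    simp only [flip, hmm, if_false]
    field_simp
  have e1 : 1 - q * (w i / q) ^ 2 = (q - w i ^ 2) / q := by field_simp
  have e2 : 1 - w i / q = (q - w i) / q := by field_simp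
  have e3 : 1 - q * (w i / q) = 1 - w i := by field_simp
  have := h1 w hw
  have := h2 w hw
  rw [phi, e0, e1, e2, e3, mul_assoc _ (_ ^ _) (_ ^ _), ← mul_pow]
  congr 1
  · field_simp
  · congr 1
    field_simp

theorem prod_pairs_ite (p : Fin N) (X : Fin N → ℂ) :
    ∏ a, ∏ b ∈ Finset.Ioi a, (if b = p then X a else 1) = ∏ a ∈ Finset.Iio p, X a := by
  simp only [Finset.prod_ite_eq', Finset.mem_Ioi]
  rw [← Finset.prod_filter]
  congr 1
  ext a
  simp

/-- The contribution of the signs `ε` without its poles in the variable `p`. -/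
def regularPart (q α : ℝ) {M N : ℕ} (y : Fin M → ℕ+) (x : Fin N → ℕ+) (ε : Fin N → ℤˣ) (p : Fin N)
    (u : Fin N → ℂ) : ℂ :=
  (∏ a, rho q α (x a) (u a))
    * (∏ a, ∏ b ∈ Finset.Ioi a, if b = p then u b / u a
        else pairFactor q (ε a) (ε b) (u a) (u b))
    * altSum Finset.univ (bethe q (psi q α y)) fun a => flip q (ε a) (u a)

variable (hC : Admissible q α C) (hq : q ≠ 0) {y : Fin M → ℕ+} {x : Fin N → ℕ+} {ε : Fin N → ℤˣ}
  {p : Fin N} (hεp : ε p = -1) (hε : ∀ a < p, ε a = 1)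

include hεp hε in
-- All signs before p are positive, so each pair (a, p) with a < p contributes w p / (w a w p - 1),
-- with its pole at 1/w a.
theorem signTerm_eq_regularPart {w : Fin N → ℂ} (h0 : ∀ a, w a ≠ 0) :
    signTerm q α y x ε w
      = regularPart q α y x ε p w * ∏ a ∈ Finset.Iio p, (w p - (w a)⁻¹)⁻¹ := by
  have key : ∏ a, ∏ b ∈ Finset.Ioi a, pairFactor q (ε a) (ε b) (w a) (w b)
      = (∏ a, ∏ b ∈ Finset.Ioi a, if b = p then w b / w a
        else pairFactor q (ε a) (ε b) (w a) (w b)) * ∏ a ∈ Finset.Iio p, (w p - (w a)⁻¹)⁻¹ := by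
    rw [← prod_pairs_ite p fun a => (w p - (w a)⁻¹)⁻¹, ← Finset.prod_mul_distrib]
    refine Finset.prod_congr rfl fun a _ => ?_
    rw [← Finset.prod_mul_distrib]
    refine Finset.prod_congr rfl fun b hb => ?_
    rw [Finset.mem_Ioi] at hb
    split_ifs with hbp
    · subst hbp
      have hmm : (-1 : ℤˣ) ≠ 1 := by decide
      have ha := h0 a
      have e : w b - (w a)⁻¹ = (w a * w b - 1) / w a := by field_simp
      rw [pairFactor, hεp, hε a hb, if_neg hmm, if_pos rfl, e, inv_div]
      field_simp
    · rw [mul_one]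
  rw [signTerm, key, regularPart]
  ring

variable {U : Fin N → (Fin N → ℂ) → ℂ} {S : Set (Fin N → ℂ)}

include hC hq hε in
-- The coordinates are general functions `U` because the lemma serves twice: for the variables
-- themselves, and after the substitution of a pole 1/w i for w p.
theorem RatOn.regularPart_factors (hU : ∀ a, RatOn S (U a)) (hd : ∀ a, ∀ w ∈ S, U a w ∈ disc (C a))
    (ht : ∀ b, p < b → ∀ w ∈ S, U b w ∈ trace (C b)) :
    RatOn S fun w => (∏ a, rho q α (x a) (U a w))
      * (∏ a, ∏ b ∈ Finset.Ioi a, if b = p then U b w / U a w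
        else pairFactor q (ε a) (ε b) (U a w) (U b w)) := by
  refine (RatOn.prod _ fun a _ => (hU a).comp_rho _ (fun w hw => hC.ne_zero (hd a w hw))
    (fun w hw => hC.pole_ne_zero (hd a w hw))
    fun w hw => hC.one_sub_mul_ne_zero (hd a w hw)).mul
    (RatOn.prod _ fun a _ => RatOn.prod _ fun b hb => ?_)
  rw [Finset.mem_Ioi] at hb
  by_cases hbp : b = p
  · simp only [if_pos hbp]
    exact (hU b).div (hU a) fun w hw => hC.ne_zero (hd a w hw)
  · simp only [if_neg hbp]
    refine (hU a).comp_pairFactor (hU b) _ _ ?_ fun w hw =>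
      hC.sub_smul_ne_zero hq hb (hd a w hw) (hd b w hw)
    rcases lt_or_gt_of_ne hbp with h | h
    · exact .inl ⟨hε a (hb.trans h), hε b h⟩
    · exact .inr fun w hw => hC.mul_ne_one_of_mem_disc hb (hd a w hw) (ht b h w hw)

theorem RatOn.bethe_factor (hU : ∀ a, RatOn S (U a)) (π : Equiv.Perm (Fin N)) :
    RatOn S fun w => ∏ i, ∏ j ∈ Finset.Ioi i, (U (π i) w - q * U (π j) w) :=
  RatOn.prod _ fun _ _ => RatOn.prod _ fun _ _ => (hU _).sub ((RatOn.const _).mul (hU _))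

include hC hq in
theorem RatOn.phi_flip {u : (Fin N → ℂ) → ℂ} {a : Fin N} (hu : RatOn S u)
    (hd : ∀ w ∈ S, u w ∈ disc (C a)) (y : ℕ+) (δ : ℤˣ) (h1 : δ ≠ 1 ∨ ∀ w ∈ S, u w ≠ 1) :
    RatOn S fun w => phi q α y (flip q δ (u w)) := by
  have hq' : (q : ℂ) ≠ 0 := by exact_mod_cast hq
  refine (hu.comp_flip hq δ fun w hw => hC.ne_zero (hd w hw)).comp_phi y (fun w hw => ?_)
    fun w hw => ?_
  · have h0 := hC.ne_zero (hd w hw)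
    have h2 := hC.one_sub_mul_sq_ne_zero hq (hd w hw)
    unfold flip
    split_ifs
    · exact h2
    · intro h
      field_simp at h
      exact h2 (by linear_combination -h)
  · have h0 := hC.ne_zero (hd w hw)
    have h2 := hC.one_sub_mul_ne_zero (hd w hw)
    unfold flip
    split_ifs with hδ
    · exact sub_ne_zero.2 (h1.resolve_left (not_not.2 hδ) w hw).symm
    · intro h
      field_simp at h
      exact h2 (by linear_combination -h)

include hC hq in
theorem RatOn.psi_flip {u : (Fin N → ℂ) → ℂ} {a : Fin N} (hu : RatOn S u)
    (hd : ∀ w ∈ S, u w ∈ disc (C a)) (i : Fin N) (δ : ℤˣ) (h1 : δ ≠ 1 ∨ ∀ w ∈ S, u w ≠ 1) :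
    RatOn S fun w => psi q α y i (flip q δ (u w)) := by
  unfold psi
  split_ifs with h
  · exact hu.phi_flip hC hq hd _ _ h1
  · exact RatOn.const 1

include hC hq hεp hε in
-- The inverted variable makes `phi` singular only where 1/(q w p) = 1, that is at 1/q, outside the
-- contour. The factor `rho` has no pole at 1 either, so nothing singular in w p remains.
theorem RatOn.regularPart : RatOn (solidTorus C p) (regularPart q α y x ε p) := by
  have hd : ∀ a, ∀ w ∈ solidTorus C p, w a ∈ disc (C a) :=
    fun a w hw => mem_disc_of_mem_solidTorus hw a
  have hmm : (-1 : ℤˣ) ≠ 1 := by decide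
  have hU : ∀ a, RatOn (solidTorus C p) fun w => w a := fun a => RatOn.coord a
  refine (RatOn.regularPart_factors hC hq hε hU hd fun b hb w hw => hw.2 b hb.ne').mul
    (RatOn.sum _ fun π _ => (RatOn.const _).mul (RatOn.mul ?_ (RatOn.prod _ fun i _ => ?_)))
  · exact RatOn.bethe_factor (fun a => (hU a).comp_flip hq _ fun w hw => hC.ne_zero (hd a w hw)) π
  · refine (hU (π i)).psi_flip hC hq (hd (π i)) i (ε (π i)) ?_
    by_cases h : π i = p
    · exact .inl (by rw [h, hεp]; exact hmm)
    · exact .inr fun w hw => hC.ne_one (hw.2 _ h)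

variable (hy : StrictAnti y) {i : Fin N} (hip : i < p)
  (hinv : ∀ b ∈ disc (C i), b⁻¹ ∈ inside (C p))

omit hC hq in
include hinv in
theorem Admissible.mem_disc_update {w : Fin N → ℂ} (hw : w ∈ solidTorus C i) (a : Fin N) :
    Function.update w p (w i)⁻¹ a ∈ disc (C a) := by
  by_cases h : a = p
  · subst h
    rw [Function.update_self]
    exact .inr (hinv _ hw.1)
  · rw [Function.update_of_ne h]
    exact mem_disc_of_mem_solidTorus hw a

include hC hq hεp hε hy hip hinv in
-- After w p has been replaced by 1/w i, the arguments belonging to i and p are w i and w i / q. If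
-- i stands before p in the permutation, the Bethe factor w i - q (w i / q) is zero. Otherwise p
-- belongs to a particle further to the right than that of i: the zero of order y - 1 at w i = 1
-- from p outweighs the pole of order y' < y from i. Positions beyond `M` contribute order 0.
theorem RatOrd.regularPart_update : RatOrd (solidTorus C i) i 0
    fun w => HalfSpaceASEP.regularPart q α y x ε p (Function.update w p (w i)⁻¹) := by
  have hq' : (q : ℂ) ≠ 0 := by exact_mod_cast hq
  have hmm : (-1 : ℤˣ) ≠ 1 := by decide
  have hd : ∀ a, ∀ w ∈ solidTorus C i, Function.update w p (w i)⁻¹ a ∈ disc (C a) :=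
    fun a w hw => Admissible.mem_disc_update hinv hw a
  have hw0 : ∀ w ∈ solidTorus C i, w i ≠ 0 := fun w hw => hC.ne_zero hw.1
  have hU : ∀ a, RatOn (solidTorus C i) fun w => Function.update w p (w i)⁻¹ a := by
    intro a
    by_cases h : a = p
    · subst h
      simpa using (RatOn.coord i).inv hw0
    · simpa [h] using RatOn.coord a
  have hV : ∀ a, RatOn (solidTorus C i) fun w => flip q (ε a) (Function.update w p (w i)⁻¹ a) :=
    fun a => (hU a).comp_flip hq _ fun w hw => hC.ne_zero (hd a w hw)
  have hfac := RatOn.regularPart_factors (x := x) (α := α) hC hq hε hU hd fun b hb w hw => by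
    rw [Function.update_of_ne hb.ne']
    exact hw.2 b (hip.trans hb).ne'
  rw [show (0 : ℤ) = 0 + 0 from rfl]
  refine hfac.ratOrd.mul (RatOrd.sum _ fun π _ => ?_)
  rw [show (0 : ℤ) = 0 + 0 from rfl]
  refine (RatOn.const _).ratOrd.mul ?_
  have hvi : ∀ w : Fin N → ℂ, flip q (ε i) (Function.update w p (w i)⁻¹ i) = w i := fun w => by
    rw [Function.update_of_ne hip.ne, hε i hip, flip, if_pos rfl]
  rcases lt_or_gt_of_ne (show π.symm i ≠ π.symm p from fun h => hip.ne (π.symm.injective h)) with hlt | hlt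
  · refine RatOrd.zero.congr fun w hw _ => ?_
    rw [bethe, Finset.prod_eq_zero (Finset.mem_univ (π.symm i)), zero_mul]
    refine Finset.prod_eq_zero (Finset.mem_Ioi.2 hlt) ?_
    have := hw0 w hw
    simp only [Equiv.apply_symm_apply]
    rw [hvi, Function.update_self, hεp, flip, if_neg hmm]
    field_simp
    ring
  · set o : Fin N → ℤ := fun j => if h : (j : ℕ) < M then
      (if π j = p then (y ⟨j, h⟩ : ℤ) - 1 else if π j = i then -(y ⟨j, h⟩ : ℤ) else 0) else 0
    have hord : ∀ j ∈ (Finset.univ : Finset (Fin N)), RatOrd (solidTorus C i) i (o j) fun w =>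
        psi q α y j (flip q (ε (π j)) (Function.update w p (w i)⁻¹ (π j))) := by
      intro j _
      unfold psi
      by_cases hj : (j : ℕ) < M
      · simp only [o, dif_pos hj]
        split_ifs with h1 h2
        · simp only [h1, Function.update_self, hεp]
          refine ratOrd_phi_flip_inv hq _ hw0 (fun w hw h => ?_) fun w hw => ?_
          -- A zero of q - (w i)² would mean w i / q = 1/w i, which is enclosed by `C p`; but w i /
          -- q is not.
          · refine hC.div_notMem_disc hq hip hw.1 (Or.inr ?_)
            have := hw0 w hw
            have e : w i / q = (w i)⁻¹ := by
              field_simp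
              linear_combination -h
            rw [e]
            exact hinv _ hw.1
          · exact sub_ne_zero.2 (hC.ne_q hq hip hw.1).symm
        · simp only [h2, hvi]
          exact ratOrd_phi _ fun w hw => hC.one_sub_mul_sq_ne_zero hq hw.1
        · refine ((hU (π j)).phi_flip hC hq (hd _) _ _ (.inr fun w hw => ?_)).ratOrd
          rw [Function.update_of_ne h1]
          exact hC.ne_one (hw.2 _ h2)
      · simp only [dif_neg hj, o]
        exact (RatOn.const 1).ratOrd
    refine ((RatOn.bethe_factor hV π).ratOrd.mul (RatOrd.prod _ hord)).mono ?_
    rw [zero_add, Finset.sum_eq_add (π.symm p) (π.symm i) hlt.ne]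
    · have hyy : ∀ h : ((π.symm i : Fin N) : ℕ) < M, ∀ h' : ((π.symm p : Fin N) : ℕ) < M,
          (y ⟨_, h⟩ : ℕ) < y ⟨_, h'⟩ := fun h h' => by
        exact_mod_cast hy (show (⟨_, h'⟩ : Fin M) < ⟨_, h⟩ from hlt)
      have hpos : ∀ k, 0 < (y k : ℕ) := fun k => (y k).pos
      simp only [o, Equiv.apply_symm_apply, if_true, if_neg hip.ne]
      split_ifs with h1 h2 h2
      · have := hyy h2 h1
        omega
      · have := hpos ⟨_, h1⟩
        omega
      · exact absurd (lt_trans (show ((π.symm p : Fin N) : ℕ) < _ from hlt) h2) h1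
      · simp
    · rintro j - ⟨h1, h2⟩
      have h1' : π j ≠ p := fun h => h1 (by rw [← h, Equiv.symm_apply_apply])
      have h2' : π j ≠ i := fun h => h2 (by rw [← h, Equiv.symm_apply_apply])
      simp [o, h1', h2']
    · simp
    · simp

include hε in
theorem regularPart_update_eq_zero {w : Fin N → ℂ} {b : Fin N} (hip : i < p) (hbp : b < p)
    (hbi : b ≠ i) (hwb : w i = w b) :
    HalfSpaceASEP.regularPart q α y x ε p (Function.update w p (w i)⁻¹) = 0 := by
  rw [HalfSpaceASEP.regularPart, altSum_eq_zero _ hbi (by simp), mul_zero]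
  simp only [Function.update_of_ne hbp.ne, Function.update_of_ne hip.ne, hε b hbp, hε i hip, hwb]

theorem Admissible.winding_inv_eq {w c : ℂ} (hC : Admissible q α C) (hip : i < p)
    (hw : w ∈ trace (C i)) (hc : c ∈ trace (C i)) : winding (C p) w⁻¹ = winding (C p) c⁻¹ := by
  have hd : ∀ w ∈ trace (C i), w⁻¹ ∉ trace (C p) := fun w hw h =>
    hC.mul_ne_one i p hip w hw _ h (mul_inv_cancel₀ (hC.ne_zero (.inl hw)))
  have h1 := hC.inv_mem_inside_iff hip hw hc
  rw [mem_inside_iff (hC.simple p), mem_inside_iff (hC.simple p)] at h1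
  rcases (hC.simple p).winding_eq _ (hd w hw) with h | h <;>
    rcases (hC.simple p).winding_eq _ (hd c hc) with h' | h'
  · rw [h, h']
  · have := (h1.2 ⟨hd c hc, h'⟩).2
    rw [this, h']
  · have := (h1.1 ⟨hd w hw, h⟩).2
    rw [this, h]
  · rw [h, h']

include hC hq hεp hε hy in
/-- The terms of the symmetrization that contain inverted variables integrate to zero. -/
theorem nestedInt_signTerm_eq_zero : nestedInt C (signTerm q α y x ε) = 0 := by
  have hreg := RatOn.regularPart hC hq (y := y) (x := x) (M := M) hεp hε
  set R := HalfSpaceASEP.regularPart q α y x ε p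
  have hT : ∀ w ∈ torus C, signTerm q α y x ε w = R w * ∏ a ∈ Finset.Iio p, (w p - (w a)⁻¹)⁻¹ :=
    fun w hw => signTerm_eq_regularPart hεp hε fun a => hC.ne_zero (.inl (hw a))
  have hnt : ∀ w ∈ torus C, ∀ a < p, (w a)⁻¹ ∉ trace (C p) := fun w hw a ha h =>
    hC.mul_ne_one a p ha _ (hw a) _ h (mul_inv_cancel₀ (hC.ne_zero (.inl (hw a))))
  have hinv0 : ∀ w ∈ torus C, ∀ a, ∀ b ∈ (Finset.Iio p).erase a, (w a)⁻¹ - (w b)⁻¹ ≠ 0 :=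
    fun w hw a b hb h => (Finset.mem_erase.1 hb).1
      (hC.injOn_coord hw (inv_injective (sub_eq_zero.1 h))).symm
  rw [nestedInt_congr hT]
  -- Only poles 1/w a enclosed by `C p` contribute. Whether they are enclosed is the same for all
  -- points of `C a`, so one point decides.
  set s := (Finset.Iio p).filter fun a => winding (C p) (C a 0)⁻¹ ≠ 0
  have hsp : ∀ a ∈ s, a < p := fun a ha => Finset.mem_Iio.1 (Finset.mem_filter.1 ha).1
  have hin : ∀ a ∈ s, ∀ b ∈ disc (C a), b⁻¹ ∈ inside (C p) := by
    intro a ha b hb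
    refine hC.inv_mem_inside_of_trace (fun w hw => ?_) hb
    have hd : ∀ w ∈ trace (C a), w⁻¹ ∉ trace (C p) := fun w hw h =>
      hC.mul_ne_one a p (hsp a ha) w hw _ h (mul_inv_cancel₀ (hC.ne_zero (.inl hw)))
    refine ⟨hd w hw, ?_⟩
    rw [hC.winding_inv_eq (hsp a ha) hw (zero_mem_trace _)]
    exact (Finset.mem_filter.1 ha).2
  have hord : ∀ a ∈ s, RatOrd (solidTorus C a) a 0 fun w => R (Function.update w p (w a)⁻¹) :=
    fun a ha => RatOrd.regularPart_update hC hq hεp hε hy (hsp a ha) (hin a ha)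
  refine hC.nestedInt_eq_zero_of_residues p s (g := fun a w => winding (C p) (C a 0)⁻¹
    * R (Function.update w p (w a)⁻¹) * ∏ b ∈ (Finset.Iio p).erase a, ((w a)⁻¹ - (w b)⁻¹)⁻¹)
    ?_ (fun a ha => ?_) (fun a ha w z => ?_) (fun w hw => ?_) fun a ha => ?_
  · refine (hreg.continuousOn.mono (torus_subset_solidTorus p)).mul
      (continuousOn_finsetProd _ fun a ha => ContinuousOn.inv₀ ?_ fun w hw h => ?_)
    · exact ContinuousOn.sub (by fun_prop) (ContinuousOn.inv₀ (by fun_prop)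
        fun w hw => hC.ne_zero (.inl (hw a)))
    · exact hnt w hw a (Finset.mem_Iio.1 ha) (sub_eq_zero.1 h ▸ hw p)
  · refine (continuousOn_const.mul ((hord a ha).continuousOn hC)).mul
      (continuousOn_finsetProd _ fun b hb => ContinuousOn.inv₀ ?_ fun w hw => hinv0 w hw a b hb)
    exact ContinuousOn.sub (ContinuousOn.inv₀ (by fun_prop) fun w hw => hC.ne_zero (.inl (hw a)))
      (ContinuousOn.inv₀ (by fun_prop) fun w hw => hC.ne_zero (.inl (hw b)))
  · have hap := (hsp a ha).ne
    simp only [Function.update_idem, Function.update_of_ne hap]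
    congr 1
    refine Finset.prod_congr rfl fun b hb => ?_
    rw [Function.update_of_ne (Finset.mem_Iio.1 (Finset.mem_erase.1 hb).2).ne]
  · have h1 := (hC.isClosedCurve p).curveInt_mul_prod_inv_sub (hreg.regOn_update
      (Y := disc (C p)) fun z hz => update_mem_solidTorus hw hz) (Finset.Iio p)
      (c := fun a => (w a)⁻¹) (fun a _ b _ h => hC.injOn_coord hw (inv_injective h))
      fun a ha => hnt w hw a (Finset.mem_Iio.1 ha)
    calc _ = _ := curveInt_congr fun z _ => by
            rw [Finset.prod_congr rfl fun a ha => ?_]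
            rw [Function.update_self, Function.update_of_ne (Finset.mem_Iio.1 ha).ne]
      _ = _ := h1
      _ = _ := by
        congr 1
        rw [Finset.sum_filter_of_ne]
        · refine Finset.sum_congr rfl fun a ha => ?_
          rw [hC.winding_inv_eq (Finset.mem_Iio.1 ha) (hw a) (zero_mem_trace _)]
        · intro a _ h0 hz
          rw [hz, zero_mul, zero_mul] at h0
          exact h0 rfl
  · have hap := hsp a ha
    -- The second integration, over w a. There is no pole at 1, and the poles at the other w b, b <
    -- p, are removable because the alternating sum vanishes when two uninverted variables coincide.
    refine hC.nestedInt_eq_zero_of_ratOrd a ((Finset.Iio p).erase a) (by simp)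
      (Ψ := fun w => winding (C p) (C a 0)⁻¹ * R (Function.update w p (w a)⁻¹)
        * ((∏ b ∈ (Finset.Iio p).erase a, -(w a * w b)) * (w p - 1)⁻¹)) (fun w hw => ?_) ?_ ?_
    · have : ∀ b ∈ (Finset.Iio p).erase a, ((w a)⁻¹ - (w b)⁻¹)⁻¹
          = -(w a * w b) * (w a - w b)⁻¹ := fun b hb => by
        have h1 := hC.ne_zero (.inl (hw a))
        have h2 := hC.ne_zero (.inl (hw b))
        have h3 : w b - w a ≠ 0 := sub_ne_zero.2 fun h =>
          (Finset.mem_erase.1 hb).1 (hC.injOn_coord hw h)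
        have e1 : (w a)⁻¹ - (w b)⁻¹ = (w b - w a) / (w a * w b) := by field_simp
        rw [e1, inv_div, ← neg_sub (w b) (w a), inv_neg, neg_mul_neg, div_eq_mul_inv]
      rw [Finset.prod_congr rfl this, Finset.prod_mul_distrib]
      ring
    · have h1 : RatOn (solidTorus C a) fun w => (∏ b ∈ (Finset.Iio p).erase a, -(w a * w b))
          * (w p - 1)⁻¹ := by
        refine (RatOn.prod _ fun b _ => ((RatOn.coord a).mul (RatOn.coord b)).neg).mul
          (((RatOn.coord p).sub (RatOn.const 1)).inv fun w hw => ?_)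
        exact sub_ne_zero.2 (hC.ne_one (hw.2 p hap.ne'))
      simpa using (((RatOn.const (winding (C p) (C a 0)⁻¹)).ratOrd (i := a)).mul
        (hord a ha)).mul h1.ratOrd
    · intro w _ b hb hwb
      obtain ⟨hba, hbp⟩ := Finset.mem_erase.1 hb
      have hz : R (Function.update w p (w a)⁻¹) = 0 :=
        regularPart_update_eq_zero hε hap (Finset.mem_Iio.1 hbp) hba hwb
      rw [hz, mul_zero, zero_mul]

end signs

/-! ### Terms without inverted variables. -/

section positive

variable {q α : ℝ} {M N : ℕ} {C : Fin N → ℝ → ℂ}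

theorem prod_pairs_split (p : Fin N) (g : Fin N → Fin N → ℂ) :
    ∏ a, ∏ b ∈ Finset.Ioi a, g a b = (∏ a ∈ Finset.Iio p, g a p) * (∏ b ∈ Finset.Ioi p, g p b)
      * ∏ a, ∏ b ∈ Finset.Ioi a, (if a = p ∨ b = p then 1 else g a b) := by
  have h2 : ∏ b ∈ Finset.Ioi p, g p b
      = ∏ a, ∏ b ∈ Finset.Ioi a, (if a = p then g p b else 1) := by
    refine Eq.trans ?_ (Finset.prod_eq_single_of_mem p (Finset.mem_univ p) fun a _ ha => ?_).symm
    · simp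
    · simp [ha]
  rw [← prod_pairs_ite p fun a => g a p, h2, ← Finset.prod_mul_distrib, ← Finset.prod_mul_distrib]
  refine Finset.prod_congr rfl fun a _ => ?_
  rw [← Finset.prod_mul_distrib, ← Finset.prod_mul_distrib]
  refine Finset.prod_congr rfl fun b hb => ?_
  rw [Finset.mem_Ioi] at hb
  by_cases h1 : b = p
  · subst h1
    simp [hb.ne]
  · by_cases h2 : a = p
    · subst h2
      simp [h1]
    · simp [h1, h2]

/-- The contribution of the permutation `π` of uninverted variables. -/
def permTerm (q α : ℝ) {M N : ℕ} (y : Fin M → ℕ+) (x : Fin N → ℕ+) (π : Equiv.Perm (Fin N))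
    (w : Fin N → ℂ) : ℂ :=
  (∏ a, rho q α (x a) (w a)) * (∏ a, ∏ b ∈ Finset.Ioi a, (w a - q * w b)⁻¹)
    * (((Equiv.Perm.sign π : ℤ) : ℂ) * bethe q (psi q α y) fun i => w (π i))

theorem signTerm_one (y : Fin M → ℕ+) (x : Fin N → ℕ+) (w : Fin N → ℂ) :
    signTerm q α y x (fun _ => 1) w = ∑ π, permTerm q α y x π w := by
  simp only [signTerm, permTerm, altSum, pairFactor, flip, if_true, Finset.mul_sum]

theorem ratOrd_rho {ι : Type*} {S : Set (ι → ℂ)} {i : ι} (x : ℕ+) (h0 : ∀ w ∈ S, w i ≠ 0)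
    (h1 : ∀ w ∈ S, (q : ℂ) + α - 1 - α * w i ≠ 0) (h2 : ∀ w ∈ S, 1 - (q : ℂ) * w i ≠ 0) :
    RatOrd S i ((x : ℤ) - 1) fun w => rho q α x (w i) := by
  have hc : RatOn S fun w => w i := RatOn.coord i
  have hqu : RatOn S fun w => 1 - (q : ℂ) * w i := (RatOn.const 1).sub ((RatOn.const _).mul hc)
  have hreg : RatOn S fun w => (1 - q * w i ^ 2) / (w i * (q + α - 1 - α * w i) * (1 - q * w i))
      * ((1 - q * w i)⁻¹) ^ ((x : ℕ) - 1) := by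
    refine (RatOn.div ?_ ?_ fun w hw => ?_).mul ((hqu.inv h2).pow _)
    · exact (RatOn.const 1).sub ((RatOn.const _).mul (hc.pow 2))
    · exact (hc.mul ((RatOn.const _).sub ((RatOn.const _).mul hc))).mul hqu
    · exact mul_ne_zero (mul_ne_zero (h0 w hw) (h1 w hw)) (h2 w hw)
  have := (hreg.ratOrd (i := i)).mul (ratOrd_one_sub_pow (S := S) (i := i) ((x : ℕ) - 1))
  rw [zero_add, Nat.cast_sub x.pos, Nat.cast_one] at this
  refine this.congr fun w _ _ => ?_
  rw [rho, div_pow, inv_pow]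
  ring

/-- The boundary pole of `rho` cancels against the zero of `phi`, as does 1 - q w². Only the points
1 and 1/q stay, and `α` disappears. -/
theorem rho_mul_phi (x y : ℕ+) {w : ℂ} (h0 : w ≠ 0) (h1 : (q : ℂ) + α - 1 - α * w ≠ 0)
    (h2 : 1 - (q : ℂ) * w ≠ 0) (h3 : 1 - (q : ℂ) * w ^ 2 ≠ 0) (h4 : 1 - w ≠ 0) :
    rho q α x w * phi q α y w = (q - 1) * ((1 - w) ^ (x : ℕ) * (1 - q * w) ^ (y : ℕ))
      / ((1 - q * w) ^ ((x : ℕ) + 1) * (1 - w) ^ ((y : ℕ) + 1)) := by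
  obtain ⟨k, hk⟩ : ∃ k : ℕ, (x : ℕ) = k + 1 := ⟨x - 1, by have := x.pos; omega⟩
  obtain ⟨l, hl⟩ : ∃ l : ℕ, (y : ℕ) = l + 1 := ⟨y - 1, by have := y.pos; omega⟩
  have e : 1 - (q : ℂ) - α + α * w = -(q + α - 1 - α * w) := by ring
  rw [rho, phi, hk, hl, Nat.add_sub_cancel, Nat.add_sub_cancel, e, div_pow, div_pow]
  generalize (q : ℂ) + α - 1 - α * w = A at *
  generalize 1 - (q : ℂ) * w ^ 2 = B at *
  generalize hD : 1 - (q : ℂ) * w = D at *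
  generalize 1 - w = E at *
  field_simp
  ring

/-- The degree is at most k + `s.card`. With the denominators of `curveInt_eq_sum_outside` this is
decay like w⁻² at infinity. -/
theorem degree_outward_lt {ι : Type*} (c a : ℂ) (k : ℕ) (s : Finset ι) (b : ι → ℂ) :
    (Polynomial.C c * (1 - Polynomial.C a * Polynomial.X) ^ k
      * ∏ i ∈ s, (Polynomial.X - Polynomial.C (b i))).degree
        < ((k + 1 + s.card : ℕ) : WithBot ℕ) := by
  have h1 : (1 - Polynomial.C a * Polynomial.X : Polynomial ℂ).natDegree ≤ 1 := by compute_degree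
  have h2 : (∏ i ∈ s, (Polynomial.X - Polynomial.C (b i))).natDegree = s.card :=
    Polynomial.natDegree_finsetProd_X_sub_C_eq_card _ _
  have h3 : ((1 - Polynomial.C a * Polynomial.X : Polynomial ℂ) ^ k).natDegree ≤ k * 1 :=
    Polynomial.natDegree_pow_le_of_le k h1
  have h4 := Polynomial.natDegree_C_mul_le c ((1 - Polynomial.C a * Polynomial.X) ^ k)
  have h5 := Polynomial.natDegree_mul_le (p := Polynomial.C c
    * (1 - Polynomial.C a * Polynomial.X) ^ k) (q := ∏ i ∈ s, (Polynomial.X - Polynomial.C (b i)))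
  have h6 := h5.trans (by omega : _ ≤ k + s.card)
  refine lt_of_le_of_lt (Polynomial.degree_le_of_natDegree_le h6) ?_
  exact_mod_cast (by omega : k + s.card < k + 1 + s.card)

variable (hC : Admissible q α C)

include hC in
-- The integrand is (q - 1)(1 - w)^(x - y - 1)(1 - q w)^(y - x - 1). For x = y it has a simple pole
-- at 1. For x > y it is regular inside the contour. For x < y its only finite pole is 1 and it
-- decays like w⁻², so it has no residue.
theorem Admissible.curveInt_rho_mul_phi (hq1 : q ≠ 1) (hq : q ≠ 0) (i : Fin N) (x y : ℕ+) :
    (2 * Real.pi * Complex.I)⁻¹ * curveInt (C i) (fun w => rho q α x w * phi q α y w)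
      = if x = y then 1 else 0 := by
  have hpi : (2 * Real.pi * Complex.I : ℂ) ≠ 0 := Complex.two_pi_I_ne_zero
  have hne : ∀ w ∈ trace (C i), 1 - w ≠ 0 := fun w hw => sub_ne_zero.2 (hC.ne_one hw).symm
  have hqw : ∀ w ∈ disc (C i), 1 - q * w ≠ 0 := fun w hw => hC.one_sub_mul_ne_zero hw
  have hcong := fun w (hw : w ∈ trace (C i)) => rho_mul_phi x y (hC.ne_zero (.inl hw))
    (hC.pole_ne_zero (.inl hw)) (hqw w (.inl hw)) (hC.one_sub_mul_sq_ne_zero hq (.inl hw)) (hne w hw)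
  rw [curveInt_congr hcong]
  have hreg1 : RegOn (disc (C i)) fun w => 1 - (q : ℂ) * w :=
    (RegOn.const 1).sub ((RegOn.const _).mul RegOn.id)
  rw [inv_mul_eq_iff_eq_mul₀ hpi]
  split_ifs with hxy
  · subst hxy
    have hreg : RegOn (disc (C i)) fun w => (1 - q) / (1 - q * w) :=
      (RegOn.const _).div hreg1 hqw
    have h1 := (hC.isClosedCurve i).curveInt_mul_inv_sub hreg (hC.one_notMem_trace i)
    rw [hC.winding_one, mul_one, mul_one, div_self
      (sub_ne_zero.2 (by exact_mod_cast hq1.symm))] at h1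
    rw [← h1]
    refine curveInt_congr fun w hw => ?_
    have h2 := hne w hw
    have h3 := hqw w (.inl hw)
    rw [← neg_sub 1 w, ← neg_sub (1 : ℂ) (q : ℂ)]
    generalize 1 - (q : ℂ) * w = D at *
    generalize 1 - w = E at *
    field_simp
    ring
  · rw [mul_zero]
    rcases lt_or_gt_of_ne hxy with h | h
    · obtain ⟨k, hk⟩ : ∃ k : ℕ, (y : ℕ) = x + 1 + k :=
        ⟨y - x - 1, by have : (x : ℕ) < y := h; omega⟩
      have hdeg := degree_outward_lt ((q - 1) * (-1 : ℂ) ^ k) q k (∅ : Finset ℕ) fun _ => 0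
      simp only [Finset.prod_empty, mul_one, Finset.card_empty, add_zero] at hdeg
      rw [← curveInt_poly_div_pow (hC.isClosedCurve i) (hC.one_notMem_trace i) (k + 1) _ hdeg]
      refine curveInt_congr fun w hw => ?_
      have h2 := hne w hw
      have h3 := hqw w (.inl hw)
      have h4 : w - 1 = -1 * (1 - w) := by ring
      simp only [Polynomial.eval_mul, Polynomial.eval_C, Polynomial.eval_pow, Polynomial.eval_sub,
        Polynomial.eval_one, Polynomial.eval_X]
      rw [hk, h4, mul_pow]
      have h5 : ((-1 : ℂ)) ^ k * (-1) ^ k = 1 := by rw [← mul_pow]; simp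
      have h6 : ((-1 : ℂ)) ^ (k + 1 + 1) = (-1) ^ k := by ring
      have h7 : ((-1 : ℂ)) ^ k ≠ 0 := pow_ne_zero _ (by norm_num)
      rw [h6]
      generalize 1 - (q : ℂ) * w = D at *
      generalize 1 - w = E at *
      field_simp
      ring
    · obtain ⟨k, hk⟩ : ∃ k : ℕ, (x : ℕ) = y + 1 + k :=
        ⟨x - y - 1, by have : (y : ℕ) < x := h; omega⟩
      refine Eq.trans ?_ ((hC.isClosedCurve i).curveInt_eq_zero
        (f := fun w => (q - 1) * (1 - w) ^ k / (1 - q * w) ^ (k + 2)) ?_)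
      · refine curveInt_congr fun w hw => ?_
        have h2 := hne w hw
        have h3 := hqw w (.inl hw)
        rw [hk]
        generalize 1 - (q : ℂ) * w = D at *
        generalize 1 - w = E at *
        field_simp
        ring
      · exact ((RegOn.const _).mul (((RegOn.const 1).sub RegOn.id).pow k)).div (hreg1.pow _)
          fun w hw => pow_ne_zero _ (hqw w hw)

/-! ### Regularity of the permutation terms, and the case of too few particles. -/

section permTerm

variable (hq : q ≠ 0) {y : Fin M → ℕ+} {x : Fin N → ℕ+}
include hC hq

theorem Admissible.ratOn_pair_inv (c : Fin N) {a b : Fin N} (hab : a < b) :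
    RatOn (solidTorus C c) fun w => (w a - q * w b)⁻¹ :=
  ((RatOn.coord a).sub ((RatOn.const _).mul (RatOn.coord b))).inv fun _ hw =>
    hC.sub_smul_ne_zero hq hab (mem_disc_of_mem_solidTorus hw a) (mem_disc_of_mem_solidTorus hw b)

omit hq in
theorem Admissible.ratOn_rho (c : Fin N) (x : ℕ+) (a : Fin N) :
    RatOn (solidTorus C c) fun w => rho q α x (w a) :=
  (RatOn.coord a).comp_rho x (fun _ hw => hC.ne_zero (mem_disc_of_mem_solidTorus hw a))
    (fun _ hw => hC.pole_ne_zero (mem_disc_of_mem_solidTorus hw a))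
    fun _ hw => hC.one_sub_mul_ne_zero (mem_disc_of_mem_solidTorus hw a)

theorem Admissible.ratOn_phi {c a : Fin N} (h : a ≠ c) (y : ℕ+) :
    RatOn (solidTorus C c) fun w => phi q α y (w a) :=
  (RatOn.coord a).comp_phi y
    (fun _ hw => hC.one_sub_mul_sq_ne_zero hq (mem_disc_of_mem_solidTorus hw a))
    fun _ hw => sub_ne_zero.2 (hC.ne_one (hw.2 a h)).symm

omit hq in
theorem Admissible.ratOrd_prod_rho (s : Finset (Fin N)) {c : Fin N} (hc : c ∈ s) :
    RatOrd (solidTorus C c) c ((x c : ℤ) - 1) fun w => ∏ a ∈ s, rho q α (x a) (w a) := by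
  have h : ∀ a ∈ s, RatOrd (solidTorus C c) c (if a = c then (x c : ℤ) - 1 else 0)
      fun w => rho q α (x a) (w a) := by
    intro a _
    split_ifs with hac
    · subst hac
      exact ratOrd_rho _ (fun w hw => hC.ne_zero hw.1) (fun w hw => hC.pole_ne_zero hw.1)
        fun w hw => hC.one_sub_mul_ne_zero hw.1
    · exact (hC.ratOn_rho c (x a) a).ratOrd
  have := RatOrd.prod s h
  rwa [Finset.sum_ite_eq', if_pos hc] at this

theorem Admissible.ratOrd_prod_phi {y : Fin N → ℕ+} (π : Equiv.Perm (Fin N)) (s : Finset (Fin N))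
    {c : Fin N} (hc : π.symm c ∈ s) :
    RatOrd (solidTorus C c) c (-(y (π.symm c) : ℤ)) fun w => ∏ i ∈ s, phi q α (y i) (w (π i)) := by
  have h : ∀ i ∈ s, RatOrd (solidTorus C c) c
      (if i = π.symm c then -(y (π.symm c) : ℤ) else 0) fun w => phi q α (y i) (w (π i)) := by
    intro i _
    split_ifs with hi
    · subst hi
      rw [Equiv.apply_symm_apply]
      exact ratOrd_phi _ fun w hw => hC.one_sub_mul_sq_ne_zero hq hw.1
    · refine (hC.ratOn_phi hq (fun h => hi ?_) (y i)).ratOrd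
      rw [← h, Equiv.symm_apply_apply]
  have := RatOrd.prod s h
  rwa [Finset.sum_ite_eq', if_pos hc] at this

/-- A variable in a position without particle carries no `phi`, the only source of poles at 1. -/
theorem Admissible.ratOn_permTerm (π : Equiv.Perm (Fin N)) {c : Fin N}
    (hc : ¬ (π.symm c : ℕ) < M) : RatOn (solidTorus C c) (permTerm q α y x π) := by
  have h1 : RatOn (solidTorus C c) fun w => ∏ i, psi q α y i (w (π i)) := by
    refine RatOn.prod _ fun i _ => ?_
    unfold psi
    split_ifs with h
    · refine hC.ratOn_phi hq (fun h' => hc ?_) _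
      rwa [← h', Equiv.symm_apply_apply]
    · exact RatOn.const 1
  have h2 : RatOn (solidTorus C c) fun w => ∏ a, ∏ b ∈ Finset.Ioi a, (w a - q * w b)⁻¹ :=
    RatOn.prod _ fun a _ => RatOn.prod _ fun b hb => hC.ratOn_pair_inv hq c (Finset.mem_Ioi.1 hb)
  exact ((RatOn.prod _ fun a _ => hC.ratOn_rho c (x a) a).mul h2).mul ((RatOn.const _).mul
    ((RatOn.bethe_factor (q := q) (U := fun a w => w a) (fun a => RatOn.coord a) π).mul h1))

theorem Admissible.continuousOn_permTerm (π : Equiv.Perm (Fin N)) :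
    ContinuousOn (permTerm q α y x π) (torus C) := by
  refine ((continuousOn_finsetProd _ fun a _ => ?_).mul (continuousOn_finsetProd _ fun a _ =>
    continuousOn_finsetProd _ fun b hb => ?_)).mul (continuousOn_const.mul
      (ContinuousOn.mul ?_ (continuousOn_finsetProd _ fun i _ => ?_)))
  · exact (hC.ratOn_rho a (x a) a).continuousOn.mono (torus_subset_solidTorus a)
  · exact (hC.ratOn_pair_inv hq a (Finset.mem_Ioi.1 hb)).continuousOn.mono
      (torus_subset_solidTorus a)
  · exact continuousOn_finsetProd _ fun i _ => continuousOn_finsetProd _ fun j _ => by fun_prop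
  · unfold psi
    split_ifs with h
    · refine (RatOn.comp_phi (S := torus C) (RatOn.coord (π i)) _ (fun w hw => ?_)
        fun w hw => ?_).continuousOn
      · exact hC.one_sub_mul_sq_ne_zero hq (.inl (hw _))
      · exact sub_ne_zero.2 (hC.ne_one (hw _)).symm
    · exact continuousOn_const

theorem Admissible.nestedInt_signTerm_one_of_lt (hMN : M < N) :
    nestedInt C (signTerm q α y x fun _ => 1) = 0 := by
  rw [nestedInt_congr fun w _ => signTerm_one y x w, nestedInt_sum hC.isClosedCurve _
    fun π _ => hC.continuousOn_permTerm hq π]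
  refine Finset.sum_eq_zero fun π _ => ?_
  -- Position `M`, counted from 0, is the first one without a particle.
  refine hC.nestedInt_eq_zero_of_ratOrd (π ⟨M, hMN⟩) ∅ (by simp) (Ψ := permTerm q α y x π)
    (by simp) (hC.ratOn_permTerm hq π ?_).ratOrd (by simp)
  simp

end permTerm

/-! ### Equal numbers of particles: the identity and the terms that vanish individually. -/

section square

variable {y : Fin N → ℕ+} {x : Fin N → ℕ+}

theorem bethe_psi (v : Fin N → ℂ) : bethe q (psi q α y) v
    = (∏ i, ∏ j ∈ Finset.Ioi i, (v i - q * v j)) * ∏ i, phi q α (y i) (v i) := by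
  simp [bethe, psi]

variable (hq : q ≠ 0)
include hC hq

/-- For the identity the Bethe factors cancel the pair factors, and the integral is a product of
one-variable integrals. -/
theorem Admissible.nestedInt_permTerm_one (hq1 : q ≠ 1) :
    nestedInt C (permTerm q α y x 1) = if x = y then 1 else 0 := by
  have h : ∀ w ∈ torus C, permTerm q α y x 1 w = ∏ a, (rho q α (x a) (w a) * phi q α (y a) (w a)) := by
    intro w hw
    rw [permTerm, bethe_psi, Finset.prod_mul_distrib]
    simp only [Equiv.Perm.one_apply, Equiv.Perm.sign_one, Units.val_one, Int.cast_one, one_mul]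
    have h1 : (∏ a, ∏ b ∈ Finset.Ioi a, (w a - q * w b)⁻¹)
        * ∏ a, ∏ b ∈ Finset.Ioi a, (w a - q * w b) = 1 := by
      rw [← Finset.prod_mul_distrib]
      refine Finset.prod_eq_one fun a _ => ?_
      rw [← Finset.prod_mul_distrib]
      refine Finset.prod_eq_one fun b hb => inv_mul_cancel₀ ?_
      exact hC.sub_smul_ne_zero hq (Finset.mem_Ioi.1 hb) (.inl (hw a)) (.inl (hw b))
    linear_combination (∏ a, rho q α (x a) (w a)) * (∏ a, phi q α (y a) (w a)) * h1
  rw [nestedInt_congr h, nestedInt_prod fun a z => rho q α (x a) z * phi q α (y a) z]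
  simp only [hC.curveInt_rho_mul_phi hq1 hq]
  split_ifs with hxy
  · simp [hxy]
  · obtain ⟨a, ha⟩ := Function.ne_iff.1 hxy
    exact Finset.prod_eq_zero (Finset.mem_univ a) (by simp [ha])

/-- At w c = 1 the term has order at least x c - 1 - y(π⁻¹ c), which the hypothesis makes
nonnegative. -/
theorem Admissible.nestedInt_permTerm_eq_zero (π : Equiv.Perm (Fin N)) (c : Fin N)
    (hc : y (π.symm c) < x c) : nestedInt C (permTerm q α y x π) = 0 := by
  refine hC.nestedInt_eq_zero_of_ratOrd c ∅ (by simp) (Ψ := permTerm q α y x π)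
    (by simp) ?_ (by simp)
  have h1 : RatOn (solidTorus C c) fun w => ∏ a, ∏ b ∈ Finset.Ioi a, (w a - q * w b)⁻¹ :=
    RatOn.prod _ fun a _ => RatOn.prod _ fun b hb => hC.ratOn_pair_inv hq c (Finset.mem_Ioi.1 hb)
  have h2 := (((hC.ratOrd_prod_rho (x := x) Finset.univ (Finset.mem_univ c)).mul h1.ratOrd).mul
    ((RatOn.const ((Equiv.Perm.sign π : ℤ) : ℂ)).ratOrd.mul
      ((RatOn.bethe_factor (q := q) (U := fun a w => w a) (fun a => RatOn.coord a) π).ratOrd.mul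
        (hC.ratOrd_prod_phi hq (y := y) π Finset.univ (Finset.mem_univ _)))))
  have hlt : (y (π.symm c) : ℤ) < x c := by exact_mod_cast hc
  refine (h2.mono (n := 0) (by omega)).congr fun w _ _ => ?_
  rw [permTerm, bethe_psi]

end square

end positive

/-! ### Groups of permutations that vanish through residues outside the contour. -/

section outward

variable {q α : ℝ} {N : ℕ} {C : Fin N → ℝ → ℂ} {y x : Fin N → ℕ+} {k l : Fin N}

/-- The permutations that fix everything before `k` and move `k` to `l`. -/
def firstMoved (k l : Fin N) : Finset (Equiv.Perm (Fin N)) :=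
  Finset.univ.filter fun π => (∀ i < k, π i = i) ∧ π k = l

theorem le_symm_of_mem_firstMoved {π : Equiv.Perm (Fin N)} (hπ : π ∈ firstMoved k l) {a : Fin N}
    (ha : k ≤ a) : k ≤ π.symm a := by
  by_contra h
  have h1 := (Finset.mem_filter.1 hπ).2.1 _ (not_le.1 h)
  rw [Equiv.apply_symm_apply] at h1
  rw [← h1] at h
  exact h ha

theorem lt_symm_of_mem_firstMoved {π : Equiv.Perm (Fin N)} (hπ : π ∈ firstMoved k l) {a : Fin N}
    (ha : k ≤ a) (hal : a ≠ l) : k < π.symm a := by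
  refine lt_of_le_of_ne (le_symm_of_mem_firstMoved hπ ha) fun h => hal ?_
  rw [← (Finset.mem_filter.1 hπ).2.2, h, Equiv.apply_symm_apply]

/-- The part of a Bethe wave function that does not involve the position `k`. -/
def innerPart (q α : ℝ) (y : Fin N → ℕ+) (k : Fin N) (v : Fin N → ℂ) : ℂ :=
  (∏ i, ∏ j ∈ Finset.Ioi i, if i = k ∨ j = k then 1 else v i - q * v j)
    * ∏ i ∈ Finset.univ.erase k, phi q α (y i) (v i)

/-- The part of the integrand that does not involve the variable `l`. -/
def spectator (q α : ℝ) (y x : Fin N → ℕ+) (k l : Fin N) (w : Fin N → ℂ) : ℂ :=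
  (∏ a ∈ Finset.univ.erase l, rho q α (x a) (w a))
    * (∏ a, ∏ b ∈ Finset.Ioi a, if a = l ∨ b = l then 1 else (w a - q * w b)⁻¹)
    * altSum (firstMoved k l) (innerPart q α y k) w

variable (hC : Admissible q α C) (hq : q ≠ 0) (hkl : k < l)

include hC hq hkl in
-- Throughout the group the variable l stands in position k, after the fixed variables with index
-- below k and before all others. So the factors that contain w l are common to all terms: those
-- with index below k or above l cancel, and the range from k up to l remains.
theorem Admissible.sum_permTerm_eq {w : Fin N → ℂ} (hw : w ∈ torus C) :
    ∑ π ∈ firstMoved k l, permTerm q α y x π w = rho q α (x l) (w l) * phi q α (y k) (w l)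
      * (∏ a ∈ Finset.Ico k l, ((w l - q * w a) * (w a - q * w l)⁻¹)) * spectator q α y x k l w := by
  have hne : ∀ {a b : Fin N}, a < b → w a - q * w b ≠ 0 := fun hab =>
    hC.sub_smul_ne_zero hq hab (.inl (hw _)) (.inl (hw _))
  have hA : (∏ a ∈ Finset.Iio k, (w a - q * w l)⁻¹) * ∏ a ∈ Finset.Iio k, (w a - q * w l) = 1 := by
    rw [← Finset.prod_mul_distrib]
    exact Finset.prod_eq_one fun a ha => inv_mul_cancel₀ (hne ((Finset.mem_Iio.1 ha).trans hkl))
  have hB : (∏ b ∈ Finset.Ioi l, (w l - q * w b)⁻¹) * ∏ b ∈ Finset.Ioi l, (w l - q * w b) = 1 := by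
    rw [← Finset.prod_mul_distrib]
    exact Finset.prod_eq_one fun b hb => inv_mul_cancel₀ (hne (Finset.mem_Ioi.1 hb))
  have hsplit : ∏ a ∈ Finset.Iio l, (w a - q * w l)⁻¹
      = (∏ a ∈ Finset.Iio k, (w a - q * w l)⁻¹) * ∏ a ∈ Finset.Ico k l, (w a - q * w l)⁻¹ := by
    rw [← Finset.prod_union]
    · congr 1
      ext a
      simp only [Finset.mem_Iio, Finset.mem_union, Finset.mem_Ico]
      constructor
      · intro h
        rcases lt_or_ge a k with h' | h'
        exacts [.inl h', .inr ⟨h', h⟩]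
      · rintro (h | h)
        exacts [h.trans hkl, h.2]
    · rw [Finset.disjoint_left]
      intro a ha ha'
      exact absurd (Finset.mem_Ico.1 ha').1 (not_le.2 (Finset.mem_Iio.1 ha))
  rw [spectator, altSum, Finset.mul_sum, Finset.mul_sum]
  refine Finset.sum_congr rfl fun π hπ => ?_
  obtain ⟨hfix, hπk⟩ := (Finset.mem_filter.1 hπ).2
  have h1 : ∏ i ∈ Finset.Iio k, (w (π i) - q * w (π k)) = ∏ a ∈ Finset.Iio k, (w a - q * w l) :=
    Finset.prod_congr rfl fun i hi => by rw [hfix i (Finset.mem_Iio.1 hi), hπk]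
  have h2 : ∏ j ∈ Finset.Ioi k, (w (π k) - q * w (π j))
      = (∏ a ∈ Finset.Ico k l, (w l - q * w a)) * ∏ b ∈ Finset.Ioi l, (w l - q * w b) := by
    rw [← Finset.prod_union]
    · refine Finset.prod_equiv π (fun j => ?_) fun j _ => by rw [hπk]
      simp only [Finset.mem_Ioi, Finset.mem_union, Finset.mem_Ico]
      constructor
      · intro hj
        have hne : π j ≠ l := fun h => hj.ne' (π.injective (h.trans hπk.symm))
        have hge : k ≤ π j := by
          by_contra h
          have e : π j = j := π.injective (hfix _ (not_le.1 h))
          rw [e] at h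
          exact h hj.le
        rcases lt_or_gt_of_ne hne with h | h
        exacts [.inl ⟨hge, h⟩, .inr h]
      · intro h
        have hge : k ≤ π j := h.elim (fun h => h.1) fun h => (hkl.trans h).le
        have hne : π j ≠ l := h.elim (fun h => h.2.ne) fun h => h.ne'
        simpa using lt_symm_of_mem_firstMoved hπ hge hne
    · rw [Finset.disjoint_left]
      intro a ha ha'
      exact absurd (Finset.mem_Ico.1 ha).2 (not_lt.2 (Finset.mem_Ioi.1 ha').le)
  rw [permTerm, bethe_psi, prod_pairs_split l fun a b => (w a - q * w b)⁻¹,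
    prod_pairs_split k fun i j => (w (π i) - q * w (π j)), h1, h2, hsplit, innerPart,
    ← Finset.mul_prod_erase _ _ (Finset.mem_univ l), ← Finset.mul_prod_erase Finset.univ
      (fun i => phi q α (y i) (w (π i))) (Finset.mem_univ k), hπk, Finset.prod_mul_distrib]
  generalize ∏ a ∈ Finset.Iio k, (w a - q * w l)⁻¹ = A' at *
  generalize ∏ a ∈ Finset.Iio k, (w a - q * w l) = A at *
  generalize ∏ b ∈ Finset.Ioi l, (w l - q * w b)⁻¹ = B' at *
  generalize ∏ b ∈ Finset.Ioi l, (w l - q * w b) = B at *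
  generalize ∏ b ∈ Finset.Ico k l, (w l - q * w b) = E at *
  generalize ∏ a ∈ Finset.Ico k l, (w a - q * w l)⁻¹ = E' at *
  generalize ∏ a ∈ Finset.univ.erase l, rho q α (x a) (w a) = R at *
  generalize ∏ i ∈ Finset.univ.erase k, phi q α (y i) (w (π i)) = I at *
  generalize (∏ a, ∏ b ∈ Finset.Ioi a, if a = l ∨ b = l then 1 else (w a - q * w b)⁻¹) = D at *
  generalize (∏ i, ∏ j ∈ Finset.Ioi i, if i = k ∨ j = k then 1 else w (π i) - q * w (π j)) = J at *
  generalize ((Equiv.Perm.sign π : ℤ) : ℂ) = s at *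
  generalize rho q α (x l) (w l) = r at *
  generalize phi q α (y k) (w l) = p at *
  linear_combination r * R * E' * D * s * E * J * p * I * B' * B * hA
    + r * R * E' * D * s * E * J * p * I * hB

theorem spectator_update (w : Fin N → ℂ) (z : ℂ) :
    spectator q α y x k l (Function.update w l z) = spectator q α y x k l w := by
  unfold spectator
  congr 1
  · congr 1
    · exact Finset.prod_congr rfl fun a ha => by
        rw [Function.update_of_ne (Finset.ne_of_mem_erase ha)]
    · refine Finset.prod_congr rfl fun a _ => Finset.prod_congr rfl fun b _ => ?_
      split_ifs with h
      · rfl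
      · rw [Function.update_of_ne (fun h' => h (.inl h')), Function.update_of_ne fun h' => h (.inr h')]
  · refine Finset.sum_congr rfl fun π hπ => ?_
    have hne : ∀ i, i ≠ k → π i ≠ l := fun i hi h =>
      hi (π.injective (h.trans (Finset.mem_filter.1 hπ).2.2.symm))
    unfold innerPart
    congr 2
    · refine Finset.prod_congr rfl fun a _ => Finset.prod_congr rfl fun b _ => ?_
      split_ifs with h
      · rfl
      · simp only
        rw [Function.update_of_ne (hne a fun h' => h (.inl h')),
          Function.update_of_ne (hne b fun h' => h (.inr h'))]
    · exact Finset.prod_congr rfl fun a ha => by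
        simp only
        rw [Function.update_of_ne (hne a (Finset.ne_of_mem_erase ha))]

/-- A transposition of two indices in [k, l) fixes l and everything below k, hence preserves the
group. -/
theorem spectator_eq_zero {w : Fin N → ℂ} {a c : Fin N} (ha : a ∈ Finset.Ico k l)
    (hc : c ∈ Finset.Ico k l) (hac : a ≠ c) (hw : w c = w a) : spectator q α y x k l w = 0 := by
  rw [spectator, altSum_eq_zero _ hac.symm (fun π hπ => ?_) hw, mul_zero]
  rw [Finset.mem_Ico] at ha hc
  obtain ⟨hfix, hπk⟩ := (Finset.mem_filter.1 hπ).2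
  refine Finset.mem_filter.2 ⟨Finset.mem_univ _, fun i hi => ?_, ?_⟩
  · rw [Equiv.Perm.mul_apply, hfix i hi]
    exact Equiv.swap_apply_of_ne_of_ne (hi.trans_le hc.1).ne (hi.trans_le ha.1).ne
  · rw [Equiv.Perm.mul_apply, hπk]
    exact Equiv.swap_apply_of_ne_of_ne hc.2.ne' ha.2.ne'

include hC hq in
-- A variable c in [k, l) stands in a position after k, where the particle is strictly to the left
-- of y k. This gains one order over the bound x c - 1 - y k.
theorem Admissible.ratOrd_spectator (hy : StrictAnti y) {c : Fin N} (hc : c ∈ Finset.Ico k l) :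
    RatOrd (solidTorus C c) c ((x c : ℤ) - y k) (spectator q α y x k l) := by
  rw [Finset.mem_Ico] at hc
  have h1 : RatOn (solidTorus C c) fun w =>
      ∏ a, ∏ b ∈ Finset.Ioi a, if a = l ∨ b = l then 1 else (w a - q * w b)⁻¹ := by
    refine RatOn.prod _ fun a _ => RatOn.prod _ fun b hb => ?_
    split_ifs
    · exact RatOn.const 1
    · exact hC.ratOn_pair_inv hq c (Finset.mem_Ioi.1 hb)
  have h2 : RatOrd (solidTorus C c) c (-(y k : ℤ) + 1)
      (altSum (firstMoved k l) (innerPart q α y k)) := by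
    refine RatOrd.sum _ fun π hπ => ?_
    have hlt := lt_symm_of_mem_firstMoved hπ hc.1 hc.2.ne
    have h3 : RatOn (solidTorus C c) fun w =>
        ∏ i, ∏ j ∈ Finset.Ioi i, if i = k ∨ j = k then 1 else w (π i) - q * w (π j) := by
      refine RatOn.prod _ fun a _ => RatOn.prod _ fun b hb => ?_
      split_ifs
      · exact RatOn.const 1
      · exact (RatOn.coord _).sub ((RatOn.const _).mul (RatOn.coord _))
    have hyy : (y (π.symm c) : ℤ) < y k := by exact_mod_cast hy hlt
    exact ((RatOn.const ((Equiv.Perm.sign π : ℤ) : ℂ)).ratOrd.mul (h3.ratOrd.mul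
      (hC.ratOrd_prod_phi hq (y := y) π (Finset.univ.erase k)
        (Finset.mem_erase.2 ⟨hlt.ne', Finset.mem_univ _⟩)))).mono (by omega)
  exact (((hC.ratOrd_prod_rho (x := x) (Finset.univ.erase l)
    (Finset.mem_erase.2 ⟨hc.2.ne, Finset.mem_univ _⟩)).mul h1.ratOrd).mul h2).mono (by omega)

include hC hq hkl in
/-- The permutations that move `k` to `l` cancel, by taking residues outside of the contour. -/
theorem Admissible.nestedInt_firstMoved_of_lt (hy : StrictAnti y) (hx : StrictAnti x)
    (hxy : x l < y k) :
    nestedInt C (fun w => ∑ π ∈ firstMoved k l, permTerm q α y x π w) = 0 := by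
  have hq' : (q : ℂ) ≠ 0 := by exact_mod_cast hq
  -- Since y k > x l, the factor 1 - q z stands in the numerator with the power m, so 1/q is not a
  -- pole.
  obtain ⟨m, hm⟩ : ∃ m : ℕ, (y k : ℕ) = x l + 1 + m :=
    ⟨y k - x l - 1, by have : (x l : ℕ) < y k := hxy; omega⟩
  set I := Finset.Ico k l
  -- The powers of -1 turn 1 - z into z - 1, and the powers of -1/q come from w a - q z = -q (z - w
  -- a / q).
  set K : ℂ := (q - 1) * (-1) ^ m * (-(q : ℂ)⁻¹) ^ I.card
  set P : (Fin N → ℂ) → Polynomial ℂ := fun w => Polynomial.C K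
    * (1 - Polynomial.C (q : ℂ) * Polynomial.X) ^ m
    * ∏ a ∈ I, (Polynomial.X - Polynomial.C (q * w a))
  have hPe : ∀ w z, (P w).eval z = K * (1 - q * z) ^ m * ∏ a ∈ I, (z - q * w a) := by
    intro w z
    simp [P, Polynomial.eval_prod]
  have hcont : ContinuousOn (fun w => ∑ π ∈ firstMoved k l, permTerm q α y x π w) (torus C) :=
    continuousOn_finsetSum _ fun π _ => hC.continuousOn_permTerm hq π
  have hIl : ∀ c ∈ I, c < l := fun c hc => (Finset.mem_Ico.1 hc).2
  -- The residue at the outer pole w l = w c / q, without its singular factors. The power (1 - q w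
  -- l)^m becomes (1 - w c)^m there.
  set A : Fin N → (Fin N → ℂ) → ℂ := fun c w => (1 - w c) ^ m
    * (-K * (∏ a ∈ I, (w c / q - q * w a)) * ((w c / q - 1) ^ (m + 1 + 1))⁻¹
      * ∏ _a ∈ I.erase c, (q : ℂ)) * spectator q α y x k l w
  have hA : ∀ c ∈ I, RatOrd (solidTorus C c) c 0 (A c) := by
    intro c hc
    have hcq : RatOn (solidTorus C c) fun w => w c / q :=
      (RatOn.coord c).div (RatOn.const _) fun _ _ => hq'
    have h1 : RatOn (solidTorus C c) fun w => -K * (∏ a ∈ I, (w c / q - q * w a))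
        * ((w c / q - 1) ^ (m + 1 + 1))⁻¹ * ∏ _a ∈ I.erase c, (q : ℂ) := by
      refine (((RatOn.const _).mul (RatOn.prod _ fun a _ => hcq.sub
        ((RatOn.const _).mul (RatOn.coord a)))).mul (RatOn.inv ((hcq.sub (RatOn.const 1)).pow _)
        fun w hw => pow_ne_zero _ (sub_ne_zero.2 fun h => ?_))).mul (RatOn.const _)
      exact hC.ne_q hq (hIl c hc) hw.1 (by rwa [div_eq_one_iff_eq hq'] at h)
    have hxc : (x l : ℤ) < x c := by exact_mod_cast hx (hIl c hc)
    have hm' : (y k : ℤ) = x l + 1 + m := by exact_mod_cast hm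
    -- The orders add up to m + x c - y k = x c - x l - 1, which is nonnegative as x c > x l.
    exact (((ratOrd_one_sub_pow m).mul h1.ratOrd).mul (hC.ratOrd_spectator hq hy hc)).mono
      (by omega)
  have hsub : ∀ w ∈ torus C, ∀ c, ∀ a ∈ I.erase c, w c - w a ≠ 0 := fun w hw c a ha =>
    sub_ne_zero.2 fun h => (Finset.ne_of_mem_erase ha) (hC.injOn_coord hw h).symm
  refine hC.nestedInt_eq_zero_of_residues l I (g := fun c w => A c w
    * ∏ a ∈ I.erase c, (w c - w a)⁻¹) hcont (fun c hc => ?_) (fun c hc w z => ?_) (fun w hw => ?_)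
    fun c hc => ?_
  · exact ((hA c hc).continuousOn hC).mul (continuousOn_finsetProd _ fun a ha =>
      ContinuousOn.inv₀ (by fun_prop) fun w hw => hsub w hw c a ha)
  · have hu : ∀ a ∈ I, Function.update w l z a = w a :=
      fun a ha => Function.update_of_ne (hIl a ha).ne _ _
    have e1 : ∏ a ∈ I, (w c / q - q * Function.update w l z a) = ∏ a ∈ I, (w c / q - q * w a) :=
      Finset.prod_congr rfl fun a ha => by rw [hu a ha]
    have e2 : ∏ a ∈ I.erase c, (w c - Function.update w l z a)⁻¹
        = ∏ a ∈ I.erase c, (w c - w a)⁻¹ :=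
      Finset.prod_congr rfl fun a ha => by rw [hu a (Finset.mem_of_mem_erase ha)]
    simp only [A, spectator_update, hu c hc, e1, e2]
  · have h1 := curveInt_eq_sum_outside (hC.isClosedCurve l) (hC.one_notMem_trace l)
      (hC.winding_one l) I (b := fun a => w a / q)
      (fun a _ b _ h => hC.injOn_coord hw ((div_left_inj' hq').1 h))
      (fun a ha => hC.div_notMem_disc hq (hIl a ha) (.inl (hw a))) (m + 1) (P w)
      (degree_outward_lt _ _ _ _ _)
    have h2 : EqOn (fun z => ∑ π ∈ firstMoved k l, permTerm q α y x π (Function.update w l z))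
        (fun z => spectator q α y x k l w * ((P w).eval z * ((z - 1) ^ (m + 1 + 1))⁻¹
          * ∏ a ∈ I, (z - w a / q)⁻¹)) (trace (C l)) := by
      intro z hz
      have hu : ∀ a ∈ I, Function.update w l z a = w a :=
        fun a ha => Function.update_of_ne (hIl a ha).ne _ _
      have e1 : ∏ a ∈ I, ((z - q * Function.update w l z a) * (Function.update w l z a - q * z)⁻¹)
          = ∏ a ∈ I, ((z - q * w a) * (w a - q * z)⁻¹) :=
        Finset.prod_congr rfl fun a ha => by rw [hu a ha]
      simp only
      rw [hC.sum_permTerm_eq hq hkl (update_mem_torus hw hz), spectator_update,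
        Function.update_self, e1,
        rho_mul_phi _ _ (hC.ne_zero (.inl hz)) (hC.pole_ne_zero (.inl hz))
        (hC.one_sub_mul_ne_zero (.inl hz)) (hC.one_sub_mul_sq_ne_zero hq (.inl hz))
        (sub_ne_zero.2 (hC.ne_one hz).symm), hPe, hm]
      have h3 : ∀ a ∈ I, (z - q * w a) * (w a - q * z)⁻¹
          = (z - q * w a) * (-(q : ℂ)⁻¹) * (z - w a / q)⁻¹ := by
        intro a ha
        rw [show w a - q * z = -q * (z - w a / q) by field_simp; ring, mul_inv, inv_neg]
        ring
      rw [Finset.prod_congr rfl h3, Finset.prod_mul_distrib, Finset.prod_mul_distrib,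
        Finset.prod_const]
      have h4 : 1 - q * z ≠ 0 := hC.one_sub_mul_ne_zero (.inl hz)
      have h5 : z - 1 ≠ 0 := sub_ne_zero.2 (hC.ne_one hz)
      have h6 : 1 - z = -1 * (z - 1) := by ring
      rw [h6, mul_pow, mul_pow]
      have h7 : (-1 : ℂ) ^ ((x l : ℕ) + 1 + m + 1) = (-1) ^ (x l : ℕ) * (-1) ^ m := by ring
      have h8 : (-1 : ℂ) ^ (x l : ℕ) ≠ 0 := pow_ne_zero _ (by norm_num)
      have h9 : ((-1 : ℂ) ^ m) ^ 2 = 1 := by rw [← pow_mul, mul_comm, pow_mul]; simp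
      have h10 : (-1 : ℂ) ^ m ≠ 0 := pow_ne_zero _ (by norm_num)
      rw [h7]
      simp only [K]
      generalize 1 - q * z = D at *
      generalize z - 1 = E at *
      generalize ∏ a ∈ I, (z - q * w a) = X1
      generalize ∏ a ∈ I, (z - w a / q)⁻¹ = X2
      generalize (-(q : ℂ)⁻¹) ^ I.card = X3
      generalize (-1 : ℂ) ^ (x l : ℕ) = s at *
      generalize (-1 : ℂ) ^ m = s' at *
      field_simp
      rw [h9]
      ring
    rw [curveInt_congr h2, curveInt_const_mul, h1, neg_mul, mul_neg, mul_left_comm, ← mul_neg,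
      Finset.mul_sum, ← Finset.sum_neg_distrib]
    congr 1
    refine Finset.sum_congr rfl fun c hc => ?_
    have h3 : ∏ a ∈ I.erase c, (w c / q - w a / q)⁻¹
        = (∏ _a ∈ I.erase c, (q : ℂ)) * ∏ a ∈ I.erase c, (w c - w a)⁻¹ := by
      rw [← Finset.prod_mul_distrib]
      refine Finset.prod_congr rfl fun a ha => ?_
      rw [← sub_div, inv_div, div_eq_mul_inv]
    rw [h3, hPe, mul_div_cancel₀ _ hq']
    simp only [A]
    ring
  -- The second integration, over w c: no pole at 1, and antisymmetry of the spectator removes the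
  -- poles at the other variables of [k, l).
  · refine hC.nestedInt_eq_zero_of_ratOrd c (I.erase c) (by simp)
      (Ψ := fun w => A c w * (w l - 1)⁻¹) (fun w _ => by ring) ?_ ?_
    · have h1 : RatOn (solidTorus C c) fun w => (w l - 1)⁻¹ :=
        ((RatOn.coord l).sub (RatOn.const 1)).inv fun w hw =>
          sub_ne_zero.2 (hC.ne_one (hw.2 l (hIl c hc).ne'))
      simpa using (hA c hc).mul h1.ratOrd
    · intro w _ a ha hwa
      simp only [A]
      rw [spectator_eq_zero (Finset.mem_of_mem_erase ha) hc (Finset.ne_of_mem_erase ha) hwa]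
      ring

end outward

/-! ### The integral at time zero. -/

section initial

variable {q α : ℝ} {M N : ℕ} {C : Fin N → ℝ → ℂ} (hC : Admissible q α C) (hq : q ≠ 0)

/-- The first moved index k cannot go below itself, since the smaller values are already taken by
fixed indices. -/
theorem univ_erase_one_eq_biUnion_firstMoved :
    (Finset.univ.erase 1 : Finset (Equiv.Perm (Fin N)))
      = (Finset.univ.filter fun kl : Fin N × Fin N => kl.1 < kl.2).biUnion
        fun kl => firstMoved kl.1 kl.2 := by
  ext π
  simp only [Finset.mem_erase, Finset.mem_univ, and_true, Finset.mem_biUnion, Finset.mem_filter,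
    true_and, Prod.exists, firstMoved]
  constructor
  · intro h
    have hne : (Finset.univ.filter fun i => π i ≠ i).Nonempty := by
      by_contra h'
      rw [Finset.not_nonempty_iff_eq_empty, Finset.filter_eq_empty_iff] at h'
      exact h (Equiv.ext fun i => not_not.1 (h' (Finset.mem_univ i)))
    set k := (Finset.univ.filter fun i => π i ≠ i).min' hne
    have hk : π k ≠ k := (Finset.mem_filter.1 (Finset.min'_mem _ hne)).2
    have hfix : ∀ i < k, π i = i := fun i hi => by
      by_contra h'
      exact absurd (Finset.min'_le _ i (Finset.mem_filter.2 ⟨Finset.mem_univ _, h'⟩)) (not_le.2 hi)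
    refine ⟨k, π k, lt_of_le_of_ne ?_ hk.symm, hfix, rfl⟩
    by_contra h'
    exact hk (π.injective (hfix _ (not_le.1 h')))
  · rintro ⟨k, l, hkl, -, h⟩ rfl
    exact hkl.ne h

theorem pairwiseDisjoint_firstMoved :
    ((Finset.univ.filter fun kl : Fin N × Fin N => kl.1 < kl.2) : Set (Fin N × Fin N)).PairwiseDisjoint
      fun kl => firstMoved kl.1 kl.2 := by
  rintro ⟨k, l⟩ hkl ⟨k', l'⟩ hkl' hne
  simp only [Finset.coe_filter, Finset.mem_univ, true_and, mem_ofPred_eq] at hkl hkl'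
  simp only [Function.onFun, Finset.disjoint_left, firstMoved, Finset.mem_filter, Finset.mem_univ,
    true_and, not_and]
  rintro π ⟨h1, h2⟩ h3 h4
  rcases lt_trichotomy k k' with h | h | h
  · exact hkl.ne ((h3 k h).symm.trans h2)
  · subst h
    exact hne (by rw [← h2, h4])
  · exact hkl'.ne ((h1 k' h).symm.trans h4)

include hC hq

/-- If x l ≥ y k, each permutation vanishes on its own by integration over w k: this variable stands
after position k, so its particle lies to the left of y k ≤ x l < x k. Otherwise the residues
outside the contour are used. -/
theorem Admissible.nestedInt_firstMoved {y x : Fin N → ℕ+} (hy : StrictAnti y) (hx : StrictAnti x)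
    {k l : Fin N} (hkl : k < l) :
    nestedInt C (fun w => ∑ π ∈ firstMoved k l, permTerm q α y x π w) = 0 := by
  rcases lt_or_ge (x l) (y k) with h | h
  · exact hC.nestedInt_firstMoved_of_lt hq hkl hy hx h
  · rw [nestedInt_sum hC.isClosedCurve _ fun π _ => hC.continuousOn_permTerm hq π]
    exact Finset.sum_eq_zero fun π hπ => hC.nestedInt_permTerm_eq_zero hq π k
      ((hy (lt_symm_of_mem_firstMoved hπ le_rfl hkl.ne)).trans (h.trans_lt (hx hkl)))

theorem Admissible.nestedInt_signTerm_one (hq1 : q ≠ 1) {y x : Fin N → ℕ+} (hy : StrictAnti y)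
    (hx : StrictAnti x) :
    nestedInt C (signTerm q α y x fun _ => 1) = if x = y then 1 else 0 := by
  have h : ∀ w ∈ torus C, signTerm q α y x (fun _ => 1) w = permTerm q α y x 1 w
      + ∑ kl ∈ Finset.univ.filter fun kl : Fin N × Fin N => kl.1 < kl.2,
        ∑ π ∈ firstMoved kl.1 kl.2, permTerm q α y x π w := by
    intro w _
    rw [signTerm_one, ← Finset.sum_biUnion pairwiseDisjoint_firstMoved,
      ← univ_erase_one_eq_biUnion_firstMoved]
    exact (Finset.add_sum_erase _ (fun π => permTerm q α y x π w) (Finset.mem_univ 1)).symm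
  have hc : ∀ kl : Fin N × Fin N, ContinuousOn
      (fun w => ∑ π ∈ firstMoved kl.1 kl.2, permTerm q α y x π w) (torus C) := fun kl =>
    continuousOn_finsetSum _ fun π _ => hC.continuousOn_permTerm hq π
  rw [nestedInt_congr h, nestedInt_add hC.isClosedCurve (hC.continuousOn_permTerm hq 1)
    (continuousOn_finsetSum _ fun kl _ => hc kl), nestedInt_sum hC.isClosedCurve _ fun kl _ => hc kl,
    hC.nestedInt_permTerm_one hq hq1, Finset.sum_eq_zero, add_zero]
  exact fun kl hkl => hC.nestedInt_firstMoved hq hy hx (Finset.mem_filter.1 hkl).2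

omit hC hq in
theorem exists_first_neg {ε : Fin N → ℤˣ} (h : ε ≠ fun _ => 1) :
    ∃ p, ε p = -1 ∧ ∀ a < p, ε a = 1 := by
  have hne : (Finset.univ.filter fun i => ε i ≠ 1).Nonempty := by
    by_contra h'
    rw [Finset.not_nonempty_iff_eq_empty, Finset.filter_eq_empty_iff] at h'
    exact h (funext fun i => not_not.1 (h' (Finset.mem_univ i)))
  refine ⟨(Finset.univ.filter fun i => ε i ≠ 1).min' hne,
    (Int.units_eq_one_or _).resolve_left (Finset.mem_filter.1 (Finset.min'_mem _ hne)).2,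
    fun a ha => ?_⟩
  by_contra h'
  exact absurd (Finset.min'_le _ a (Finset.mem_filter.2 ⟨Finset.mem_univ _, h'⟩)) (not_le.2 ha)

theorem Admissible.continuousOn_signTerm (y : Fin M → ℕ+) (x : Fin N → ℕ+) (ε : Fin N → ℤˣ) :
    ContinuousOn (signTerm q α y x ε) (torus C) := by
  by_cases h : ε = fun _ => 1
  · subst h
    exact (continuousOn_finsetSum _ fun π _ => hC.continuousOn_permTerm hq π).congr
      fun w _ => signTerm_one y x w
  · obtain ⟨p, hp, hlt⟩ := exists_first_neg h
    have h1 : ContinuousOn (HalfSpaceASEP.regularPart q α y x ε p) (torus C) :=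
      (RatOn.regularPart hC hq hp hlt).continuousOn.mono (torus_subset_solidTorus p)
    have h2 : ContinuousOn (fun w : Fin N → ℂ => ∏ a ∈ Finset.Iio p, (w p - (w a)⁻¹)⁻¹)
        (torus C) := by
      refine continuousOn_finsetProd _ fun a ha => ?_
      refine ContinuousOn.inv₀ (ContinuousOn.sub (by fun_prop) (ContinuousOn.inv₀ (by fun_prop)
        fun w hw => hC.ne_zero (.inl (hw a)))) fun w hw h' => ?_
      refine hC.mul_ne_one a p (Finset.mem_Iio.1 ha) _ (hw a) _ (hw p) ?_
      rw [sub_eq_zero.1 h', mul_inv_cancel₀ (hC.ne_zero (.inl (hw a)))]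
    exact (h1.mul h2).congr fun w hw =>
      signTerm_eq_regularPart hp hlt fun a => hC.ne_zero (.inl (hw a))

theorem Admissible.continuousOn_integrand_zero (hMN : M ≤ N) (y : Fin M → ℕ+) (x : Fin N → ℕ+) :
    ContinuousOn (integrand q α 0 hMN y x) (torus C) :=
  (continuousOn_finsetSum _ fun ε _ => hC.continuousOn_signTerm hq y x ε).congr
    fun _ hw => hC.integrand_zero hq hMN y x hw

theorem Admissible.nestedInt_integrand_zero_eq (hMN : M ≤ N) {y : Fin M → ℕ+} (x : Fin N → ℕ+)
    (hy : StrictAnti y) :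
    nestedInt C (integrand q α 0 hMN y x) = nestedInt C (signTerm q α y x fun _ => 1) := by
  rw [nestedInt_congr fun w hw => hC.integrand_zero hq hMN y x hw,
    nestedInt_sum hC.isClosedCurve _ fun ε _ => hC.continuousOn_signTerm hq y x ε]
  refine Finset.sum_eq_single_of_mem _ (Finset.mem_univ _) fun ε _ hε => ?_
  obtain ⟨p, hp, hlt⟩ := exists_first_neg hε
  exact nestedInt_signTerm_eq_zero hC hq hp hlt hy

/-- The initial condition: there are too few particles in the initial configuration. -/
theorem Admissible.nestedInt_integrand_zero_of_lt (hMN : M < N) {y : Fin M → ℕ+} (x : Fin N → ℕ+)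
    (hy : StrictAnti y) : nestedInt C (integrand q α 0 hMN.le y x) = 0 := by
  rw [hC.nestedInt_integrand_zero_eq hq _ _ hy, hC.nestedInt_signTerm_one_of_lt hq hMN]

/-- The initial condition: the numbers of particles are equal. -/
theorem Admissible.nestedInt_integrand_zero (hq1 : q ≠ 1) {y x : Fin N → ℕ+} (hy : StrictAnti y)
    (hx : StrictAnti x) :
    nestedInt C (integrand q α 0 le_rfl y x) = if x = y then 1 else 0 := by
  rw [hC.nestedInt_integrand_zero_eq hq _ _ hy, hC.nestedInt_signTerm_one hq hq1 hy hx]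

end initial

/-! ### The wave functions in the variables `z = (1 - q w) / (1 - w)` -/

/-- The two points `a` and `q / a` of an orbit. -/
def branch (q : ℂ) (ε : ℤˣ) (a : ℂ) : ℂ := if ε = 1 then a else q / a

/-- The energy of a variable. -/
def energy (q x : ℂ) : ℂ := x + q / x - 1 - q

/-- The interaction factor of two variables. -/
def interaction (q x b : ℂ) : ℂ :=
  (x * b + q - (1 + q) * b) * (x + b - 1 - q) / ((x - b) * (x * b - q))

/-- The weight `E(x) / (x - q / x)`. -/
def weight (q x : ℂ) : ℂ := energy q x * x / (x ^ 2 - q)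

/-- The one-particle function, where the position may be zero. -/
def orbital (q α : ℂ) (y : ℕ) (x : ℂ) : ℂ :=
  energy q x * (x - q - α) * x ^ y / (x ^ 2 - q)

/-- Variables in general position. -/
structure Generic (q : ℂ) (s : Finset ℂ) : Prop where
  ne_zero : ∀ a ∈ s, a ≠ 0
  ne_one : ∀ a ∈ s, a ≠ 1
  ne_q : ∀ a ∈ s, a ≠ q
  mul_ne : ∀ a ∈ s, ∀ b ∈ s, a * b ≠ q

theorem Generic.mono {q : ℂ} {s t : Finset ℂ} (h : Generic q s) (hts : t ⊆ s) : Generic q t :=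
  ⟨fun a ha => h.1 a (hts ha), fun a ha => h.2 a (hts ha), fun a ha => h.3 a (hts ha),
    fun a ha b hb => h.4 a (hts ha) b (hts hb)⟩

/-- The weighted sum of `g` over all branches of all variables. -/
def moment (q : ℂ) (s : Finset ℂ) (g : ℂ → ℂ) : ℂ :=
  ∑ a ∈ s, ∑ ε, weight q (branch q ε a)
    * (∏ b ∈ s.erase a, interaction q (branch q ε a) b) * g (branch q ε a)

section

variable {q : ℂ}

theorem sum_units_int (f : ℤˣ → ℂ) : ∑ ε, f ε = f 1 + f (-1) := by
  rw [UnitsInt.univ, Finset.sum_pair (by decide)]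

@[simp] theorem branch_one (a : ℂ) : branch q 1 a = a := if_pos rfl

@[simp] theorem branch_neg_one (a : ℂ) : branch q (-1) a = q / a := if_neg (by decide)

theorem energy_branch (hq : q ≠ 0) (ε : ℤˣ) {a : ℂ} (ha : a ≠ 0) :
    energy q (branch q ε a) = energy q a := by
  rcases Int.units_eq_one_or ε with rfl | rfl
  · rw [branch_one]
  · rw [branch_neg_one, energy, energy]
    field_simp
    ring

theorem weight_div (hq : q ≠ 0) {a : ℂ} (ha : a ≠ 0) (haa : a * a ≠ q) :
    weight q (q / a) = -weight q a := by
  have h := energy_branch hq (-1) ha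
  rw [branch_neg_one] at h
  rw [weight, weight, h]
  have h1 : a ^ 2 - q ≠ 0 := by rw [sq]; exact sub_ne_zero.2 haa
  have h2 : (q / a) ^ 2 - q = -(q * (a ^ 2 - q)) / a ^ 2 := by field_simp; ring
  rw [h2]
  generalize a ^ 2 - q = D at *
  field_simp

theorem moment_add (s : Finset ℂ) (f g : ℂ → ℂ) :
    moment q s (fun p => f p + g p) = moment q s f + moment q s g := by
  simp only [moment, mul_add, Finset.sum_add_distrib]

theorem moment_const_mul (s : Finset ℂ) (c : ℂ) (g : ℂ → ℂ) :
    moment q s (fun p => c * g p) = c * moment q s g := by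
  simp only [moment, Finset.mul_sum, mul_left_comm c]

/-- A point of the orbits of the variables, seen from another variable. -/
theorem Generic.branch_props {s : Finset ℂ} {a b : ℂ} (h : Generic q s) (hq : q ≠ 0) (ha : a ∈ s)
    (hb : b ∈ s) (hab : b ≠ a) (ε : ℤˣ) :
    branch q ε b ≠ 0 ∧ branch q ε b - a ≠ 0 ∧ branch q ε b * a - q ≠ 0 := by
  have hb0 := h.ne_zero b hb
  rcases Int.units_eq_one_or ε with rfl | rfl
  · rw [branch_one]
    exact ⟨hb0, sub_ne_zero.2 hab, sub_ne_zero.2 (h.mul_ne b hb a ha)⟩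
  · rw [branch_neg_one]
    refine ⟨div_ne_zero hq hb0, fun h' => h.mul_ne a ha b hb ?_, fun h' => hab ?_⟩
    · rw [← sub_eq_zero.1 h', div_mul_cancel₀ _ hb0]
    · rw [sub_eq_zero, div_mul_eq_mul_div, div_eq_iff hb0] at h'
      exact (mul_left_cancel₀ hq h').symm

theorem moment_congr {s : Finset ℂ} {f g : ℂ → ℂ}
    (h : ∀ b ∈ s, ∀ ε, f (branch q ε b) = g (branch q ε b)) : moment q s f = moment q s g :=
  Finset.sum_congr rfl fun b hb => Finset.sum_congr rfl fun ε _ => by rw [h b hb ε]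

/-- The expansion over s is a hypothesis here because its own proof, by induction on s, runs through
this lemma. -/
theorem moment_insert {s : Finset ℂ} {a : ℂ} (ha : a ∉ s) (g : ℂ → ℂ)
    (hpf : ∀ ε, ∏ b ∈ s, interaction q (branch q ε a) b
      = 1 + (2 * branch q ε a - 1 - q) * moment q s fun p => (branch q ε a - p)⁻¹) :
    moment q (insert a s) g = moment q s (fun p => interaction q p a * g p
        + ∑ ε, weight q (branch q ε a) * g (branch q ε a) * (2 * branch q ε a - 1 - q)
          * (branch q ε a - p)⁻¹)
      + ∑ ε, weight q (branch q ε a) * g (branch q ε a) := by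
  have h1 : ∑ b ∈ s, ∑ ε, weight q (branch q ε b)
      * (∏ c ∈ (insert a s).erase b, interaction q (branch q ε b) c) * g (branch q ε b)
      = moment q s fun p => interaction q p a * g p := by
    refine Finset.sum_congr rfl fun b hb => Finset.sum_congr rfl fun ε _ => ?_
    have hab : a ≠ b := fun h => ha (h ▸ hb)
    rw [Finset.erase_insert_of_ne hab, Finset.prod_insert fun h => ha (Finset.mem_of_mem_erase h)]
    ring
  rw [moment, Finset.sum_insert ha, h1, Finset.erase_insert ha, moment_add]
  simp only [hpf, sum_units_int, moment_add, moment_const_mul]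
  ring

variable {s : Finset ℂ} {a : ℂ}

/-- In x the interaction takes the value 1 at infinity and at (1 + q)/2. This fixes the shape of all
expansions below, with 2 x - 1 - q in the numerator. -/
theorem interaction_eq {x : ℂ} (ha : a ≠ 0) (h1 : x - a ≠ 0) (h2 : x * a - q ≠ 0) :
    interaction q x a = 1 + (2 * x - 1 - q) * energy q a * a / ((x - a) * (x * a - q)) := by
  rw [interaction, energy, eq_comm, ← sub_eq_zero]
  field_simp
  ring

/-- A divided difference of `(2 x - 1 - q) g(x)` at `p`, `a` and `q / a`. -/
def dividedDiff (q a : ℂ) (g : ℂ → ℂ) (p : ℂ) : ℂ :=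
  a * ((2 * p - 1 - q) * g p / ((p - a) * (p * a - q))
    - (2 * a - 1 - q) * g a / ((p - a) * (a ^ 2 - q))
    + a * (2 * (q / a) - 1 - q) * g (q / a) / ((p * a - q) * (a ^ 2 - q)))

theorem Generic.sq_sub_ne_zero (hs : Generic q (insert a s)) : a ^ 2 - q ≠ 0 := by
  rw [sq]
  exact sub_ne_zero.2 (hs.mul_ne a (Finset.mem_insert_self a s) a (Finset.mem_insert_self a s))

theorem Generic.branch_props_insert (hs : Generic q (insert a s)) (hq : q ≠ 0) (ha : a ∉ s) {b : ℂ}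
    (hb : b ∈ s) (ε : ℤˣ) :
    branch q ε b ≠ 0 ∧ branch q ε b - a ≠ 0 ∧ branch q ε b * a - q ≠ 0 :=
  hs.branch_props hq (Finset.mem_insert_self a s) (Finset.mem_insert_of_mem hb)
    (fun h => ha (h ▸ hb)) ε

/-- The two branches of a have opposite weights (`weight_div`), so their contributions combine into
divided differences. On polynomials `dividedDiff` lowers the degree by one, which makes the moments
computable by induction on the number of variables. -/
theorem moment_insert_eq (hs : Generic q (insert a s)) (hq : q ≠ 0) (ha : a ∉ s) (g : ℂ → ℂ)
    (hpf : ∀ ε, ∏ b ∈ s, interaction q (branch q ε a) b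
      = 1 + (2 * branch q ε a - 1 - q) * moment q s fun p => (branch q ε a - p)⁻¹) :
    moment q (insert a s) g = moment q s g + energy q a * moment q s (dividedDiff q a g)
      + energy q a * (a * (g a - g (q / a)) / (a ^ 2 - q)) := by
  have ha0 := hs.ne_zero a (Finset.mem_insert_self a s)
  have haa := hs.sq_sub_ne_zero
  rw [moment_insert ha g hpf, ← moment_const_mul, ← moment_add]
  congr 1
  · refine moment_congr fun b hb ε => ?_
    obtain ⟨h0, h1, h2⟩ := hs.branch_props_insert hq ha hb ε
    generalize branch q ε b = p at *
    have h3 : q / a - p = -(p * a - q) / a := by field_simp; ring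
    rw [sum_units_int, branch_one, branch_neg_one, weight_div hq ha0
      (by rw [← sq]; exact sub_ne_zero.1 haa), interaction_eq ha0 h1 h2, weight, dividedDiff, h3,
      ← neg_sub p a]
    generalize energy q a = e
    generalize p * a - q = X at *
    generalize p - a = Y at *
    generalize a ^ 2 - q = Z at *
    generalize g (q / a) = g1
    generalize 2 * (q / a) - 1 - q = c1
    field_simp
    ring
  · rw [sum_units_int, branch_one, branch_neg_one, weight_div hq ha0
      (by rw [← sq]; exact sub_ne_zero.1 haa), weight]
    ring

/-- Partial fractions in X, with simple poles at both points of each orbit. The induction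
hypothesis, applied at X = a and X = q / a, is what inserting a into the moment requires; on 1/(X -
p) the operator `dividedDiff` acts by a scalar. -/
theorem prod_interaction (hq : q ≠ 0) : ∀ {s : Finset ℂ}, Generic q s → ∀ {X : ℂ},
    (∀ b ∈ s, X - b ≠ 0 ∧ X * b - q ≠ 0) → ∏ b ∈ s, interaction q X b
      = 1 + (2 * X - 1 - q) * moment q s fun p => (X - p)⁻¹ := by
  intro s
  induction s using Finset.induction_on with
  | empty => intro _ X _; simp [moment]
  | insert a s ha ih =>
    intro hs X hX
    have hs' := hs.mono (Finset.subset_insert a s)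
    have ha0 := hs.ne_zero a (Finset.mem_insert_self a s)
    have haa := hs.sq_sub_ne_zero
    obtain ⟨h1, h2⟩ := hX a (Finset.mem_insert_self a s)
    rw [Finset.prod_insert ha, ih hs' fun b hb => hX b (Finset.mem_insert_of_mem hb),
      moment_insert_eq hs hq ha _ fun ε => ih hs' fun b hb =>
        (hs.branch_props hq (Finset.mem_insert_of_mem hb) (Finset.mem_insert_self a s)
          (fun h => ha (h ▸ hb)) ε).2]
    have h3 : moment q s (dividedDiff q a fun p => (X - p)⁻¹)
        = a * (2 * X - 1 - q) / ((X - a) * (X * a - q)) * moment q s fun p => (X - p)⁻¹ := by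
      rw [← moment_const_mul]
      refine moment_congr fun b hb ε => ?_
      obtain ⟨h4, h5, h6⟩ := hs.branch_props_insert hq ha hb ε
      have h7 : X - branch q ε b ≠ 0 := by
        have hb0 := hs'.ne_zero b hb
        obtain ⟨h8, h9⟩ := hX b (Finset.mem_insert_of_mem hb)
        rcases Int.units_eq_one_or ε with rfl | rfl
        · rwa [branch_one]
        · rw [branch_neg_one, sub_ne_zero, Ne, eq_div_iff hb0]
          exact sub_ne_zero.1 h9
      generalize branch q ε b = p at *
      have h6' : a * p - q ≠ 0 := by rwa [mul_comm]
      have h2' : a * X - q ≠ 0 := by rwa [mul_comm]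
      have h8 : X - q / a = (X * a - q) / a := by field_simp
      simp only [dividedDiff]
      rw [h8]
      field_simp
      ring
    have h8 : X - q / a = (X * a - q) / a := by field_simp
    have h2' : a * X - q ≠ 0 := by rwa [mul_comm]
    rw [h3, interaction_eq ha0 h1 h2, h8]
    generalize (moment q s fun p => (X - p)⁻¹) = m
    generalize energy q a = e
    field_simp
    ring

theorem Generic.moment_insert_eq (hs : Generic q (insert a s)) (hq : q ≠ 0) (ha : a ∉ s)
    (g : ℂ → ℂ) :
    moment q (insert a s) g = moment q s g + energy q a * moment q s (dividedDiff q a g)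
      + energy q a * (a * (g a - g (q / a)) / (a ^ 2 - q)) :=
  HalfSpaceASEP.moment_insert_eq hs hq ha g fun ε =>
    prod_interaction hq (hs.mono (Finset.subset_insert a s)) fun _ hb =>
      (hs.branch_props hq (Finset.mem_insert_of_mem hb) (Finset.mem_insert_self a s)
        (fun h => ha (h ▸ hb)) ε).2

theorem moment_one (hq : q ≠ 0) (hs : Generic q s) : moment q s (fun _ => 1) = 0 := by
  induction s using Finset.induction_on with
  | empty => simp [moment]
  | insert a s ha ih =>
    have ha0 := hs.ne_zero a (Finset.mem_insert_self a s)
    have haa := hs.sq_sub_ne_zero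
    have h : moment q s (dividedDiff q a fun _ => 1) = moment q s fun p => 0 * 1 := by
      refine moment_congr fun b hb ε => ?_
      obtain ⟨h4, h5, h6⟩ := hs.branch_props_insert hq ha hb ε
      generalize branch q ε b = p at *
      have h6' : a * p - q ≠ 0 := by rwa [mul_comm]
      rw [dividedDiff]
      field_simp
      ring
    rw [hs.moment_insert_eq hq ha, h, moment_const_mul, ih (hs.mono (Finset.subset_insert a s))]
    simp

theorem moment_id (hq : q ≠ 0) (hs : Generic q s) :
    moment q s (fun p => p) = ∑ a ∈ s, energy q a := by
  induction s using Finset.induction_on with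
  | empty => simp [moment]
  | insert a s ha ih =>
    have ha0 := hs.ne_zero a (Finset.mem_insert_self a s)
    have haa := hs.sq_sub_ne_zero
    have hs' := hs.mono (Finset.subset_insert a s)
    have h : moment q s (dividedDiff q a fun p => p) = moment q s fun p => 2 * 1 := by
      refine moment_congr fun b hb ε => ?_
      obtain ⟨h4, h5, h6⟩ := hs.branch_props_insert hq ha hb ε
      generalize branch q ε b = p at *
      have h6' : a * p - q ≠ 0 := by rwa [mul_comm]
      rw [dividedDiff]
      field_simp
      ring
    have h1 : a * (a - q / a) / (a ^ 2 - q) = 1 := by field_simp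
    rw [hs.moment_insert_eq hq ha, h, moment_const_mul, ih hs', moment_one hq hs',
      Finset.sum_insert ha, h1]
    ring

/-- The divided difference of the cubic (2 x - 1 - q) x² at p, a and q / a is linear in p, so the
two lower moments suffice. -/
theorem moment_sq (hq : q ≠ 0) (hs : Generic q s) :
    moment q s (fun p => p ^ 2)
      = (∑ a ∈ s, energy q a) ^ 2 + (1 + q) * ∑ a ∈ s, energy q a := by
  induction s using Finset.induction_on with
  | empty => simp [moment]
  | insert a s ha ih =>
    have ha0 := hs.ne_zero a (Finset.mem_insert_self a s)
    have haa := hs.sq_sub_ne_zero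
    have hs' := hs.mono (Finset.subset_insert a s)
    have h : moment q s (dividedDiff q a fun p => p ^ 2)
        = moment q s fun p => 2 * p + (2 * energy q a + 1 + q) * 1 := by
      refine moment_congr fun b hb ε => ?_
      obtain ⟨h4, h5, h6⟩ := hs.branch_props_insert hq ha hb ε
      generalize branch q ε b = p at *
      have h6' : a * p - q ≠ 0 := by rwa [mul_comm]
      rw [dividedDiff, energy]
      field_simp
      ring
    have h1 : a * (a ^ 2 - (q / a) ^ 2) / (a ^ 2 - q) = energy q a + 1 + q := by
      rw [energy]
      field_simp
      ring
    rw [hs.moment_insert_eq hq ha, h, moment_add, moment_const_mul, moment_const_mul, ih hs',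
      moment_one hq hs', moment_id hq hs', Finset.sum_insert ha, h1]
    ring

/-- The sum of the products of interaction factors, which is the symmetrization of a constant. -/
theorem sum_prod_interaction (hq : q ≠ 0) (hq1 : q ≠ 1) (hs : Generic q s) :
    ∑ a ∈ s, ∑ ε, ∏ b ∈ s.erase a, interaction q (branch q ε a) b
      = (1 - q ^ s.card) / (1 - q) + q * (q⁻¹ ^ s.card - 1) / (1 - q) := by
  have hq1' : 1 - q ≠ 0 := sub_ne_zero.2 hq1.symm
  -- The weight is inverse to 1 - 1/(1 - x) - q/(q - x). This rewrites the unweighted sum by the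
  -- expansions at X = 1 and X = q, where every interaction factor is q or 1/q respectively.
  have h1 : ∑ a ∈ s, ∑ ε, ∏ b ∈ s.erase a, interaction q (branch q ε a) b
      = moment q s fun p => (1 + -1 * (1 - p)⁻¹) + -q * (q - p)⁻¹ := by
    refine Finset.sum_congr rfl fun a ha => Finset.sum_congr rfl fun ε _ => ?_
    have ha0 := hs.ne_zero a ha
    have ha1 : a - 1 ≠ 0 := sub_ne_zero.2 (hs.ne_one a ha)
    have haq : a - q ≠ 0 := sub_ne_zero.2 (hs.ne_q a ha)
    have haa : a ^ 2 - q ≠ 0 := by rw [sq]; exact sub_ne_zero.2 (hs.mul_ne a ha a ha)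
    have h2 : branch q ε a ≠ 0 ∧ branch q ε a - 1 ≠ 0 ∧ branch q ε a - q ≠ 0
        ∧ branch q ε a ^ 2 - q ≠ 0 := by
      rcases Int.units_eq_one_or ε with rfl | rfl
      · rw [branch_one]
        exact ⟨ha0, ha1, haq, haa⟩
      · rw [branch_neg_one, show q / a - 1 = -(a - q) / a by field_simp; ring,
          show q / a - q = -(a - 1) * q / a by field_simp; ring,
          show (q / a) ^ 2 - q = -(a ^ 2 - q) * q / a ^ 2 by field_simp; ring]
        exact ⟨div_ne_zero hq ha0, div_ne_zero (neg_ne_zero.2 haq) ha0,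
          div_ne_zero (mul_ne_zero (neg_ne_zero.2 ha1) hq) ha0,
          div_ne_zero (mul_ne_zero (neg_ne_zero.2 haa) hq) (pow_ne_zero _ ha0)⟩
    obtain ⟨h3, h4, h5, h6⟩ := h2
    generalize branch q ε a = x at *
    have h7 : weight q x * ((1 + -1 * (1 - x)⁻¹) + -q * (q - x)⁻¹) = 1 := by
      rw [weight, energy, ← neg_sub x 1, ← neg_sub x q]
      field_simp
      ring
    linear_combination (-∏ b ∈ s.erase a, interaction q x b) * h7
  have h2 : ∏ b ∈ s, interaction q 1 b = q ^ s.card := by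
    rw [← Finset.prod_const]
    refine Finset.prod_congr rfl fun b hb => ?_
    have hb1 : 1 - b ≠ 0 := sub_ne_zero.2 (hs.ne_one b hb).symm
    have hbq : b - q ≠ 0 := sub_ne_zero.2 (hs.ne_q b hb)
    rw [interaction, one_mul]
    field_simp
    ring
  have h3 : ∏ b ∈ s, interaction q q b = q⁻¹ ^ s.card := by
    rw [← Finset.prod_const]
    refine Finset.prod_congr rfl fun b hb => ?_
    have hb1 : b - 1 ≠ 0 := sub_ne_zero.2 (hs.ne_one b hb)
    have hbq : q - b ≠ 0 := sub_ne_zero.2 (hs.ne_q b hb).symm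
    rw [interaction, show q * b - q = q * (b - 1) by ring]
    field_simp
    ring
  have h4 := prod_interaction hq hs (X := 1) fun b hb => ⟨sub_ne_zero.2 (hs.ne_one b hb).symm, by
    rw [one_mul]; exact sub_ne_zero.2 (hs.ne_q b hb)⟩
  have h5 := prod_interaction hq hs (X := q) fun b hb => ⟨sub_ne_zero.2 (hs.ne_q b hb).symm, by
    rw [← mul_sub_one]; exact mul_ne_zero hq (sub_ne_zero.2 (hs.ne_one b hb))⟩
  rw [h2] at h4
  rw [h3] at h5
  rw [h1, moment_add, moment_add, moment_const_mul, moment_const_mul, moment_one hq hs, h4, h5]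
  field_simp
  ring

end

/-! ### Wave functions and the relations between them. -/

section wave

/-- The nested sum of one-particle functions: the symmetrization over signed permutations, up to a
constant. -/
def wave (q : ℂ) : {M : ℕ} → (Fin M → ℂ → ℂ) → Finset ℂ → ℂ
  | 0, _, _ => 1
  | _ + 1, ψ, s => ∑ a ∈ s, ∑ ε, ψ 0 (branch q ε a)
      * (∏ b ∈ s.erase a, interaction q (branch q ε a) b) * wave q (Fin.tail ψ) (s.erase a)

variable {q α : ℂ} {M : ℕ}

theorem wave_zero (ψ : Fin 0 → ℂ → ℂ) (s : Finset ℂ) : wave q ψ s = 1 := rfl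

theorem wave_succ (ψ : Fin (M + 1) → ℂ → ℂ) (s : Finset ℂ) :
    wave q ψ s = ∑ a ∈ s, ∑ ε, ψ 0 (branch q ε a)
      * (∏ b ∈ s.erase a, interaction q (branch q ε a) b) * wave q (Fin.tail ψ) (s.erase a) := rfl

theorem wave_eq_zero_of_card_lt : ∀ {M : ℕ} (ψ : Fin M → ℂ → ℂ) {s : Finset ℂ}, s.card < M →
    wave q ψ s = 0
  | 0, _, _, h => absurd h (Nat.not_lt_zero _)
  | M + 1, ψ, s, h => by
    rw [wave_succ]
    refine Finset.sum_eq_zero fun a ha => Finset.sum_eq_zero fun ε _ => ?_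
    rw [wave_eq_zero_of_card_lt, mul_zero]
    rw [Finset.card_erase_of_mem ha]
    have := Finset.card_pos.2 ⟨a, ha⟩
    omega

/-- Two functions in the place of one particle that agree on the orbits can be interchanged. -/
theorem wave_congr_update : ∀ {M : ℕ} (ψ : Fin M → ℂ → ℂ) (i : Fin M) {f g : ℂ → ℂ} {s : Finset ℂ},
    (∀ a ∈ s, ∀ ε, f (branch q ε a) = g (branch q ε a)) →
    wave q (Function.update ψ i f) s = wave q (Function.update ψ i g) s
  | M + 1, ψ, i, f, g, s, h => by
    rw [wave_succ, wave_succ]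
    refine Finset.sum_congr rfl fun a ha => Finset.sum_congr rfl fun ε _ => ?_
    refine Fin.cases ?_ (fun i => ?_) i
    · simp only [Function.update_self, Fin.tail_update_zero, h a ha ε]
    · rw [Fin.tail_update_succ, Fin.tail_update_succ, wave_congr_update _ i fun b hb =>
        h b (Finset.mem_of_mem_erase hb), Function.update_of_ne (Fin.succ_ne_zero i).symm,
        Function.update_of_ne (Fin.succ_ne_zero i).symm]

/-- The wave function is linear in each of the one-particle functions. -/
theorem wave_update_combination : ∀ {M : ℕ} (ψ : Fin M → ℂ → ℂ) (i : Fin M) (c d : ℂ) (f g : ℂ → ℂ)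
    (s : Finset ℂ), wave q (Function.update ψ i fun x => c * f x + d * g x) s
      = c * wave q (Function.update ψ i f) s + d * wave q (Function.update ψ i g) s
  | M + 1, ψ, i, c, d, f, g, s => by
    rw [wave_succ, wave_succ, wave_succ]
    simp only [Finset.mul_sum, ← Finset.sum_add_distrib]
    refine Finset.sum_congr rfl fun a _ => Finset.sum_congr rfl fun ε _ => ?_
    refine Fin.cases ?_ (fun i => ?_) i
    · simp only [Function.update_self, Fin.tail_update_zero]
      ring
    · rw [Fin.tail_update_succ, Fin.tail_update_succ, Fin.tail_update_succ,
        wave_update_combination, Function.update_of_ne (Fin.succ_ne_zero i).symm,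
        Function.update_of_ne (Fin.succ_ne_zero i).symm,
        Function.update_of_ne (Fin.succ_ne_zero i).symm]
      ring

theorem tail_snoc (ψ : Fin (M + 1) → ℂ → ℂ) (f : ℂ → ℂ) :
    Fin.tail (Fin.snoc (α := fun _ => ℂ → ℂ) ψ f)
      = Fin.snoc (α := fun _ => ℂ → ℂ) (Fin.tail ψ) f := by
  conv_lhs => rw [← Fin.cons_self_tail ψ, ← Fin.cons_snoc_eq_snoc_cons, Fin.tail_cons]

theorem snoc_apply_zero (ψ : Fin (M + 1) → ℂ → ℂ) (f : ℂ → ℂ) :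
    Fin.snoc (α := fun _ => ℂ → ℂ) ψ f 0 = ψ 0 :=
  Fin.snoc_castSucc (α := fun _ => ℂ → ℂ) (i := 0) f ψ

theorem wave_single (f : ℂ → ℂ) (s : Finset ℂ) :
    wave q (fun _ : Fin 1 => f) s
      = ∑ a ∈ s, ∑ ε, f (branch q ε a) * ∏ b ∈ s.erase a, interaction q (branch q ε a) b := by
  simp [wave_succ, wave_zero]

variable {s : Finset ℂ}

theorem wave_orbital (y : ℕ) (s : Finset ℂ) :
    wave q (fun _ : Fin 1 => orbital q α (y + 1)) s
      = moment q s (fun p => p ^ (y + 1)) - (q + α) * moment q s (fun p => p ^ y) := by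
  rw [wave_single, moment, moment, Finset.mul_sum, ← Finset.sum_sub_distrib]
  refine Finset.sum_congr rfl fun a _ => ?_
  rw [Finset.mul_sum, ← Finset.sum_sub_distrib]
  refine Finset.sum_congr rfl fun ε _ => ?_
  rw [orbital, weight]
  ring

/-- The term with `α` drops out because the zeroth moment vanishes. So one particle at site 1
carries exactly the energy of all the variables that are available to it. -/
theorem wave_orbital_one (hq : q ≠ 0) (hs : Generic q s) :
    wave q (fun _ : Fin 1 => orbital q α 1) s = ∑ a ∈ s, energy q a := by
  have h := wave_orbital (q := q) (α := α) 0 s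
  simp only [zero_add, pow_one, pow_zero, moment_one hq hs, moment_id hq hs] at h
  rw [h]
  ring

theorem wave_orbital_two (hq : q ≠ 0) (hs : Generic q s) :
    wave q (fun _ : Fin 1 => orbital q α 2) s
      = (∑ a ∈ s, energy q a) ^ 2 + (1 - α) * ∑ a ∈ s, energy q a := by
  have h := wave_orbital (q := q) (α := α) 1 s
  simp only [Nat.reduceAdd, pow_one, moment_sq hq hs, moment_id hq hs] at h
  rw [h]
  ring

/-- The eigenvalue relation for particles without exclusion. -/
theorem energy_mul_wave (hq : q ≠ 0) : ∀ {M : ℕ} (ψ : Fin M → ℂ → ℂ) {s : Finset ℂ}, Generic q s →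
    (∑ a ∈ s, energy q a) * wave q ψ s
      = (∑ i, wave q (Function.update ψ i fun x => energy q x * ψ i x) s)
        + wave q (Fin.snoc (α := fun _ => ℂ → ℂ) ψ (orbital q α 1)) s
  | 0, ψ, s, hs => by
    -- No particle is left: the energy of the remaining variables is the wave function of an
    -- injected particle.
    have h : (Fin.snoc (α := fun _ => ℂ → ℂ) ψ (orbital q α 1)) = fun _ : Fin 1 => orbital q α 1 := by
      funext i
      rw [Subsingleton.elim (α := Fin 1) i (Fin.last 0), Fin.snoc_last]
    rw [h, wave_orbital_one hq hs]
    simp [wave_zero]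
  | M + 1, ψ, s, hs => by
    rw [Fin.sum_univ_succ, wave_succ ψ, wave_succ (Function.update ψ 0 _),
      wave_succ (Fin.snoc (α := fun _ => ℂ → ℂ) ψ _)]
    have h : ∀ i : Fin M, wave q (Function.update ψ i.succ fun x => energy q x * ψ i.succ x) s
        = ∑ a ∈ s, ∑ ε, ψ 0 (branch q ε a) * (∏ b ∈ s.erase a, interaction q (branch q ε a) b)
          * wave q (Function.update (Fin.tail ψ) i fun x => energy q x * Fin.tail ψ i x)
            (s.erase a) := fun i => by
      rw [wave_succ, Fin.tail_update_succ, Function.update_of_ne (Fin.succ_ne_zero i).symm]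
      rfl
    rw [Finset.sum_congr rfl fun i _ => h i,
      Finset.sum_comm (s := (Finset.univ : Finset (Fin M))), Finset.mul_sum,
      ← Finset.sum_add_distrib, ← Finset.sum_add_distrib]
    refine Finset.sum_congr rfl fun a ha => ?_
    rw [Finset.sum_comm (s := (Finset.univ : Finset (Fin M))), Finset.mul_sum,
      ← Finset.sum_add_distrib, ← Finset.sum_add_distrib]
    refine Finset.sum_congr rfl fun ε _ => ?_
    -- The total energy is that of the variable a, absorbed by the first particle, plus that of the
    -- others, to which the induction hypothesis applies.
    have ih := energy_mul_wave hq (Fin.tail ψ) (hs.mono (Finset.erase_subset a s))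
    rw [Function.update_self, Fin.tail_update_zero, tail_snoc, snoc_apply_zero,
      energy_branch hq ε (hs.ne_zero a ha), ← Finset.mul_sum, ← Finset.add_sum_erase _ _ ha]
    linear_combination ψ 0 (branch q ε a) * (∏ b ∈ s.erase a, interaction q (branch q ε a) b) * ih

/-- Multiplication of powers of x by x + q/x - 1 - q is the generator of the free walk with rate 1
to the right and q to the left. -/
theorem energy_mul_orbital (y : ℕ) {x : ℂ} (hx : x ≠ 0) :
    energy q x * orbital q α (y + 1) x
      = 1 * (1 * orbital q α (y + 2) x + q * orbital q α y x) + -(1 + q) * orbital q α (y + 1) x := by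
  have h : energy q x * x = x ^ 2 + q - (1 + q) * x := by
    rw [energy]
    field_simp
    ring
  simp only [orbital]
  linear_combination (energy q x * (x - q - α) * x ^ y / (x ^ 2 - q)) * h

theorem Generic.branch_ne_zero (hs : Generic q s) (hq : q ≠ 0) {a : ℂ} (ha : a ∈ s) (ε : ℤˣ) :
    branch q ε a ≠ 0 := by
  rcases Int.units_eq_one_or ε with rfl | rfl
  · rw [branch_one]
    exact hs.ne_zero a ha
  · rw [branch_neg_one]
    exact div_ne_zero hq (hs.ne_zero a ha)

/-- The action of the energy of one particle. -/
theorem wave_update_energy (hq : q ≠ 0) (hs : Generic q s) (ψ : Fin M → ℂ → ℂ) (i : Fin M) (y : ℕ) :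
    wave q (Function.update ψ i fun x => energy q x * orbital q α (y + 1) x) s
      = wave q (Function.update ψ i (orbital q α (y + 2))) s
        + q * wave q (Function.update ψ i (orbital q α y)) s
        - (1 + q) * wave q (Function.update ψ i (orbital q α (y + 1))) s := by
  rw [wave_congr_update (g := fun x => 1 * (1 * orbital q α (y + 2) x + q * orbital q α y x)
      + -(1 + q) * orbital q α (y + 1) x) ψ i
      fun a ha ε => energy_mul_orbital y (hs.branch_ne_zero hq ha ε),
    wave_update_combination ψ i 1 (-(1 + q))
      (fun x => 1 * orbital q α (y + 2) x + q * orbital q α y x), wave_update_combination]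
  ring

theorem sum_sum_erase_eq_zero {ι : Type*} [DecidableEq ι] (s : Finset ι) {G : ι → ι → ℂ}
    (h : ∀ a ∈ s, ∀ b ∈ s, a ≠ b → G a b + G b a = 0) : ∑ a ∈ s, ∑ b ∈ s.erase a, G a b = 0 := by
  have h1 : ∑ a ∈ s, ∑ b ∈ s.erase a, G a b = ∑ a ∈ s, ∑ b ∈ s, if a = b then 0 else G a b := by
    refine Finset.sum_congr rfl fun a ha => ?_
    rw [← Finset.add_sum_erase _ _ ha, if_pos rfl, zero_add]
    exact Finset.sum_congr rfl fun b hb => (if_neg (Finset.ne_of_mem_erase hb).symm).symm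
  have h2 : (∑ a ∈ s, ∑ b ∈ s, if a = b then 0 else G a b)
      + ∑ a ∈ s, ∑ b ∈ s, (if a = b then 0 else G a b) = 0 := by
    nth_rw 1 [Finset.sum_comm]
    rw [← Finset.sum_add_distrib]
    refine Finset.sum_eq_zero fun a ha => ?_
    rw [← Finset.sum_add_distrib]
    refine Finset.sum_eq_zero fun b hb => ?_
    split_ifs with h3 h4 h4
    · rw [add_zero]
    · exact absurd h3.symm h4
    · exact absurd h4.symm h3
    · rw [add_comm]
      exact h a ha b hb h4
  rw [h1]
  linear_combination h2 / 2

theorem interaction_div (hq : q ≠ 0) {x b : ℂ} (hb : b ≠ 0) :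
    interaction q x (q / b) = interaction q x b := by
  have e1 : x * (q / b) + q - (1 + q) * (q / b) = (x + b - 1 - q) * (q / b) := by
    field_simp
    ring
  have e2 : x + q / b - 1 - q = (x * b + q - (1 + q) * b) / b := by
    field_simp
    ring
  have e3 : x - q / b = (x * b - q) / b := by field_simp
  have e4 : x * (q / b) - q = (x - b) * (q / b) := by field_simp
  rw [interaction, interaction, e1, e2, e3, e4, mul_comm (x - b) (x * b - q)]
  rw [show (x + b - 1 - q) * (q / b) * ((x * b + q - (1 + q) * b) / b)
    = (x * b + q - (1 + q) * b) * (x + b - 1 - q) * (q / b ^ 2) by ring,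
    show (x * b - q) / b * ((x - b) * (q / b)) = (x * b - q) * (x - b) * (q / b ^ 2) by ring]
  exact mul_div_mul_right _ _ (div_ne_zero hq (pow_ne_zero _ hb))

theorem interaction_branch (hq : q ≠ 0) (x : ℂ) {b : ℂ} (hb : b ≠ 0) (ε : ℤˣ) :
    interaction q x (branch q ε b) = interaction q x b := by
  rcases Int.units_eq_one_or ε with rfl | rfl
  · rw [branch_one]
  · rw [branch_neg_one, interaction_div hq hb]

/-- The missing numerator factor makes the numerator symmetric, while the denominator is
antisymmetric. This is the two-particle condition of the Bethe ansatz. -/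
theorem interaction_add_swap (x z : ℂ) :
    (x * z + q - (1 + q) * x) * interaction q x z
      + (z * x + q - (1 + q) * z) * interaction q z x = 0 := by
  rw [interaction, interaction, show (z - x) * (z * x - q) = -((x - z) * (x * z - q)) by ring, div_neg]
  ring

/-- The equation at a pair of neighbouring particles. -/
theorem wave_exclusion (hq : q ≠ 0) (y : ℕ) : ∀ {M : ℕ} (ψ : Fin (M + 1) → ℂ → ℂ) (i : Fin M)
    {s : Finset ℂ}, Generic q s → ψ i.castSucc = orbital q α (y + 1) → ψ i.succ = orbital q α y →
    wave q (Function.update ψ i.succ (orbital q α (y + 1))) s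
      + q * wave q (Function.update ψ i.castSucc (orbital q α y)) s - (1 + q) * wave q ψ s = 0
  | M + 1, ψ, i, s, hs, h1, h2 => by
    induction i using Fin.cases with
    | zero =>
      -- The first two particles occupy an ordered pair of variables. All factors except their
      -- mutual interaction and their one-particle functions are symmetric in the pair.
      have e : ∀ χ : Fin (M + 2) → ℂ → ℂ, wave q χ s = ∑ a ∈ s, ∑ b ∈ s.erase a, ∑ ε, ∑ δ,
          χ 0 (branch q ε a) * χ 1 (branch q δ b)
            * ((∏ c ∈ (s.erase a).erase b, interaction q (branch q ε a) c)
            * (∏ c ∈ (s.erase a).erase b, interaction q (branch q δ b) c)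
            * interaction q (branch q ε a) b
            * wave q (Fin.tail (Fin.tail χ)) ((s.erase a).erase b)) := by
        intro χ
        rw [wave_succ]
        refine Finset.sum_congr rfl fun a _ => ?_
        rw [Finset.sum_comm (t := (Finset.univ : Finset ℤˣ))]
        refine Finset.sum_congr rfl fun ε _ => ?_
        rw [wave_succ, Finset.mul_sum]
        refine Finset.sum_congr rfl fun b hb => ?_
        rw [Finset.mul_sum, ← Finset.mul_prod_erase _ _ hb]
        refine Finset.sum_congr rfl fun δ _ => ?_
        rw [show Fin.tail χ 0 = χ 1 from rfl]
        ring
      have t1 : ∀ f, Fin.tail (Fin.tail (Function.update ψ (Fin.succ 0) f))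
          = Fin.tail (Fin.tail ψ) := fun f => by rw [Fin.tail_update_succ, Fin.tail_update_zero]
      have t2 : ∀ f, Fin.tail (Fin.tail (Function.update ψ (Fin.castSucc 0) f))
          = Fin.tail (Fin.tail ψ) := fun f => by rw [Fin.castSucc_zero, Fin.tail_update_zero]
      have u1 : ψ 0 = orbital q α (y + 1) := h1
      have u2 : ψ 1 = orbital q α y := h2
      have v1 : ∀ f, Function.update ψ (Fin.succ 0) f 0 = ψ 0 := fun f =>
        Function.update_of_ne (by simp) _ _
      have v2 : ∀ f, Function.update ψ (Fin.succ 0) f 1 = f := fun f => Function.update_self ..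
      have v3 : ∀ f, Function.update ψ (Fin.castSucc 0) f 0 = f := fun f => Function.update_self ..
      have v4 : ∀ f, Function.update ψ (Fin.castSucc 0) f 1 = ψ 1 := fun f =>
        Function.update_of_ne (by simp) _ _
      rw [e, e, e]
      simp only [t1, t2, v1, v2, v3, v4, u1, u2, Finset.mul_sum, ← Finset.sum_add_distrib,
        ← Finset.sum_sub_distrib]
      -- The terms for (a, b) and (b, a) cancel by `interaction_add_swap`; the interaction is first
      -- rewritten on the branches, on which it does not depend.
      refine sum_sum_erase_eq_zero s fun a ha b hb hab => ?_
      rw [Finset.sum_comm (s := (Finset.univ : Finset ℤˣ)), ← Finset.sum_add_distrib]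
      refine Finset.sum_eq_zero fun δ _ => ?_
      rw [← Finset.sum_add_distrib]
      refine Finset.sum_eq_zero fun ε _ => ?_
      rw [Finset.erase_right_comm (a := b), ← interaction_branch hq _ (hs.ne_zero a ha) ε,
        ← interaction_branch hq _ (hs.ne_zero b hb) δ]
      have key := interaction_add_swap (q := q) (branch q ε a) (branch q δ b)
      have ho : ∀ x, orbital q α (y + 1) x = x * orbital q α y x := fun x => by
        simp only [orbital]
        ring
      simp only [ho]
      linear_combination (orbital q α y (branch q ε a) * orbital q α y (branch q δ b)
        * (∏ c ∈ (s.erase a).erase b, interaction q (branch q ε a) c)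
        * (∏ c ∈ (s.erase a).erase b, interaction q (branch q δ b) c)
        * wave q (Fin.tail (Fin.tail ψ)) ((s.erase a).erase b)) * key
    | succ i =>
      have e : i.succ.castSucc = i.castSucc.succ := Fin.castSucc_succ i
      rw [e] at h1 ⊢
      rw [wave_succ, wave_succ, wave_succ ψ, Finset.mul_sum, Finset.mul_sum,
        ← Finset.sum_add_distrib, ← Finset.sum_sub_distrib]
      refine Finset.sum_eq_zero fun a _ => ?_
      rw [Finset.mul_sum, Finset.mul_sum, ← Finset.sum_add_distrib, ← Finset.sum_sub_distrib]
      refine Finset.sum_eq_zero fun ε _ => ?_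
      have ih := wave_exclusion hq y (Fin.tail ψ) i (hs.mono (Finset.erase_subset a s)) h1 h2
      rw [Fin.tail_update_succ, Fin.tail_update_succ,
        Function.update_of_ne (Fin.succ_ne_zero _).symm,
        Function.update_of_ne (Fin.succ_ne_zero _).symm]
      linear_combination ψ 0 (branch q ε a)
        * (∏ b ∈ s.erase a, interaction q (branch q ε a) b) * ih

/-- The equation at the boundary. -/
theorem wave_boundary (hq : q ≠ 0) : ∀ {M : ℕ} (ψ : Fin M → ℂ → ℂ) {s : Finset ℂ}, Generic q s →
    q * wave q (Fin.snoc (α := fun _ => ℂ → ℂ) ψ (orbital q α 0)) s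
      + wave q (Fin.snoc (α := fun _ => ℂ → ℂ)
        (Fin.snoc (α := fun _ => ℂ → ℂ) ψ (orbital q α 1)) (orbital q α 1)) s
      = (q + α) * wave q (Fin.snoc (α := fun _ => ℂ → ℂ) ψ (orbital q α 1)) s
  | 0, ψ, s, hs => by
    have h : ∀ f, (Fin.snoc (α := fun _ => ℂ → ℂ) ψ f) = fun _ : Fin 1 => f := by
      intro f
      funext i
      rw [Subsingleton.elim (α := Fin 1) i (Fin.last 0), Fin.snoc_last]
    simp only [h]
    -- For a single particle at site 1 the energy relation contains the three wave functions of the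
    -- boundary relation and the one at site 2, which is known from the second moment.
    have h1 := energy_mul_wave (α := α) hq (fun _ : Fin 1 => orbital q α 1) hs
    have h2 : wave q (Function.update (fun _ : Fin 1 => orbital q α 1) 0
        fun x => energy q x * orbital q α 1 x) s = wave q (fun _ : Fin 1 => orbital q α 2) s
          + q * wave q (fun _ : Fin 1 => orbital q α 0) s
          - (1 + q) * wave q (fun _ : Fin 1 => orbital q α 1) s := by
      have hu : ∀ f g : ℂ → ℂ, Function.update (fun _ : Fin 1 => f) 0 g = fun _ : Fin 1 => g :=
        fun f g => funext fun i => by rw [Subsingleton.elim i 0, Function.update_self]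
      rw [wave_update_energy hq hs, hu, hu, hu]
    rw [Fin.sum_univ_one, h2, wave_orbital_two hq hs, wave_orbital_one hq hs] at h1
    rw [wave_orbital_one hq hs]
    linear_combination -h1
  | M + 1, ψ, s, hs => by
    rw [wave_succ, wave_succ, wave_succ, Finset.mul_sum, Finset.mul_sum, ← Finset.sum_add_distrib]
    refine Finset.sum_congr rfl fun a ha => ?_
    rw [Finset.mul_sum, Finset.mul_sum, ← Finset.sum_add_distrib]
    refine Finset.sum_congr rfl fun ε _ => ?_
    have ih := wave_boundary hq (Fin.tail ψ) (hs.mono (Finset.erase_subset a s))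
    simp only [tail_snoc, snoc_apply_zero]
    linear_combination ψ 0 (branch q ε a) * (∏ b ∈ s.erase a, interaction q (branch q ε a) b) * ih

end wave

/-! ### The symmetrization in terms of the wave function -/

section symmetrize

variable {q : ℂ} {M N : ℕ}

/-- The product that is symmetrized. -/
def orderedProd (q : ℂ) (h : M ≤ N) (ψ : Fin M → ℂ → ℂ) (v : Fin N → ℂ) : ℂ :=
  (∏ i, ∏ j ∈ Finset.Ioi i, interaction q (v i) (v j)) * ∏ i, ψ i (v (Fin.castLE h i))

/-- The variable and the sign in the first position are split off; a transposition with 0 relabels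
the remaining variables. -/
theorem sum_signedPerm_succ (z : Fin (N + 1) → ℂ) (F : (Fin (N + 1) → ℂ) → ℂ) :
    ∑ σ : SignedPerm (N + 1), F (fun i => branch q (σ.2 i) (z (σ.1 i)))
      = ∑ p, ∑ ε, ∑ σ : SignedPerm N, F (Fin.cons (branch q ε (z p))
          fun i => branch q (σ.2 i) (z (Equiv.swap 0 p (σ.1 i).succ))) := by
  rw [Fintype.sum_prod_type, ← Equiv.sum_comp Equiv.Perm.decomposeFin.symm, Fintype.sum_prod_type]
  refine Finset.sum_congr rfl fun p _ => ?_
  simp only [Fintype.sum_prod_type]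
  rw [Finset.sum_comm (s := (Finset.univ : Finset ℤˣ))]
  refine Finset.sum_congr rfl fun e _ => ?_
  rw [← Equiv.sum_comp (Fin.consEquiv fun _ => ℤˣ), Fintype.sum_prod_type]
  refine Finset.sum_congr rfl fun ε _ => Finset.sum_congr rfl fun δ _ => ?_
  congr 1
  funext i
  refine Fin.cases ?_ (fun i => ?_) i
  · simp
  · simp

theorem image_swap_succ {z : Fin (N + 1) → ℂ} (hz : Function.Injective z) (p : Fin (N + 1)) :
    Finset.univ.image (fun j : Fin N => z (Equiv.swap 0 p j.succ))
      = (Finset.univ.image z).erase (z p) := by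
  ext a
  simp only [Finset.mem_image, Finset.mem_univ, true_and, Finset.mem_erase]
  constructor
  · rintro ⟨j, rfl⟩
    refine ⟨fun h => ?_, _, rfl⟩
    have h1 := hz h
    rw [Equiv.swap_apply_eq_iff, Equiv.swap_apply_right] at h1
    exact Fin.succ_ne_zero j h1
  · rintro ⟨hne, k, rfl⟩
    have hk : Equiv.swap 0 p k ≠ 0 := fun h => by
      rw [Equiv.swap_apply_eq_iff, Equiv.swap_apply_left] at h
      exact hne (by rw [h])
    obtain ⟨j, hj⟩ := Fin.exists_succ_eq.2 hk
    exact ⟨j, by rw [hj, Equiv.swap_apply_self]⟩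

theorem injective_swap_succ {z : Fin (N + 1) → ℂ} (hz : Function.Injective z) (p : Fin (N + 1)) :
    Function.Injective fun j : Fin N => z (Equiv.swap 0 p j.succ) :=
  fun _ _ h => Fin.succ_injective _ ((Equiv.swap 0 p).injective (hz h))

/-- The normalization of the symmetrization. -/
def symmConst (q : ℂ) (k : ℕ) : ℂ :=
  ∏ n ∈ Finset.range k, ((1 - q ^ (n + 1)) / (1 - q) + q * (q⁻¹ ^ (n + 1) - 1) / (1 - q))

/-- The interaction depends on its second argument only through the orbit, so order and signs of the
remaining variables do not matter. -/
theorem prod_interaction_swap (hq : q ≠ 0) {z : Fin (N + 1) → ℂ} (hz : Function.Injective z)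
    (h0 : ∀ i, z i ≠ 0) (p : Fin (N + 1)) (x : ℂ) (σ : SignedPerm N) :
    ∏ j, interaction q x (branch q (σ.2 j) (z (Equiv.swap 0 p (σ.1 j).succ)))
      = ∏ b ∈ (Finset.univ.image z).erase (z p), interaction q x b := by
  rw [← image_swap_succ hz, Finset.prod_image (injective_swap_succ hz p).injOn,
    ← Equiv.prod_comp σ.1 fun j => interaction q x (z (Equiv.swap 0 p j.succ))]
  exact Finset.prod_congr rfl fun j _ => interaction_branch hq x (h0 _) _

/-- Summing over the entry in the first position reproduces the recursion of `wave` while there are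
particles. Afterwards it gives the constants of `sum_prod_interaction`, whose product is
`symmConst`. -/
theorem sum_orderedProd (hq : q ≠ 0) (hq1 : q ≠ 1) : ∀ {N M : ℕ} (h : M ≤ N) (ψ : Fin M → ℂ → ℂ)
    {z : Fin N → ℂ}, Function.Injective z → Generic q (Finset.univ.image z) →
    ∑ σ : SignedPerm N, orderedProd q h ψ (fun i => branch q (σ.2 i) (z (σ.1 i)))
      = symmConst q (N - M) * wave q ψ (Finset.univ.image z)
  | 0, 0, h, ψ, z, _, _ => by
    simp [orderedProd, symmConst, wave_zero]
  | N + 1, 0, h, ψ, z, hz, hg => by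
    rw [sum_signedPerm_succ]
    have h0 : ∀ i, z i ≠ 0 := fun i => hg.ne_zero _ (Finset.mem_image_of_mem z (Finset.mem_univ i))
    have h1 : ∀ p ε, ∑ σ : SignedPerm N, orderedProd q h ψ (Fin.cons (branch q ε (z p))
        fun i => branch q (σ.2 i) (z (Equiv.swap 0 p (σ.1 i).succ)))
        = (∏ b ∈ (Finset.univ.image z).erase (z p), interaction q (branch q ε (z p)) b)
          * symmConst q N := by
      intro p ε
      have ih := sum_orderedProd hq hq1 (Nat.zero_le N) ψ (injective_swap_succ hz p)
        (by rw [image_swap_succ hz]; exact hg.mono (Finset.erase_subset _ _))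
      rw [wave_zero, mul_one, Nat.sub_zero] at ih
      rw [← ih, Finset.mul_sum]
      refine Finset.sum_congr rfl fun σ _ => ?_
      rw [orderedProd, Fin.prod_univ_succ, Fin.prod_Ioi_zero]
      simp only [Fin.prod_Ioi_succ, Fin.cons_zero, Fin.cons_succ]
      rw [prod_interaction_swap hq hz h0, orderedProd]
      simp
    simp only [h1]
    rw [← Finset.sum_image (s := Finset.univ) (g := z) (f := fun a => ∑ ε,
      (∏ b ∈ (Finset.univ.image z).erase a, interaction q (branch q ε a) b) * symmConst q N)
      hz.injOn]
    simp only [← Finset.sum_mul]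
    rw [sum_prod_interaction hq hq1 hg, Finset.card_image_of_injective _ hz, Finset.card_univ,
      Fintype.card_fin, wave_zero, Nat.sub_zero, mul_one, symmConst, symmConst,
      Finset.prod_range_succ, mul_comm]
  | N + 1, M + 1, h, ψ, z, hz, hg => by
    rw [sum_signedPerm_succ]
    have h0 : ∀ i, z i ≠ 0 := fun i => hg.ne_zero _ (Finset.mem_image_of_mem z (Finset.mem_univ i))
    have h1 : ∀ p ε, ∑ σ : SignedPerm N, orderedProd q h ψ (Fin.cons (branch q ε (z p))
        fun i => branch q (σ.2 i) (z (Equiv.swap 0 p (σ.1 i).succ)))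
        = ψ 0 (branch q ε (z p))
          * (∏ b ∈ (Finset.univ.image z).erase (z p), interaction q (branch q ε (z p)) b)
          * (symmConst q (N - M)
            * wave q (Fin.tail ψ) ((Finset.univ.image z).erase (z p))) := by
      intro p ε
      have ih := sum_orderedProd hq hq1 (Nat.le_of_succ_le_succ h) (Fin.tail ψ)
        (injective_swap_succ hz p)
        (by rw [image_swap_succ hz]; exact hg.mono (Finset.erase_subset _ _))
      rw [image_swap_succ hz] at ih
      rw [← ih, Finset.mul_sum]
      refine Finset.sum_congr rfl fun σ _ => ?_
      rw [orderedProd, Fin.prod_univ_succ, Fin.prod_Ioi_zero, Fin.prod_univ_succ (n := M)]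
      simp only [Fin.prod_Ioi_succ, Fin.cons_zero, Fin.cons_succ, Fin.castLE_zero, Fin.castLE_succ]
      rw [prod_interaction_swap hq hz h0, orderedProd]
      simp only [Fin.tail]
      ring
    simp only [h1]
    rw [← Finset.sum_image (s := Finset.univ) (g := z) (f := fun a => ∑ ε, ψ 0 (branch q ε a)
      * (∏ b ∈ (Finset.univ.image z).erase a, interaction q (branch q ε a) b)
      * (symmConst q (N - M) * wave q (Fin.tail ψ) ((Finset.univ.image z).erase a))) hz.injOn,
      wave_succ, Nat.add_sub_add_right, Finset.mul_sum]
    refine Finset.sum_congr rfl fun a _ => ?_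
    rw [Finset.mul_sum]
    exact Finset.sum_congr rfl fun ε _ => by ring

/-- The factor with index n of `symmConst` is (1 - q^(n + 1))(1 + q^n) / (q^n (1 - q)); the powers
q^n multiply to the binomial power of q in `V`. -/
theorem V_mul_symmConst {q : ℝ} (hq : 0 < q) (hq1 : q ≠ 1) (k : ℕ) :
    (V q k : ℂ) * symmConst q k = 1 := by
  have hq0 : (q : ℂ) ≠ 0 := by exact_mod_cast hq.ne'
  have hq1' : 1 - (q : ℂ) ≠ 0 := sub_ne_zero.2 (by exact_mod_cast hq1.symm)
  have h1 : ∀ n : ℕ, 1 - (q : ℂ) ^ (n + 1) ≠ 0 := fun n => sub_ne_zero.2 fun h =>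
    hq1 ((pow_eq_one_iff_of_nonneg hq.le n.succ_ne_zero).1 (by exact_mod_cast h.symm))
  have h2 : ∀ n : ℕ, 1 + (q : ℂ) ^ n ≠ 0 := fun n => by
    have : (1 : ℝ) + q ^ n ≠ 0 := by positivity
    exact_mod_cast this
  induction k with
  | zero => simp [V, symmConst]
  | succ k ih =>
    have h3 : (V q (k + 1) : ℂ)
        = V q k * (q ^ k * (1 - q) / ((1 - q ^ (k + 1)) * (1 + q ^ k))) := by
      simp only [V]
      rw [Finset.prod_range_succ, Nat.choose_succ_succ' k 1, Nat.choose_one_right]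
      push_cast
      rw [pow_add, pow_succ, div_mul_div_comm]
      congr 1
      ring
    have h4 : symmConst q (k + 1)
        = symmConst q k * ((1 - q ^ (k + 1)) * (1 + q ^ k) / (q ^ k * (1 - q))) := by
      rw [symmConst, Finset.prod_range_succ, ← symmConst, inv_pow, pow_succ]
      congr 1
      have : (q : ℂ) ^ k ≠ 0 := pow_ne_zero _ hq0
      generalize (q : ℂ) ^ k = c at *
      field_simp
      ring
    have h5 : (q : ℂ) ^ k ≠ 0 := pow_ne_zero _ hq0
    rw [h3, h4]
    have h6 := h1 k
    have h7 := h2 k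
    generalize 1 - (q : ℂ) ^ (k + 1) = c at *
    generalize 1 + (q : ℂ) ^ k = d at *
    generalize 1 - (q : ℂ) = e at *
    rw [← ih]
    field_simp

end symmetrize

/-! ### The change of variables z = (1 - q w) / (1 - w). -/

section orbit

variable {q α : ℝ}

/-- The variable `z = (1 - q w) / (1 - w)`. -/
def orbitVar (q : ℝ) (w : ℂ) : ℂ := (1 - q * w) / (1 - w)

theorem orbitVar_flip (hq : q ≠ 0) (ε : ℤˣ) {w : ℂ} (h0 : w ≠ 0) (h1 : 1 - w ≠ 0)
    (h2 : 1 - q * w ≠ 0) : orbitVar q (flip q ε w) = branch q ε (orbitVar q w) := by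
  have hq' : (q : ℂ) ≠ 0 := by exact_mod_cast hq
  rcases Int.units_eq_one_or ε with rfl | rfl
  · rw [branch_one, flip, if_pos rfl]
  · rw [branch_neg_one, flip, if_neg (by decide), orbitVar, orbitVar,
      show 1 - q * (1 / (q * w)) = -(1 - w) / w by field_simp; ring,
      show 1 - 1 / (q * w) = -(1 - q * w) / (q * w) by field_simp; ring]
    generalize 1 - q * w = X at *
    generalize 1 - w = Y at *
    field_simp

theorem interaction_orbitVar (hq1 : q ≠ 1) {v w : ℂ} (hv : 1 - v ≠ 0) (hw : 1 - w ≠ 0)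
    (hvw : v ≠ w) (h : 1 - q * v * w ≠ 0) :
    interaction q (orbitVar q v) (orbitVar q w)
      = (v - q * w) / (v - w) * ((1 - v * w) / (1 - q * v * w)) := by
  have hq1' : 1 - (q : ℂ) ≠ 0 := sub_ne_zero.2 (by exact_mod_cast hq1.symm)
  have h' : v - w ≠ 0 := sub_ne_zero.2 hvw
  have e1 : orbitVar q v * orbitVar q w + q - (1 + q) * orbitVar q w
      = (1 - q) * (v - q * w) / ((1 - v) * (1 - w)) := by
    rw [orbitVar, orbitVar]
    field_simp
    ring
  have e2 : orbitVar q v + orbitVar q w - 1 - q = (1 - q) * (1 - v * w) / ((1 - v) * (1 - w)) := by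
    rw [orbitVar, orbitVar]
    field_simp
    ring
  have e3 : orbitVar q v - orbitVar q w = (1 - q) * (v - w) / ((1 - v) * (1 - w)) := by
    rw [orbitVar, orbitVar]
    field_simp
    ring
  have e4 : orbitVar q v * orbitVar q w - q
      = (1 - q) * (1 - q * v * w) / ((1 - v) * (1 - w)) := by
    rw [orbitVar, orbitVar]
    field_simp
    ring
  rw [interaction, e1, e2, e3, e4]
  generalize 1 - q * v * w = X at *
  generalize v - w = Y at *
  generalize 1 - v = A at *
  generalize 1 - w = B at *
  generalize 1 - (q : ℂ) = C at *
  field_simp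

theorem phi_eq_orbital (hq1 : q ≠ 1) (y : ℕ+) {w : ℂ} (h1 : 1 - w ≠ 0) (h2 : 1 - q * w ≠ 0)
    (h3 : 1 - q * w ^ 2 ≠ 0) : phi q α y w = orbital q α y (orbitVar q w) := by
  have hq1' : 1 - (q : ℂ) ≠ 0 := sub_ne_zero.2 (by exact_mod_cast hq1.symm)
  obtain ⟨k, hk⟩ : ∃ k : ℕ, (y : ℕ) = k + 1 := ⟨y - 1, by have := y.pos; omega⟩
  have e1 : energy q (orbitVar q w) = (1 - q) ^ 2 * w / ((1 - w) * (1 - q * w)) := by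
    rw [energy, orbitVar]
    field_simp
    ring
  have e2 : orbitVar q w - q - α = (1 - q - α + α * w) / (1 - w) := by
    rw [orbitVar]
    field_simp
    ring
  have e3 : orbitVar q w ^ 2 - q = (1 - q) * (1 - q * w ^ 2) / (1 - w) ^ 2 := by
    rw [orbitVar]
    field_simp
    ring
  rw [phi, orbital, e1, e2, e3, hk, Nat.add_sub_cancel, pow_succ (orbitVar q w), orbitVar]
  generalize ((1 - q * w) / (1 - w)) ^ k = P
  generalize 1 - q * w ^ 2 = X at *
  generalize 1 - q * w = Y at *
  generalize 1 - w = A at *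
  generalize 1 - (q : ℂ) = C at *
  field_simp

theorem energy_orbitVar {w : ℂ} (h1 : 1 - w ≠ 0) (h2 : 1 - q * w ≠ 0) :
    energy q (orbitVar q w) = (1 - q) ^ 2 * w / ((1 - w) * (1 - q * w)) := by
  rw [energy, orbitVar]
  field_simp
  ring

end orbit

/-! ### The backward equation for the wave functions -/

section backward

variable {q α : ℂ} {M : ℕ} {s : Finset ℂ}

/-- The wave function of particles at the positions `y 0, …, y (M - 1)`. -/
def posWave (q α : ℂ) (y : Fin M → ℕ) (s : Finset ℂ) : ℂ :=
  wave q (fun i => orbital q α (y i)) s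

theorem posWave_update (y : Fin M → ℕ) (i : Fin M) (k : ℕ) (s : Finset ℂ) :
    posWave q α (Function.update y i k) s
      = wave q (Function.update (fun i => orbital q α (y i)) i (orbital q α k)) s := by
  rw [posWave]
  congr 1
  exact Function.comp_update (orbital q α) y i k

theorem posWave_snoc (y : Fin M → ℕ) (k : ℕ) (s : Finset ℂ) :
    posWave q α (Fin.snoc (α := fun _ => ℕ) y k) s
      = wave q (Fin.snoc (α := fun _ => ℂ → ℂ) (fun i => orbital q α (y i)) (orbital q α k)) s := by
  rw [posWave]
  congr 1
  exact Fin.comp_snoc (orbital q α) y k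

theorem mem_config {y : Fin M → ℕ+} {k : ℕ+} : k ∈ config y ↔ ∃ i, y i = k := by
  simp [config]

theorem energy_mul_posWave (hq : q ≠ 0) (hs : Generic q s) (y : Fin M → ℕ+) :
    (∑ a ∈ s, energy q a) * posWave q α (fun i => y i) s
      = (∑ i, (posWave q α (Function.update (fun i => (y i : ℕ)) i (y i + 1)) s
          - posWave q α (fun i => y i) s))
        + (∑ i, q * (posWave q α (Function.update (fun i => (y i : ℕ)) i (y i - 1)) s
          - posWave q α (fun i => y i) s))
        + posWave q α (Fin.snoc (α := fun _ => ℕ) (fun i => (y i : ℕ)) 1) s := by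
  rw [posWave_snoc, posWave, energy_mul_wave (α := α) hq _ hs, ← Finset.sum_add_distrib]
  congr 1
  refine Finset.sum_congr rfl fun i _ => ?_
  obtain ⟨k, hk⟩ : ∃ k : ℕ, (y i : ℕ) = k + 1 := ⟨y i - 1, by have := (y i).pos; omega⟩
  have h := wave_update_energy (α := α) hq hs (fun i => orbital q α (y i)) i k
  have h1 : Function.update (fun i => orbital q α (y i)) i (orbital q α (k + 1))
      = fun i => orbital q α (y i) := by
    rw [← hk]
    exact Function.update_eq_self i _
  rw [h1] at h
  rw [posWave_update, posWave_update, hk, Nat.add_sub_cancel, h]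
  ring

/-- For two consecutive particles the left one is blocked on its right exactly when the right one is
blocked on its left. The two forbidden jumps of such a pair cancel by `wave_exclusion`. -/
theorem sum_excluded (hq : q ≠ 0) (hs : Generic q s) {y : Fin M → ℕ+} (hy : StrictAnti y) :
    (∑ i, if y i + 1 ∈ config y then
        posWave q α (Function.update (fun i => (y i : ℕ)) i (y i + 1)) s
          - posWave q α (fun i => y i) s else 0)
      + (∑ i, if 1 < y i ∧ y i - 1 ∈ config y then
        q * (posWave q α (Function.update (fun i => (y i : ℕ)) i (y i - 1)) s
          - posWave q α (fun i => y i) s) else 0) = 0 := by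
  cases M with
  | zero => simp
  | succ M =>
    have h0 : y 0 + 1 ∉ config y := by
      rw [mem_config]
      rintro ⟨j, hj⟩
      have := hy.antitone (Fin.zero_le j)
      rw [hj] at this
      exact absurd (PNat.lt_add_right (y 0) 1) (not_lt.2 this)
    have h1 : ¬ (1 < y (Fin.last M) ∧ y (Fin.last M) - 1 ∈ config y) := by
      rw [mem_config]
      rintro ⟨h, j, hj⟩
      have := hy.antitone (Fin.le_last j)
      have h2 := PNat.sub_add_of_lt h
      rw [← hj] at h2
      rw [← h2] at this
      exact absurd (PNat.lt_add_right (y j) 1) (not_lt.2 this)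
    rw [Fin.sum_univ_succ, if_neg h0, zero_add, Fin.sum_univ_castSucc (n := M), if_neg h1, add_zero,
      ← Finset.sum_add_distrib]
    refine Finset.sum_eq_zero fun i _ => ?_
    have hlt : i.castSucc < i.succ := Fin.castSucc_lt_succ
    have e1 : y i.succ + 1 ∈ config y ↔ y i.castSucc = y i.succ + 1 := by
      rw [mem_config]
      refine ⟨?_, fun h => ⟨_, h⟩⟩
      rintro ⟨j, hj⟩
      have h2 : j < i.succ := hy.lt_iff_gt.1 (by rw [hj]; exact PNat.lt_add_right _ 1)
      have h3 : j ≤ i.castSucc := Fin.le_castSucc_iff.2 h2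
      refine le_antisymm ?_ ?_
      · rw [← hj]
        exact hy.antitone h3
      · exact PNat.add_one_le_iff.2 (hy hlt)
    have e2 : (1 < y i.castSucc ∧ y i.castSucc - 1 ∈ config y) ↔ y i.castSucc = y i.succ + 1 := by
      rw [mem_config]
      constructor
      · rintro ⟨h, j, hj⟩
        have h2 := PNat.sub_add_of_lt h
        rw [← hj] at h2
        have h3 : i.castSucc < j := hy.lt_iff_gt.1 (by
          rw [← h2]
          exact PNat.lt_add_right _ _)
        have h4 : i.succ ≤ j := Fin.castSucc_lt_iff_succ_le.1 h3
        refine le_antisymm ?_ (PNat.add_one_le_iff.2 (hy hlt))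
        rw [← h2]
        exact add_le_add_left (hy.antitone h4) 1
      · intro h
        refine ⟨?_, i.succ, ?_⟩
        · rw [h]
          exact PNat.lt_add_left _ _
        · rw [h]
          exact (PNat.add_sub).symm
    rw [if_congr e1 rfl rfl, if_congr e2 rfl rfl]
    split_ifs with h
    · have h' : (y i.castSucc : ℕ) = y i.succ + 1 := by
        rw [h]
        rfl
      have := wave_exclusion (α := α) hq (y i.succ) (fun i => orbital q α (y i)) i hs
        (by rw [h']) rfl
      rw [posWave_update, posWave_update, h', Nat.add_sub_cancel, posWave]
      linear_combination this
    · rw [add_zero]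

/-- If site 1 is occupied, it is so by the last particle. Its forbidden jump to 0 and the forbidden
injection onto site 1 then add up to `α` times the wave function, by `wave_boundary`. -/
theorem sum_boundary (hq : q ≠ 0) (hs : Generic q s) {y : Fin M → ℕ+} (hy : StrictAnti y) :
    (∑ i, if y i = 1 then q * (posWave q α (Function.update (fun i => (y i : ℕ)) i (y i - 1)) s
          - posWave q α (fun i => y i) s) else 0)
      + posWave q α (Fin.snoc (α := fun _ => ℕ) (fun i => (y i : ℕ)) 1) s
      = if 1 ∈ config y then α * posWave q α (fun i => y i) s else
        posWave q α (Fin.snoc (α := fun _ => ℕ) (fun i => (y i : ℕ)) 1) s := by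
  split_ifs with h
  · cases M with
    | zero => simp [mem_config] at h
    | succ M =>
      obtain ⟨j, hj⟩ := mem_config.1 h
      have hl : y (Fin.last M) = 1 :=
        le_antisymm (by rw [← hj]; exact hy.antitone (Fin.le_last j)) (one_le)
      have hne : ∀ i, y i = 1 ↔ i = Fin.last M := fun i =>
        ⟨fun h => hy.injective (h.trans hl.symm), fun h => by rw [h, hl]⟩
      simp only [hne, Finset.sum_ite_eq', Finset.mem_univ, if_true]
      have hψ : (fun i => orbital q α (y i)) = Fin.snoc (α := fun _ => ℂ → ℂ)
          (fun i : Fin M => orbital q α (y i.castSucc)) (orbital q α 1) := by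
        have := (Fin.snoc_init_self (α := fun _ => ℂ → ℂ) fun i => orbital q α (y i)).symm
        rw [hl] at this
        exact this
      have hb := wave_boundary (α := α) hq (fun i : Fin M => orbital q α (y i.castSucc)) hs
      rw [posWave_update, posWave_snoc, posWave, hψ, Fin.update_snoc_last, hl, PNat.one_coe,
        Nat.sub_self]
      linear_combination hb
  · rw [Finset.sum_eq_zero, zero_add]
    intro i _
    rw [if_neg]
    exact fun h' => h (mem_config.2 ⟨i, h'⟩)

/-- The backward equation. -/
theorem posWave_backward (hq : q ≠ 0) (hs : Generic q s) {y : Fin M → ℕ+} (hy : StrictAnti y) :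
    (∑ a ∈ s, energy q a) * posWave q α (fun i => y i) s
      = (∑ i, if y i + 1 ∈ config y then 0 else
          posWave q α (Function.update (fun i => (y i : ℕ)) i (y i + 1)) s
            - posWave q α (fun i => y i) s)
        + (∑ i, if 1 < y i ∧ y i - 1 ∉ config y then
          q * (posWave q α (Function.update (fun i => (y i : ℕ)) i (y i - 1)) s
            - posWave q α (fun i => y i) s) else 0)
        + if 1 ∈ config y then α * posWave q α (fun i => y i) s else
          posWave q α (Fin.snoc (α := fun _ => ℕ) (fun i => (y i : ℕ)) 1) s := by
  rw [energy_mul_posWave hq hs y, ← sum_boundary hq hs hy]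
  have h := sum_excluded (α := α) hq hs hy
  have e1 : ∀ i, posWave q α (Function.update (fun i => (y i : ℕ)) i (y i + 1)) s
      - posWave q α (fun i => y i) s
      = (if y i + 1 ∈ config y then 0 else
          posWave q α (Function.update (fun i => (y i : ℕ)) i (y i + 1)) s
            - posWave q α (fun i => y i) s)
        + if y i + 1 ∈ config y then
        posWave q α (Function.update (fun i => (y i : ℕ)) i (y i + 1)) s
          - posWave q α (fun i => y i) s else 0 := fun i => by
    split_ifs <;> simp
  -- A jump to the left is allowed, blocked by a particle, or blocked by the boundary.
  have e2 : ∀ i, q * (posWave q α (Function.update (fun i => (y i : ℕ)) i (y i - 1)) s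
          - posWave q α (fun i => y i) s)
      = (if 1 < y i ∧ y i - 1 ∉ config y then
          q * (posWave q α (Function.update (fun i => (y i : ℕ)) i (y i - 1)) s
            - posWave q α (fun i => y i) s) else 0)
        + (if 1 < y i ∧ y i - 1 ∈ config y then
          q * (posWave q α (Function.update (fun i => (y i : ℕ)) i (y i - 1)) s
            - posWave q α (fun i => y i) s) else 0)
        + if y i = 1 then q * (posWave q α (Function.update (fun i => (y i : ℕ)) i (y i - 1)) s
          - posWave q α (fun i => y i) s) else 0 := fun i => by
    by_cases h1 : y i = 1
    · simp [h1]
    · have h2 : 1 < y i := lt_of_le_of_ne (one_le) (Ne.symm h1)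
      by_cases h3 : y i - 1 ∈ config y <;> simp [h1, h2, h3]
  rw [Finset.sum_congr rfl fun i _ => e1 i, Finset.sum_congr rfl fun i _ => e2 i,
    Finset.sum_add_distrib, Finset.sum_add_distrib, Finset.sum_add_distrib]
  linear_combination h

end backward

/-! ### The symmetrization on the contours -/

section torus

variable {q α : ℝ} {M N : ℕ} {C : Fin N → ℝ → ℂ}

/-- The variables `z` of the points `w`. -/
def orbitSet (q : ℝ) (w : Fin N → ℂ) : Finset ℂ := Finset.univ.image fun i => orbitVar q (w i)

/-- A point of the contours or its image under the involution. -/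
structure Regular (q : ℝ) (w : ℂ) : Prop where
  ne_zero : w ≠ 0
  one_sub : 1 - w ≠ 0
  one_sub_mul : 1 - q * w ≠ 0
  one_sub_sq : 1 - q * w ^ 2 ≠ 0

theorem Regular.flip (hq : q ≠ 0) {w : ℂ} (h : Regular q w) (ε : ℤˣ) : Regular q (flip q ε w) := by
  have hq' : (q : ℂ) ≠ 0 := by exact_mod_cast hq
  obtain ⟨h0, h1, h2, h3⟩ := h
  rcases Int.units_eq_one_or ε with rfl | rfl
  · rw [HalfSpaceASEP.flip, if_pos rfl]
    exact ⟨h0, h1, h2, h3⟩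
  · rw [HalfSpaceASEP.flip, if_neg (by decide)]
    refine ⟨div_ne_zero one_ne_zero (mul_ne_zero hq' h0), ?_, ?_, ?_⟩
    · rw [show 1 - 1 / (q * w) = -(1 - q * w) / (q * w) by field_simp; ring]
      exact div_ne_zero (neg_ne_zero.2 h2) (mul_ne_zero hq' h0)
    · rw [show 1 - q * (1 / (q * w)) = -(1 - w) / w by field_simp; ring]
      exact div_ne_zero (neg_ne_zero.2 h1) h0
    · rw [show 1 - q * (1 / (q * w)) ^ 2 = -(1 - q * w ^ 2) / (q * w ^ 2) by field_simp; ring]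
      exact div_ne_zero (neg_ne_zero.2 h3) (mul_ne_zero hq' (pow_ne_zero _ h0))

theorem flip_pair (hq : q ≠ 0) {a b : ℂ} (ha : a ≠ 0) (hb : b ≠ 0) (hab : a ≠ b)
    (h : 1 - q * a * b ≠ 0) (ε δ : ℤˣ) :
    flip q ε a ≠ flip q δ b ∧ 1 - q * flip q ε a * flip q δ b ≠ 0 := by
  have hq' : (q : ℂ) ≠ 0 := by exact_mod_cast hq
  have h' : a - b ≠ 0 := sub_ne_zero.2 hab
  have hmm : (-1 : ℤˣ) ≠ 1 := by decide
  rcases Int.units_eq_one_or ε with rfl | rfl <;> rcases Int.units_eq_one_or δ with rfl | rfl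
  · simp only [flip, if_true]
    exact ⟨hab, h⟩
  · simp only [flip, if_true, hmm, if_false]
    rw [← sub_ne_zero, show a - 1 / (q * b) = -(1 - q * a * b) / (q * b) by field_simp; ring,
      show 1 - q * a * (1 / (q * b)) = -(a - b) / b by field_simp; ring]
    exact ⟨div_ne_zero (neg_ne_zero.2 h) (mul_ne_zero hq' hb),
      div_ne_zero (neg_ne_zero.2 h') hb⟩
  · simp only [flip, if_true, hmm, if_false]
    rw [← sub_ne_zero, show 1 / (q * a) - b = (1 - q * a * b) / (q * a) by field_simp,
      show 1 - q * (1 / (q * a)) * b = (a - b) / a by field_simp]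
    exact ⟨div_ne_zero h (mul_ne_zero hq' ha), div_ne_zero h' ha⟩
  · simp only [flip, hmm, if_false]
    rw [← sub_ne_zero, show 1 / (q * a) - 1 / (q * b) = -(a - b) / (q * a * b) by field_simp; ring,
      show 1 - q * (1 / (q * a)) * (1 / (q * b)) = -(1 - q * a * b) / (q * a * b) by
        field_simp; ring]
    exact ⟨div_ne_zero (neg_ne_zero.2 h') (mul_ne_zero (mul_ne_zero hq' ha) hb),
      div_ne_zero (neg_ne_zero.2 h) (mul_ne_zero (mul_ne_zero hq' ha) hb)⟩

variable (hC : Admissible q α C)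
include hC

theorem Admissible.regular (hq : q ≠ 0) {w : Fin N → ℂ} (hw : w ∈ torus C) (i : Fin N) :
    Regular q (w i) :=
  ⟨hC.ne_zero (.inl (hw i)), sub_ne_zero.2 (hC.ne_one (hw i)).symm,
    hC.one_sub_mul_ne_zero (.inl (hw i)), hC.one_sub_mul_sq_ne_zero hq (.inl (hw i))⟩

theorem Admissible.injective_orbitVar (hq : q ≠ 0) (hq1 : q ≠ 1) {w : Fin N → ℂ}
    (hw : w ∈ torus C) : Function.Injective fun i => orbitVar q (w i) := by
  intro i j h
  have hq1' : 1 - (q : ℂ) ≠ 0 := sub_ne_zero.2 (by exact_mod_cast hq1.symm)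
  simp only [orbitVar] at h
  rw [div_eq_div_iff (hC.regular hq hw i).one_sub (hC.regular hq hw j).one_sub] at h
  exact hC.injOn_coord hw (mul_left_cancel₀ hq1' (by linear_combination h))

theorem Admissible.generic (hq : q ≠ 0) (hq1 : q ≠ 1) {w : Fin N → ℂ} (hw : w ∈ torus C) :
    Generic q (orbitSet q w) := by
  have hq1' : 1 - (q : ℂ) ≠ 0 := sub_ne_zero.2 (by exact_mod_cast hq1.symm)
  have h : ∀ a ∈ orbitSet q w, ∃ i, orbitVar q (w i) = a := fun a ha => by
    simpa [orbitSet] using ha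
  constructor
  · intro a ha
    obtain ⟨i, rfl⟩ := h a ha
    exact div_ne_zero (hC.regular hq hw i).one_sub_mul (hC.regular hq hw i).one_sub
  · intro a ha
    obtain ⟨i, rfl⟩ := h a ha
    rw [orbitVar, Ne, div_eq_one_iff_eq (hC.regular hq hw i).one_sub]
    exact fun h' => mul_ne_zero hq1' (hC.regular hq hw i).ne_zero (by linear_combination h')
  · intro a ha
    obtain ⟨i, rfl⟩ := h a ha
    rw [orbitVar, Ne, div_eq_iff (hC.regular hq hw i).one_sub]
    exact fun h' => hq1' (by linear_combination h')
  · intro a ha b hb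
    obtain ⟨i, rfl⟩ := h a ha
    obtain ⟨j, rfl⟩ := h b hb
    rw [orbitVar, orbitVar, div_mul_div_comm, Ne,
      div_eq_iff (mul_ne_zero (hC.regular hq hw i).one_sub (hC.regular hq hw j).one_sub)]
    exact fun h' => mul_ne_zero hq1' (hC.mul_mul_ne_one hq (.inl (hw i)) (.inl (hw j)))
      (by linear_combination h')

theorem Admissible.summand_eq_orderedProd (hq : q ≠ 0) (hq1 : q ≠ 1) (hMN : M ≤ N)
    (y : Fin M → ℕ+) {w : Fin N → ℂ} (hw : w ∈ torus C) (σ : SignedPerm N) :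
    summand q α hMN y (σ.act q w) = orderedProd q hMN (fun i => orbital q α (y i))
      fun i => branch q (σ.2 i) (orbitVar q (w (σ.1 i))) := by
  have hr : ∀ i, Regular q (σ.act q w i) := fun i => (hC.regular hq hw (σ.1 i)).flip hq (σ.2 i)
  have hv : ∀ i, branch q (σ.2 i) (orbitVar q (w (σ.1 i))) = orbitVar q (σ.act q w i) := fun i =>
    have h := hC.regular hq hw (σ.1 i)
    (orbitVar_flip hq (σ.2 i) h.ne_zero h.one_sub h.one_sub_mul).symm
  simp only [hv, summand, orderedProd]
  congr 1
  · refine Finset.prod_congr rfl fun i _ => Finset.prod_congr rfl fun j hj => ?_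
    have hij : σ.1 i ≠ σ.1 j := fun h => (Finset.mem_Ioi.1 hj).ne (σ.1.injective h)
    have h := flip_pair hq (hC.regular hq hw (σ.1 i)).ne_zero (hC.regular hq hw (σ.1 j)).ne_zero
      (fun h => hij (hC.injOn_coord hw h)) (hC.mul_mul_ne_one hq (.inl (hw _)) (.inl (hw _)))
      (σ.2 i) (σ.2 j)
    exact (interaction_orbitVar hq1 (hr i).one_sub (hr j).one_sub h.1 h.2).symm
  · exact Finset.prod_congr rfl fun i _ =>
      phi_eq_orbital hq1 _ (hr _).one_sub (hr _).one_sub_mul (hr _).one_sub_sq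

theorem Admissible.symmetrization_eq (hq : q ≠ 0) (hq1 : q ≠ 1) (hMN : M ≤ N)
    (y : Fin M → ℕ+) {w : Fin N → ℂ} (hw : w ∈ torus C) :
    symmetrization q α hMN y w
      = symmConst q (N - M) * posWave q α (fun i => y i) (orbitSet q w) := by
  have hq' : (q : ℂ) ≠ 0 := by exact_mod_cast hq
  have hq1' : (q : ℂ) ≠ 1 := by exact_mod_cast hq1
  rw [symmetrization, Finset.sum_congr rfl fun σ _ => hC.summand_eq_orderedProd hq hq1 hMN y hw σ,
    sum_orderedProd hq' hq1' hMN _ (z := fun i => orbitVar q (w i)) (hC.injective_orbitVar hq hq1 hw)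
      (hC.generic hq hq1 hw)]
  rfl

end torus

/-! ### The integrand as a wave function times an exponential. -/

section integrand

variable {q α : ℝ} {M N : ℕ} {C : Fin N → ℝ → ℂ}

/-- The total energy of the variables. -/
def totalEnergy (q : ℝ) (w : Fin N → ℂ) : ℂ :=
  ∑ i, (1 - q) ^ 2 * w i / ((1 - w i) * (1 - q * w i))

theorem integrand_eq_exp (hMN : M ≤ N) (y : Fin M → ℕ+) (x : Fin N → ℕ+) (t : ℝ) (w : Fin N → ℂ) :
    integrand q α t hMN y x w
      = integrand q α 0 hMN y x w * Complex.exp (totalEnergy q w * t) := by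
  simp only [integrand, totalEnergy, Finset.sum_mul, Complex.exp_sum, Finset.prod_mul_distrib,
    Complex.ofReal_zero, mul_zero, zero_div, Complex.exp_zero, mul_one]
  have h : ∀ i, (1 - (q : ℂ)) ^ 2 * w i * t / ((1 - w i) * (1 - q * w i))
      = (1 - q) ^ 2 * w i / ((1 - w i) * (1 - q * w i)) * t := fun i => by ring
  simp only [h]
  ring

theorem Admissible.totalEnergy_eq (hC : Admissible q α C) (hq : q ≠ 0) (hq1 : q ≠ 1)
    {w : Fin N → ℂ} (hw : w ∈ torus C) :
    totalEnergy q w = ∑ a ∈ orbitSet q w, energy q a := by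
  rw [orbitSet, Finset.sum_image (hC.injective_orbitVar hq hq1 hw).injOn]
  exact Finset.sum_congr rfl fun i _ =>
    (energy_orbitVar (hC.regular hq hw i).one_sub (hC.regular hq hw i).one_sub_mul).symm

theorem Admissible.continuousOn_totalEnergy (hC : Admissible q α C) (hq : q ≠ 0) :
    ContinuousOn (totalEnergy (N := N) q) (torus C) :=
  continuousOn_finsetSum _ fun i _ => ContinuousOn.div (by fun_prop) (by fun_prop) fun w hw =>
    mul_ne_zero (hC.regular hq hw i).one_sub (hC.regular hq hw i).one_sub_mul

/-- The factor of the integrand that does not depend on the initial configuration. -/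
def prefactor (q α : ℝ) (x : Fin N → ℕ+) (w : Fin N → ℂ) : ℂ :=
  (∏ i, ∏ j ∈ Finset.Ioi i,
      ((w j - w i) / (q * w j - w i) * ((1 - q * w i * w j) / (1 - w i * w j))))
    * ∏ i, rho q α (x i) (w i)

theorem integrand_zero_eq (hMN : M ≤ N) (y : Fin M → ℕ+) (x : Fin N → ℕ+) (w : Fin N → ℂ) :
    integrand q α 0 hMN y x w = prefactor q α x w * symmetrization q α hMN y w := by
  simp [integrand, prefactor, rho]

/-- The normalization removes `symmConst`. What is left depends on the initial configuration only
through `posWave`, in the same way for all numbers of particles. -/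
theorem Admissible.V_mul_integrand (hC : Admissible q α C) (hq : 0 < q) (hq1 : q ≠ 1) (hMN : M ≤ N)
    (y : Fin M → ℕ+) (x : Fin N → ℕ+) (t : ℝ) {w : Fin N → ℂ} (hw : w ∈ torus C) :
    V q (N - M) * integrand q α t hMN y x w
      = prefactor q α x w * posWave q α (fun i => y i) (orbitSet q w)
        * Complex.exp (totalEnergy q w * t) := by
  rw [integrand_eq_exp, integrand_zero_eq, hC.symmetrization_eq hq.ne' hq1 hMN y hw]
  linear_combination prefactor q α x w * posWave q α (fun i => y i) (orbitSet q w)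
    * Complex.exp (totalEnergy q w * t) * V_mul_symmConst hq hq1 (N - M)

end integrand

/-! ### The generator -/

section generator

variable {q α γ : ℝ} {S : Config}

/-- The configurations that can be reached from `S` in at most one jump. -/
def neighbours (S : Config) : Finset Config :=
  insert S (insert (insert 1 S)
    (S.image (fun s => move S s (s + 1)) ∪ S.image fun s => move S s (s - 1)))

theorem self_mem_neighbours : S ∈ neighbours S := Finset.mem_insert_self _ _

theorem insert_mem_neighbours : insert 1 S ∈ neighbours S :=
  Finset.mem_insert_of_mem (Finset.mem_insert_self _ _)

theorem move_add_mem_neighbours {s : ℕ+} (hs : s ∈ S) : move S s (s + 1) ∈ neighbours S :=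
  Finset.mem_insert_of_mem (Finset.mem_insert_of_mem (Finset.mem_union_left _
    (Finset.mem_image_of_mem _ hs)))

theorem move_sub_mem_neighbours {s : ℕ+} (hs : s ∈ S) : move S s (s - 1) ∈ neighbours S :=
  Finset.mem_insert_of_mem (Finset.mem_insert_of_mem (Finset.mem_union_right _
    (Finset.mem_image_of_mem (fun s => move S s (s - 1)) hs)))

theorem generator_congr {f g : Config → ℝ} (h : ∀ T ∈ neighbours S, f T = g T) :
    generator q α 0 f S = generator q α 0 g S := by
  simp only [generator, h _ self_mem_neighbours, h _ insert_mem_neighbours, zero_mul]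
  congr 1
  · congr 1
    exact Finset.sum_congr rfl fun s hs => by rw [h _ (move_add_mem_neighbours hs)]
  · exact Finset.sum_congr rfl fun s hs => by rw [h _ (move_sub_mem_neighbours hs)]

theorem generator_add (f g : Config → ℝ) :
    generator q α γ (fun T => f T + g T) S = generator q α γ f S + generator q α γ g S := by
  have h1 : ∀ s, (if s + 1 ∈ S then (0 : ℝ) else f (move S s (s + 1)) + g (move S s (s + 1))
      - (f S + g S)) = (if s + 1 ∈ S then 0 else f (move S s (s + 1)) - f S)
        + if s + 1 ∈ S then 0 else g (move S s (s + 1)) - g S := fun s => by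
    split_ifs <;> ring
  have h2 : ∀ s, (if 1 < s ∧ s - 1 ∉ S then q * (f (move S s (s - 1)) + g (move S s (s - 1))
      - (f S + g S)) else 0) = (if 1 < s ∧ s - 1 ∉ S then q * (f (move S s (s - 1)) - f S) else 0)
        + if 1 < s ∧ s - 1 ∉ S then q * (g (move S s (s - 1)) - g S) else 0 := fun s => by
    split_ifs <;> ring
  simp only [generator, h1, h2, Finset.sum_add_distrib]
  split_ifs <;> ring

theorem generator_const_mul (c : ℝ) (f : Config → ℝ) :
    generator q α γ (fun T => c * f T) S = c * generator q α γ f S := by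
  have h1 : ∀ s, (if s + 1 ∈ S then (0 : ℝ) else c * f (move S s (s + 1)) - c * f S)
      = c * if s + 1 ∈ S then 0 else f (move S s (s + 1)) - f S := fun s => by
    split_ifs <;> ring
  have h2 : ∀ s, (if 1 < s ∧ s - 1 ∉ S then q * (c * f (move S s (s - 1)) - c * f S) else 0)
      = c * if 1 < s ∧ s - 1 ∉ S then q * (f (move S s (s - 1)) - f S) else 0 := fun s => by
    split_ifs <;> ring
  simp only [generator, h1, h2, ← Finset.mul_sum]
  split_ifs <;> ring

theorem generator_const (c : ℝ) : generator q α γ (fun _ => c) S = 0 := by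
  simp [generator]

theorem generator_sum (A : Finset Config) (f : Config → ℝ) :
    generator q α γ (fun T' => ∑ T ∈ A, f T * if T' = T then 1 else 0) S
      = ∑ T ∈ A, rate q α γ S T * f T := by
  induction A using Finset.induction_on with
  | empty => simp [generator_const]
  | insert T A hT ih =>
    simp only [Finset.sum_insert hT]
    rw [generator_add, ih, generator_const_mul, mul_comm, rate]

theorem generator_eq_sum {A : Finset Config} (hA : neighbours S ⊆ A) (f : Config → ℝ) :
    generator q α 0 f S = ∑ T ∈ A, rate q α 0 S T * f T := by
  rw [← generator_sum]
  refine generator_congr fun T hT => ?_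
  simp [hA hT]

/-- The generator acting on complex functions. -/
def complexGenerator (q α : ℝ) (f : Config → ℂ) (S : Config) : ℂ :=
  (if 1 ∈ S then 0 else α * (f (insert 1 S) - f S))
    + (∑ s ∈ S, if s + 1 ∈ S then 0 else f (move S s (s + 1)) - f S)
    + ∑ s ∈ S, if 1 < s ∧ s - 1 ∉ S then q * (f (move S s (s - 1)) - f S) else 0

theorem re_complexGenerator (f : Config → ℂ) :
    (complexGenerator q α f S).re = generator q α 0 (fun T => (f T).re) S := by
  simp [complexGenerator, generator, apply_ite Complex.re]

theorem im_complexGenerator (f : Config → ℂ) :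
    (complexGenerator q α f S).im = generator q α 0 (fun T => (f T).im) S := by
  simp [complexGenerator, generator, apply_ite Complex.im]

theorem complexGenerator_eq_sum (f : Config → ℂ) :
    complexGenerator q α f S = ∑ T ∈ neighbours S, (rate q α 0 S T : ℂ) * f T := by
  apply Complex.ext
  · rw [re_complexGenerator, generator_eq_sum subset_rfl]
    simp
  · rw [im_complexGenerator, generator_eq_sum subset_rfl]
    simp

end generator

/-! ### Enumerations of configurations -/

section positions

variable {M : ℕ}

/-- The occupied sites in decreasing order. -/
def positions (S : Config) : Fin S.card → ℕ+ := fun i => S.orderEmbOfFin rfl i.rev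

theorem strictAnti_positions (S : Config) : StrictAnti (positions S) := fun _ _ h =>
  (S.orderEmbOfFin rfl).strictMono (Fin.rev_lt_rev.2 h)

theorem config_positions (S : Config) : config (positions S) = S := by
  ext k
  rw [mem_config]
  constructor
  · rintro ⟨i, rfl⟩
    exact Finset.orderEmbOfFin_mem S rfl _
  · intro h
    have : k ∈ Set.range (S.orderEmbOfFin rfl) := by
      rw [Finset.range_orderEmbOfFin]
      exact h
    obtain ⟨i, hi⟩ := this
    exact ⟨i.rev, by rw [positions, Fin.rev_rev, hi]⟩

theorem card_config {y : Fin M → ℕ+} (hy : StrictAnti y) : (config y).card = M := by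
  rw [config, Finset.card_image_of_injective _ hy.injective, Finset.card_univ, Fintype.card_fin]

theorem eq_of_config_eq {y z : Fin M → ℕ+} (hy : StrictAnti y) (hz : StrictAnti z)
    (h : config y = config z) : y = z := by
  have h1 : Set.range y = Set.range z := by
    ext k
    have := Finset.ext_iff.1 h k
    rwa [mem_config, mem_config] at this
  have hr : ∀ v : Fin M → ℕ+, Set.range (fun i : Fin M => v i.rev) = Set.range v := fun v =>
    Fin.rev_surjective.range_comp v
  have h2 : (fun i : Fin M => y i.rev) = fun i : Fin M => z i.rev :=
    (StrictMono.range_inj (fun _ _ h => hy (Fin.rev_lt_rev.2 h))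
      (fun _ _ h => hz (Fin.rev_lt_rev.2 h))).1 (by rw [hr, hr, h1])
  funext i
  have := congrFun h2 i.rev
  simpa using this

theorem posWave_positions {q α : ℂ} {y : Fin M → ℕ+} (hy : StrictAnti y) (s : Finset ℂ) :
    posWave q α (fun i => positions (config y) i) s = posWave q α (fun i => y i) s := by
  have h : ∀ n (z : Fin n → ℕ+), StrictAnti z → config z = config y → n = M →
      posWave q α (fun i => z i) s = posWave q α (fun i => y i) s := by
    rintro n z hz hzy rfl
    rw [eq_of_config_eq hz hy hzy]
  exact h _ _ (strictAnti_positions _) (config_positions _) (card_config hy)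

theorem move_config {y : Fin M → ℕ+} (hy : StrictAnti y) (i : Fin M) (k : ℕ+) :
    move (config y) (y i) k = config (Function.update y i k) := by
  ext a
  rw [move, Finset.mem_insert, Finset.mem_erase, mem_config, mem_config]
  constructor
  · rintro (rfl | ⟨h, j, rfl⟩)
    · exact ⟨i, Function.update_self ..⟩
    · exact ⟨j, Function.update_of_ne (fun h' => h (by rw [h'])) _ _⟩
  · rintro ⟨j, rfl⟩
    by_cases h : j = i
    · subst h
      exact .inl (Function.update_self ..)
    · rw [Function.update_of_ne h]
      exact .inr ⟨fun h' => h (hy.injective h'), j, rfl⟩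

theorem strictAnti_update_add {y : Fin M → ℕ+} (hy : StrictAnti y) {i : Fin M}
    (h : y i + 1 ∉ config y) : StrictAnti (Function.update y i (y i + 1)) := by
  intro a b hab
  by_cases ha : a = i
  · subst ha
    rw [Function.update_self, Function.update_of_ne hab.ne']
    exact (hy hab).trans (PNat.lt_add_right _ _)
  · rw [Function.update_of_ne ha]
    by_cases hb : b = i
    · subst hb
      rw [Function.update_self]
      exact lt_of_le_of_ne (PNat.add_one_le_iff.2 (hy hab)) fun h' => h (mem_config.2 ⟨a, h'.symm⟩)
    · rw [Function.update_of_ne hb]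
      exact hy hab

theorem strictAnti_update_sub {y : Fin M → ℕ+} (hy : StrictAnti y) {i : Fin M} (h1 : 1 < y i)
    (h : y i - 1 ∉ config y) : StrictAnti (Function.update y i (y i - 1)) := by
  have hs := PNat.sub_add_of_lt h1
  intro a b hab
  by_cases ha : a = i
  · subst ha
    rw [Function.update_self, Function.update_of_ne hab.ne']
    refine lt_of_le_of_ne ?_ fun h' => h (mem_config.2 ⟨b, h'⟩)
    have := hy hab
    rw [← hs] at this
    exact PNat.lt_add_one_iff.1 this
  · rw [Function.update_of_ne ha]
    by_cases hb : b = i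
    · subst hb
      rw [Function.update_self]
      refine lt_of_lt_of_le ?_ (hy hab).le
      conv_rhs => rw [← hs]
      exact PNat.lt_add_right _ _
    · rw [Function.update_of_ne hb]
      exact hy hab

theorem strictAnti_snoc_one {y : Fin M → ℕ+} (hy : StrictAnti y) (h : 1 ∉ config y) :
    StrictAnti (Fin.snoc (α := fun _ => ℕ+) y 1) := by
  intro a b hab
  induction b using Fin.lastCases with
  | last =>
    obtain ⟨a, rfl⟩ := Fin.exists_castSucc_eq.2 hab.ne
    rw [Fin.snoc_last, Fin.snoc_castSucc]
    exact lt_of_le_of_ne one_le fun h' => h (mem_config.2 ⟨a, h'.symm⟩)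
  | cast b =>
    obtain ⟨a, rfl⟩ := Fin.exists_castSucc_eq.2 (hab.trans (Fin.castSucc_lt_last b)).ne
    rw [Fin.snoc_castSucc, Fin.snoc_castSucc]
    exact hy (Fin.castSucc_lt_castSucc_iff.1 hab)

theorem config_snoc_one (y : Fin M → ℕ+) :
    config (Fin.snoc (α := fun _ => ℕ+) y 1) = insert 1 (config y) := by
  ext a
  rw [Finset.mem_insert, mem_config, mem_config]
  constructor
  · rintro ⟨i, rfl⟩
    induction i using Fin.lastCases with
    | last => exact .inl (Fin.snoc_last ..)
    | cast i => exact .inr ⟨i, (Fin.snoc_castSucc (α := fun _ => ℕ+) ..).symm⟩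
  · rintro (rfl | ⟨i, rfl⟩)
    · exact ⟨Fin.last M, Fin.snoc_last ..⟩
    · exact ⟨i.castSucc, Fin.snoc_castSucc (α := fun _ => ℕ+) ..⟩

end positions

/-! ### The weighted wave functions and the generator -/

section weighted

variable {q α : ℝ} {M N : ℕ} {s : Finset ℂ}

/-- The wave function of a configuration, with a weight for the particles that are missing. -/
def configWave (q α : ℝ) (N : ℕ) (s : Finset ℂ) (S : Config) : ℂ :=
  α ^ (N - S.card) * posWave q α (fun i => positions S i) s

theorem configWave_config {y : Fin M → ℕ+} (hy : StrictAnti y) :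
    configWave q α N s (config y) = α ^ (N - M) * posWave q α (fun i => y i) s := by
  rw [configWave, posWave_positions hy, card_config hy]

/-- An injection lowers the exponent of `α` by one, so the rate `α` restores the common weight and
the gain term is the injected wave function with coefficient 1, as in `posWave_backward`. When site
1 is empty the loss term lowers the eigenvalue by `α`; when it is occupied the boundary relation
produces an additional `α`, so the same eigenvalue results. -/
theorem complexGenerator_configWave (hq : q ≠ 0) (hs : Generic q s) (hN : s.card = N) (S : Config) :
    complexGenerator q α (configWave q α N s) S
      = ((∑ a ∈ s, energy q a) - α) * configWave q α N s S := by
  have hq' : (q : ℂ) ≠ 0 := by exact_mod_cast hq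
  obtain ⟨M, y, hy, rfl⟩ : ∃ (M : ℕ) (y : Fin M → ℕ+), StrictAnti y ∧ config y = S :=
    ⟨_, positions S, strictAnti_positions S, config_positions S⟩
  have hb := posWave_backward (α := (α : ℂ)) hq' hs hy
  have hsum : ∀ G : ℕ+ → ℂ, ∑ k ∈ config y, G k = ∑ i, G (y i) := fun G =>
    Finset.sum_image hy.injective.injOn
  have hcoe : ∀ i k, (fun j => (Function.update y i k j : ℕ))
      = Function.update (fun j => (y j : ℕ)) i k := fun i k =>
    Function.comp_update PNat.val y i k
  have h1 : ∀ i, (if y i + 1 ∈ config y then 0 else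
      configWave q α N s (move (config y) (y i) (y i + 1)) - configWave q α N s (config y))
      = α ^ (N - M) * if y i + 1 ∈ config y then 0 else
          posWave q α (Function.update (fun i => (y i : ℕ)) i (y i + 1)) s
            - posWave q α (fun i => y i) s := fun i => by
    split_ifs with h
    · rw [mul_zero]
    · rw [move_config hy, configWave_config (strictAnti_update_add hy h), configWave_config hy, hcoe,
        PNat.add_coe, PNat.one_coe]
      ring
  have h2 : ∀ i, (if 1 < y i ∧ y i - 1 ∉ config y then q * (
      configWave q α N s (move (config y) (y i) (y i - 1)) - configWave q α N s (config y)) else 0)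
      = α ^ (N - M) * if 1 < y i ∧ y i - 1 ∉ config y then q * (
          posWave q α (Function.update (fun i => (y i : ℕ)) i (y i - 1)) s
            - posWave q α (fun i => y i) s) else 0 := fun i => by
    split_ifs with h
    · rw [move_config hy, configWave_config (strictAnti_update_sub hy h.1 h.2),
        configWave_config hy, hcoe, PNat.sub_coe, if_pos h.1, PNat.one_coe]
      ring
    · rw [mul_zero]
  have h3 : (if 1 ∈ config y then 0 else
      α * (configWave q α N s (insert 1 (config y)) - configWave q α N s (config y)))
      = α ^ (N - M) * ((if 1 ∈ config y then α * posWave q α (fun i => y i) s else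
        posWave q α (Fin.snoc (α := fun _ => ℕ) (fun i => (y i : ℕ)) 1) s)
          - α * posWave q α (fun i => y i) s) := by
    split_ifs with h
    · ring
    · have hcs : (fun i => (Fin.snoc (α := fun _ => ℕ+) y 1 i : ℕ))
          = Fin.snoc (α := fun _ => ℕ) (fun i => (y i : ℕ)) 1 := Fin.comp_snoc PNat.val y 1
      rw [← config_snoc_one, configWave_config (strictAnti_snoc_one hy h), configWave_config hy, hcs]
      rcases lt_or_ge M N with hMN | hMN
      · rw [show N - M = N - (M + 1) + 1 by omega, pow_succ]
        ring
      -- The truncated exponent no longer drops here, but more particles than variables have wave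
      -- function zero.
      · have h0 : posWave q α (Fin.snoc (α := fun _ => ℕ) (fun i => (y i : ℕ)) 1) s = 0 :=
          wave_eq_zero_of_card_lt _ (by omega)
        rw [h0]
        ring
  rw [complexGenerator, hsum, hsum, Finset.sum_congr rfl fun i _ => h1 i,
    Finset.sum_congr rfl fun i _ => h2 i, ← Finset.mul_sum, ← Finset.mul_sum, h3,
    configWave_config hy]
  linear_combination -(α : ℂ) ^ (N - M) * hb

end weighted

/-! ### The contour integral solves the backward equation -/

section solution

variable {q α : ℝ} {M N : ℕ} {C : Fin N → ℝ → ℂ}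

/-- The contour integral formula, as a function of the initial configuration. -/
def solution (q α : ℝ) (C : Fin N → ℝ → ℂ) (x : Fin N → ℕ+) (t : ℝ) (S : Config) : ℂ :=
  Complex.exp (-(α * t)) * nestedInt C fun w =>
    (prefactor q α x w * configWave q α N (orbitSet q w) S) * Complex.exp (totalEnergy q w * t)

variable (hC : Admissible q α C) (hq : 0 < q) (hq1 : q ≠ 1)
include hC hq hq1

theorem Admissible.card_orbitSet {w : Fin N → ℂ} (hw : w ∈ torus C) : (orbitSet q w).card = N := by
  rw [orbitSet, Finset.card_image_of_injective _ (hC.injective_orbitVar hq.ne' hq1 hw),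
    Finset.card_univ, Fintype.card_fin]

theorem Admissible.configWave_of_le (hMN : M ≤ N) {y : Fin M → ℕ+} (hy : StrictAnti y)
    (x : Fin N → ℕ+) {w : Fin N → ℂ} (hw : w ∈ torus C) :
    prefactor q α x w * configWave q α N (orbitSet q w) (config y)
      = V q (N - M) * α ^ (N - M) * integrand q α 0 hMN y x w := by
  have h := hC.V_mul_integrand hq hq1 hMN y x 0 hw
  rw [Complex.ofReal_zero, mul_zero, Complex.exp_zero, mul_one] at h
  rw [configWave_config hy]
  linear_combination -(α : ℂ) ^ (N - M) * h

theorem Admissible.configWave_of_lt (hMN : N < M) {y : Fin M → ℕ+} (hy : StrictAnti y)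
    {w : Fin N → ℂ} (hw : w ∈ torus C) : configWave q α N (orbitSet q w) (config y) = 0 := by
  rw [configWave_config hy, posWave, wave_eq_zero_of_card_lt, mul_zero]
  rwa [hC.card_orbitSet hq hq1 hw]

theorem Admissible.solution_config (hMN : M ≤ N) {y : Fin M → ℕ+} (hy : StrictAnti y)
    (x : Fin N → ℕ+) (t : ℝ) :
    solution q α C x t (config y) = V q (N - M) * (α : ℂ) ^ (N - M) * Complex.exp (-(α * t))
        * nestedInt C (integrand q α t hMN y x) := by
  rw [solution, nestedInt_congr (g := fun w => (V q (N - M) * (α : ℂ) ^ (N - M))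
    * integrand q α t hMN y x w) fun w hw => ?_, nestedInt_const_mul]
  · ring
  · simp only
    rw [hC.configWave_of_le hq hq1 hMN hy x hw, integrand_eq_exp hMN y x t, mul_assoc]

theorem Admissible.solution_config_of_lt (hMN : N < M) {y : Fin M → ℕ+} (hy : StrictAnti y)
    (x : Fin N → ℕ+) (t : ℝ) : solution q α C x t (config y) = 0 := by
  rw [solution, nestedInt_congr (g := fun _ => 0) fun w hw => ?_, nestedInt_zero, mul_zero]
  simp only
  rw [hC.configWave_of_lt hq hq1 hMN hy hw, mul_zero, zero_mul]

omit hC hq hq1 in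
theorem exists_config_eq (S : Config) :
    ∃ (M : ℕ) (y : Fin M → ℕ+), StrictAnti y ∧ config y = S :=
  ⟨_, positions S, strictAnti_positions S, config_positions S⟩

theorem Admissible.solution_zero {x : Fin N → ℕ+} (hx : StrictAnti x) (S : Config) :
    solution q α C x 0 S = if S = config x then 1 else 0 := by
  obtain ⟨M, y, hy, rfl⟩ := exists_config_eq S
  rcases lt_trichotomy M N with h | rfl | h
  · rw [hC.solution_config hq hq1 h.le hy, hC.nestedInt_integrand_zero_of_lt hq.ne' h x hy, mul_zero,
      if_neg]
    intro h'
    have := congrArg Finset.card h'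
    rw [card_config hy, card_config hx] at this
    exact h.ne this
  · rw [hC.solution_config hq hq1 le_rfl hy, hC.nestedInt_integrand_zero hq.ne' hq1 hy hx]
    have : x = y ↔ config y = config x :=
      ⟨fun h => by rw [h], fun h => (eq_of_config_eq hy hx h).symm⟩
    simp [this, V]
  · rw [hC.solution_config_of_lt hq hq1 h hy, if_neg]
    intro h'
    have := congrArg Finset.card h'
    rw [card_config hy, card_config hx] at this
    exact h.ne' this

theorem Admissible.continuousOn_configWave (x : Fin N → ℕ+) (S : Config) :
    ContinuousOn (fun w => prefactor q α x w * configWave q α N (orbitSet q w) S) (torus C) := by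
  obtain ⟨M, y, hy, rfl⟩ := exists_config_eq S
  rcases le_or_gt M N with h | h
  · exact (continuousOn_const.mul (hC.continuousOn_integrand_zero hq.ne' h y x)).congr
      fun w hw => hC.configWave_of_le hq hq1 h hy x hw
  · refine (continuousOn_const (c := (0 : ℂ))).congr fun w hw => ?_
    simp only
    rw [hC.configWave_of_lt hq hq1 h hy hw, mul_zero]

/-- Differentiation multiplies the integrand by the total energy and exp(-α t) contributes -α,
together the eigenvalue of the generator. Only finitely many configurations can be reached in one
jump, so the generator passes through the integral. -/
theorem Admissible.hasDerivAt_solution (x : Fin N → ℕ+) (S : Config) (t : ℝ) :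
    HasDerivAt (fun t => solution q α C x t S) (complexGenerator q α (solution q α C x t) S) t := by
  have hg := hC.continuousOn_configWave hq hq1 x
  have hE := hC.continuousOn_totalEnergy hq.ne'
  have hge : ∀ T, ContinuousOn (fun w => (prefactor q α x w * configWave q α N (orbitSet q w) T)
      * Complex.exp (totalEnergy q w * t)) (torus C) := fun T =>
    (hg T).mul (hE.mul continuousOn_const).cexp
  have hd := hasDerivAt_nestedInt_exp hC.isClosedCurve (hg S) hE t
  have he : HasDerivAt (fun t : ℝ => Complex.exp (-(α * t))) (Complex.exp (-(α * t)) * -α) t := by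
    have h1 : HasDerivAt (fun t : ℝ => -((α : ℂ) * t)) (-α) t := by
      simpa using ((Complex.ofRealCLM.hasDerivAt (x := t)).const_mul (α : ℂ)).fun_neg
    exact h1.cexp
  refine (he.mul hd).congr_deriv ?_
  have h2 : complexGenerator q α (solution q α C x t) S = Complex.exp (-(α * t)) * nestedInt C
      fun w => ∑ T ∈ neighbours S, (rate q α 0 S T : ℂ)
        * ((prefactor q α x w * configWave q α N (orbitSet q w) T)
          * Complex.exp (totalEnergy q w * t)) := by
    rw [nestedInt_sum hC.isClosedCurve (neighbours S) (f := fun T w => (rate q α 0 S T : ℂ)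
      * ((prefactor q α x w * configWave q α N (orbitSet q w) T)
        * Complex.exp (totalEnergy q w * t))) fun T _ => continuousOn_const.mul (hge T),
      complexGenerator_eq_sum, Finset.mul_sum]
    refine Finset.sum_congr rfl fun T _ => ?_
    rw [nestedInt_const_mul, solution]
    ring
  have h3 : EqOn (fun w => ∑ T ∈ neighbours S, (rate q α 0 S T : ℂ)
        * ((prefactor q α x w * configWave q α N (orbitSet q w) T)
          * Complex.exp (totalEnergy q w * t)))
      (fun w => totalEnergy q w * ((prefactor q α x w * configWave q α N (orbitSet q w) S)
          * Complex.exp (totalEnergy q w * t))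
        + -α * ((prefactor q α x w * configWave q α N (orbitSet q w) S)
          * Complex.exp (totalEnergy q w * t))) (torus C) := by
    intro w hw
    have h4 := complexGenerator_configWave (α := α) hq.ne' (hC.generic hq.ne' hq1 hw)
      (hC.card_orbitSet hq hq1 hw) S
    rw [complexGenerator_eq_sum, ← hC.totalEnergy_eq hq.ne' hq1 hw] at h4
    have h5 : ∑ T ∈ neighbours S, (rate q α 0 S T : ℂ)
        * ((prefactor q α x w * configWave q α N (orbitSet q w) T)
          * Complex.exp (totalEnergy q w * t))
        = prefactor q α x w * Complex.exp (totalEnergy q w * t)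
          * ∑ T ∈ neighbours S, (rate q α 0 S T : ℂ) * configWave q α N (orbitSet q w) T := by
      rw [Finset.mul_sum]
      exact Finset.sum_congr rfl fun T _ => by ring
    simp only
    rw [h5, h4]
    ring
  have h4 := nestedInt_add hC.isClosedCurve
    (f := fun w => totalEnergy q w * ((prefactor q α x w * configWave q α N (orbitSet q w) S)
      * Complex.exp (totalEnergy q w * t)))
    (g := fun w => -(α : ℂ) * ((prefactor q α x w * configWave q α N (orbitSet q w) S)
      * Complex.exp (totalEnergy q w * t))) (hE.mul (hge S)) (continuousOn_const.mul (hge S))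
  rw [h2, nestedInt_congr h3, h4, nestedInt_const_mul]
  ring

end solution

/-! ### Growth of the solution in the initial configuration -/

section growth

variable {q α : ℝ} {M N : ℕ} {C : Fin N → ℝ → ℂ}

/-- The weight `b ^ (s₁ + s₂ + ⋯)` of the configuration `{s₁, s₂, …}`. -/
def growthWeight (b : ℝ) (S : Config) : ℝ := b ^ ∑ s ∈ S, (s : ℕ)

theorem exists_uniform_bound {ι : Type*} [Fintype ι] {X : Type*} [TopologicalSpace X] {K : Set X}
    (hK : IsCompact K) {f : ι → X → ℂ} (hf : ∀ i, ContinuousOn (f i) K) :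
    ∃ B, 1 ≤ B ∧ ∀ i, ∀ w ∈ K, ‖f i w‖ ≤ B := by
  choose B hB using fun i => hK.exists_bound_of_continuousOn (hf i)
  refine ⟨1 + ∑ i, |B i|, le_add_of_nonneg_right (Finset.sum_nonneg fun i _ => abs_nonneg _),
    fun i w hw => (hB i w hw).trans ((le_abs_self _).trans ?_)⟩
  have := Finset.single_le_sum (f := fun i => |B i|) (fun i _ => abs_nonneg _) (Finset.mem_univ i)
  linarith

variable (hC : Admissible q α C) (hq : q ≠ 0)
include hC hq

theorem Admissible.continuousOn_flip (ε : ℤˣ) (i : Fin N) :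
    ContinuousOn (fun w : Fin N → ℂ => flip q ε (w i)) (torus C) := by
  have hq' : (q : ℂ) ≠ 0 := by exact_mod_cast hq
  unfold flip
  split_ifs
  · fun_prop
  · exact ContinuousOn.div (by fun_prop) (by fun_prop) fun w hw =>
      mul_ne_zero hq' (hC.regular hq hw i).ne_zero

/-- The positions enter only as exponents of (1 - q w)/(1 - w) at the variables and their
inversions, which is bounded on the compact product of contours. The constants must not depend on
`M` or `y`, since uniqueness involves all configurations at once. -/
theorem Admissible.exists_norm_symmetrization_le :
    ∃ K b : ℝ, 0 ≤ K ∧ 1 ≤ b ∧ ∀ (M : ℕ) (hMN : M ≤ N) (y : Fin M → ℕ+), ∀ w ∈ torus C,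
      ‖symmetrization q α hMN y w‖ ≤ K * b ^ ∑ i, (y i : ℕ) := by
  have hK := isCompact_torus hC.isClosedCurve
  have hr : ∀ w ∈ torus C, ∀ ε i, Regular q (flip q ε (w i)) :=
    fun w hw ε i => (hC.regular hq hw i).flip hq ε
  have hf := hC.continuousOn_flip hq
  obtain ⟨b, hb1, hb⟩ := exists_uniform_bound hK (ι := ℤˣ × Fin N)
    (f := fun k w => (1 - q * flip q k.1 (w k.2)) / (1 - flip q k.1 (w k.2))) fun k =>
      ContinuousOn.div (continuousOn_const.sub (continuousOn_const.mul (hf _ _)))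
        (continuousOn_const.sub (hf _ _)) fun w hw => (hr w hw _ _).one_sub
  obtain ⟨c, hc1, hc⟩ := exists_uniform_bound hK (ι := ℤˣ × Fin N)
    (f := fun k w => (1 - q - α + α * flip q k.1 (w k.2)) / (1 - q * flip q k.1 (w k.2) ^ 2)
      * ((1 - q) * flip q k.1 (w k.2) / (1 - flip q k.1 (w k.2)))) fun k =>
      (ContinuousOn.div (continuousOn_const.add (continuousOn_const.mul (hf _ _)))
        (continuousOn_const.sub (continuousOn_const.mul ((hf _ _).pow 2)))
          fun w hw => (hr w hw _ _).one_sub_sq).mul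
      (ContinuousOn.div (continuousOn_const.mul (hf _ _)) (continuousOn_const.sub (hf _ _))
        fun w hw => (hr w hw _ _).one_sub)
  obtain ⟨a, ha1, ha⟩ := exists_uniform_bound hK (ι := SignedPerm N)
    (f := fun σ w => ∏ i, ∏ j ∈ Finset.Ioi i,
      ((σ.act q w i - q * σ.act q w j) / (σ.act q w i - σ.act q w j)
        * ((1 - σ.act q w i * σ.act q w j) / (1 - q * σ.act q w i * σ.act q w j)))) fun σ => by
      have hσ : ∀ i, ContinuousOn (fun w => σ.act q w i) (torus C) := fun i => hf _ _
      refine continuousOn_finsetProd _ fun i _ => continuousOn_finsetProd _ fun j hj => ?_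
      have hij : σ.1 i ≠ σ.1 j := fun h => (Finset.mem_Ioi.1 hj).ne (σ.1.injective h)
      have hne : ∀ w ∈ torus C, _ := fun w hw => flip_pair hq
        (hC.regular hq hw (σ.1 i)).ne_zero (hC.regular hq hw (σ.1 j)).ne_zero
        (fun h => hij (hC.injOn_coord hw h)) (hC.mul_mul_ne_one hq (.inl (hw _)) (.inl (hw _)))
        (σ.2 i) (σ.2 j)
      exact (((hσ i).sub (continuousOn_const.mul (hσ j))).div ((hσ i).sub (hσ j)) fun w hw =>
        sub_ne_zero.2 (hne w hw).1).mul ((continuousOn_const.sub ((hσ i).mul (hσ j))).div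
        (continuousOn_const.sub ((continuousOn_const.mul (hσ i)).mul (hσ j))) fun w hw =>
          (hne w hw).2)
  refine ⟨∑ _σ : SignedPerm N, a * c ^ N, b, by positivity, hb1, fun M hMN y w hw => ?_⟩
  rw [symmetrization, Finset.sum_mul]
  refine (norm_sum_le _ _).trans (Finset.sum_le_sum fun σ _ => ?_)
  have hphi : ∀ i : Fin M, ‖phi q α (y i) (σ.act q w (Fin.castLE hMN i))‖ ≤ c * b ^ (y i : ℕ) := by
    intro i
    rw [phi, norm_mul, norm_pow]
    refine mul_le_mul (hc (σ.2 _, σ.1 _) w hw) ?_ (by positivity) (by positivity)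
    exact (pow_le_pow_left₀ (norm_nonneg _) (hb (σ.2 _, σ.1 _) w hw) _).trans
      (pow_le_pow_right₀ hb1 (Nat.sub_le _ _))
  have hprod : ∏ i : Fin M, ‖phi q α (y i) (σ.act q w (Fin.castLE hMN i))‖
      ≤ c ^ N * b ^ ∑ i, (y i : ℕ) := by
    refine (Finset.prod_le_prod (fun i _ => norm_nonneg _) fun i _ => hphi i).trans ?_
    rw [Finset.prod_mul_distrib, Finset.prod_const, Finset.card_univ, Fintype.card_fin,
      Finset.prod_pow_eq_pow_sum]
    exact mul_le_mul_of_nonneg_right (pow_le_pow_right₀ hc1 hMN) (by positivity)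
  rw [summand, norm_mul, norm_prod (s := Finset.univ) (f := fun i : Fin M =>
    phi q α (y i) (σ.act q w (Fin.castLE hMN i))), mul_assoc a]
  exact mul_le_mul (ha σ w hw) hprod (Finset.prod_nonneg fun i _ => norm_nonneg _) (by positivity)

omit hq in
theorem Admissible.continuousOn_prefactor (hq : q ≠ 0) (x : Fin N → ℕ+) :
    ContinuousOn (prefactor q α x) (torus C) := by
  refine (continuousOn_finsetProd _ fun i _ => continuousOn_finsetProd _ fun j hj => ?_).mul
    (continuousOn_finsetProd _ fun i _ =>
      (hC.ratOn_rho i (x i) i).continuousOn.mono (torus_subset_solidTorus i))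
  have hij := Finset.mem_Ioi.1 hj
  refine (ContinuousOn.div (by fun_prop) (by fun_prop) fun w hw => ?_).mul
    (ContinuousOn.div (by fun_prop) (by fun_prop) fun w hw =>
      hC.mul_ne_one_of_mem_disc hij (.inl (hw i)) (hw j))
  rw [← neg_ne_zero, neg_sub]
  exact hC.sub_smul_ne_zero hq hij (.inl (hw i)) (.inl (hw j))

theorem Admissible.exists_norm_solution_le (hq0 : 0 < q) (hq1 : q ≠ 1) (hα : 0 ≤ α)
    (x : Fin N → ℕ+) (T : ℝ) : ∃ K b : ℝ, 0 ≤ K ∧ 1 ≤ b ∧ ∀ t ∈ Icc 0 T, ∀ S,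
      ‖solution q α C x t S‖ ≤ K * growthWeight b S := by
  have hK := isCompact_torus hC.isClosedCurve
  obtain ⟨K, b, hK0, hb1, hsym⟩ := hC.exists_norm_symmetrization_le hq
  obtain ⟨L, hL0, hL⟩ := exists_norm_nestedInt_le hC.isClosedCurve
  obtain ⟨P, hP1, hP⟩ := exists_uniform_bound hK (ι := Unit) (f := fun _ => prefactor q α x)
    fun _ => hC.continuousOn_prefactor hq x
  obtain ⟨E, hE1, hE⟩ := exists_uniform_bound hK (ι := Unit) (f := fun _ => totalEnergy q)
    fun _ => hC.continuousOn_totalEnergy hq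
  -- The sum over all possible numbers of missing particles bounds each normalization.
  set A := ∑ k ∈ Finset.range (N + 1), ‖(V q k : ℂ) * (α : ℂ) ^ k‖
  have hA0 : 0 ≤ A := Finset.sum_nonneg fun k _ => norm_nonneg _
  refine ⟨L * (A * (P * K) * Real.exp (E * T)), b, by positivity, hb1, fun t ht S => ?_⟩
  obtain ⟨M, y, hy, rfl⟩ := exists_config_eq S
  have hgw : growthWeight b (config y) = b ^ ∑ i, (y i : ℕ) := by
    rw [growthWeight]
    congr 1
    exact Finset.sum_image hy.injective.injOn
  rcases lt_or_ge N M with hMN | hMN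
  · rw [hC.solution_config_of_lt hq0 hq1 hMN hy, norm_zero, hgw]
    positivity
  · have he : ‖Complex.exp (-(α * t))‖ ≤ 1 := by
      rw [Complex.norm_exp, Real.exp_le_one_iff]
      have := mul_nonneg hα ht.1
      simpa using this
    have hi : ∀ w ∈ torus C, ‖(prefactor q α x w * configWave q α N (orbitSet q w) (config y))
        * Complex.exp (totalEnergy q w * t)‖
        ≤ A * (P * K) * Real.exp (E * T) * b ^ ∑ i, (y i : ℕ) := by
      intro w hw
      have h1 : ‖Complex.exp (totalEnergy q w * t)‖ ≤ Real.exp (E * T) := by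
        refine (Complex.norm_exp_le_exp_norm _).trans (Real.exp_le_exp.2 ?_)
        rw [norm_mul, Complex.norm_real, Real.norm_eq_abs, abs_of_nonneg ht.1]
        exact mul_le_mul (hE () w hw) ht.2 ht.1 (by positivity)
      have h2 : ‖(V q (N - M) : ℂ) * (α : ℂ) ^ (N - M)‖ ≤ A :=
        Finset.single_le_sum (f := fun k => ‖(V q k : ℂ) * (α : ℂ) ^ k‖) (fun k _ => norm_nonneg _)
          (Finset.mem_range.2 (by omega))
      rw [hC.configWave_of_le hq0 hq1 hMN hy x hw, integrand_zero_eq, norm_mul, norm_mul, norm_mul,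
        norm_mul]
      rw [norm_mul] at h2
      have h3 := hsym M hMN y w hw
      have h4 := hP () w hw
      calc _ ≤ A * (P * (K * b ^ ∑ i, (y i : ℕ))) * Real.exp (E * T) := by gcongr
        _ = _ := by ring
    rw [solution, norm_mul, hgw]
    have := hL _ _ hi
    calc _ ≤ 1 * (L * (A * (P * K) * Real.exp (E * T) * b ^ ∑ i, (y i : ℕ))) := by gcongr
      _ = _ := by ring

end growth

/-! ### Uniqueness for the backward equation -/

section uniqueness

variable {q α : ℝ} {S T : Config}

theorem card_le_of_mem_neighbours (h : T ∈ neighbours S) : T.card ≤ S.card + 1 := by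
  have hm : ∀ s s', s ∈ S → (move S s s').card ≤ S.card + 1 := fun s s' hs =>
    (Finset.card_insert_le _ _).trans (Nat.succ_le_succ (Finset.card_le_card (Finset.erase_subset _ _)))
  simp only [neighbours, Finset.mem_insert, Finset.mem_union, Finset.mem_image] at h
  rcases h with rfl | rfl | ⟨s, hs, rfl⟩ | ⟨s, hs, rfl⟩
  exacts [Nat.le_succ _, Finset.card_insert_le _ _, hm _ _ hs, hm _ _ hs]

theorem sum_insert_le_add (s : ℕ+) (S : Config) :
    ∑ k ∈ insert s S, (k : ℕ) ≤ s + ∑ k ∈ S, (k : ℕ) := by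
  by_cases h : s ∈ S
  · rw [Finset.insert_eq_of_mem h]
    exact Nat.le_add_left _ _
  · rw [Finset.sum_insert h]

theorem sum_le_of_mem_neighbours (h : T ∈ neighbours S) :
    ∑ s ∈ T, (s : ℕ) ≤ ∑ s ∈ S, (s : ℕ) + 1 := by
  have hm : ∀ s s' : ℕ+, s ∈ S → (s' : ℕ) ≤ s + 1 →
      ∑ k ∈ move S s s', (k : ℕ) ≤ ∑ k ∈ S, (k : ℕ) + 1 := fun s s' hs hss => by
    refine (sum_insert_le_add s' (S.erase s)).trans ?_
    rw [← Finset.add_sum_erase S (fun k : ℕ+ => (k : ℕ)) hs]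
    omega
  simp only [neighbours, Finset.mem_insert, Finset.mem_union, Finset.mem_image] at h
  rcases h with rfl | rfl | ⟨s, hs, rfl⟩ | ⟨s, hs, rfl⟩
  · exact Nat.le_succ _
  · rw [add_comm]
    exact sum_insert_le_add 1 S
  · exact hm _ _ hs le_rfl
  · refine hm _ _ hs ?_
    rw [PNat.sub_coe, PNat.one_coe]
    have := s.pos
    split_ifs <;> omega

theorem growthWeight_le_of_mem_neighbours {b : ℝ} (hb : 1 ≤ b) (h : T ∈ neighbours S) :
    growthWeight b T ≤ b * growthWeight b S := by
  rw [growthWeight, growthWeight, ← pow_succ']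
  exact pow_le_pow_right₀ hb (sum_le_of_mem_neighbours h)

theorem abs_generator_le (hq : 0 ≤ q) (hα : 0 ≤ α) {g : Config → ℝ} {B : ℝ}
    (h : ∀ T ∈ neighbours S, |g T| ≤ B) :
    |generator q α 0 g S| ≤ 2 * (1 + q + α) * (S.card + 1) * B := by
  have hB : 0 ≤ B := (abs_nonneg _).trans (h S self_mem_neighbours)
  have hd : ∀ T ∈ neighbours S, |g T - g S| ≤ 2 * B := fun T hT =>
    (abs_sub _ _).trans (by linarith [h T hT, h S self_mem_neighbours])
  have h1 : |if 1 ∈ S then 0 else α * (g (insert 1 S) - g S)| ≤ α * (2 * B) := by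
    split_ifs
    · rw [abs_zero]
      positivity
    · rw [abs_mul, abs_of_nonneg hα]
      exact mul_le_mul_of_nonneg_left (hd _ insert_mem_neighbours) hα
  have h2 : |∑ s ∈ S, if s + 1 ∈ S then 0 else g (move S s (s + 1)) - g S| ≤ S.card * (2 * B) := by
    rw [← nsmul_eq_mul]
    refine (Finset.abs_sum_le_sum_abs _ _).trans (Finset.sum_le_card_nsmul _ _ _ fun s hs => ?_)
    split_ifs
    · rw [abs_zero]
      positivity
    · exact hd _ (move_add_mem_neighbours hs)
  have h3 : |∑ s ∈ S, if 1 < s ∧ s - 1 ∉ S then q * (g (move S s (s - 1)) - g S) else 0|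
      ≤ S.card * (q * (2 * B)) := by
    rw [← nsmul_eq_mul]
    refine (Finset.abs_sum_le_sum_abs _ _).trans (Finset.sum_le_card_nsmul _ _ _ fun s hs => ?_)
    split_ifs
    · rw [abs_mul, abs_of_nonneg hq]
      exact mul_le_mul_of_nonneg_left (hd _ (move_sub_mem_neighbours hs)) hq
    · rw [abs_zero]
      positivity
  have h4 : (if 1 ∈ S then (0 : ℝ) * (g (S.erase 1) - g S) else 0) = 0 := by simp
  rw [generator, h4, add_zero]
  refine (abs_add_three _ _ _).trans ((add_le_add (add_le_add h1 h2) h3).trans ?_)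
  have hc : (0 : ℝ) ≤ S.card := Nat.cast_nonneg _
  nlinarith [mul_nonneg hα (mul_nonneg hc hB), mul_nonneg hq hB]

variable {D : ℝ → Config → ℝ} (hq : 0 ≤ q) (hα : 0 ≤ α)
  (hcont : ∀ S, ContinuousOn (fun t => D t S) (Ici 0))
  (hderiv : ∀ S, ∀ t, 0 ≤ t →
    HasDerivWithinAt (fun t => D t S) (generator q α 0 (D t) S) (Ici t) t)
include hq hα hcont hderiv

/-- Iteration of the integrated equation. One application of the generator costs a factor linear in
the number of particles, one factor b from the growth weight, and at most one additional particle.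
The product (|S| + 1)⋯(|S| + n), divided by n! from the time integrals, is the binomial coefficient.
-/
theorem abs_le_of_backward {K b t₀ t₁ : ℝ} (hK : 0 ≤ K) (hb : 1 ≤ b) (ht₀ : 0 ≤ t₀)
    (h0 : ∀ S, D t₀ S = 0) (hbd : ∀ t ∈ Icc t₀ t₁, ∀ S, |D t S| ≤ K * growthWeight b S) (n : ℕ) :
    ∀ t ∈ Icc t₀ t₁, ∀ S, |D t S| ≤ K * growthWeight b S
      * (2 * (1 + q + α) * b * (t - t₀)) ^ n * (S.card + n).choose n := by
  have hgw : ∀ S, 0 ≤ growthWeight b S := fun S => pow_nonneg (zero_le_one.trans hb) _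
  induction n with
  | zero => simpa using hbd
  | succ n ih =>
    intro t ht S
    set A := 2 * (1 + q + α) * b
    have hA : 0 ≤ A := by positivity
    refine image_norm_le_of_norm_deriv_right_le_deriv_boundary (f := fun t => D t S)
      (f' := fun t => generator q α 0 (D t) S)
      (B := fun t => K * growthWeight b S * (A * (t - t₀)) ^ (n + 1) * (S.card + (n + 1)).choose (n + 1))
      (B' := fun t => K * growthWeight b S * ((n + 1) * (A * (t - t₀)) ^ n * A)
        * (S.card + (n + 1)).choose (n + 1)) (a := t₀) (b := t₁)
      ((hcont S).mono fun s hs => ht₀.trans hs.1) (fun s hs => hderiv S s (ht₀.trans hs.1)) ?_ ?_ ?_ ht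
    · simp [h0]
    · intro s
      have h1 : HasDerivAt (fun t => A * (t - t₀)) A s := by
        simpa using ((hasDerivAt_id s).sub_const t₀).const_mul A
      have h2 := ((h1.fun_pow (n + 1)).const_mul (K * growthWeight b S)).mul_const
        ((S.card + (n + 1)).choose (n + 1) : ℝ)
      refine h2.congr_deriv ?_
      rw [Nat.add_sub_cancel]
      push_cast
      ring
    · intro s hs
      have hs0 : 0 ≤ s - t₀ := sub_nonneg.2 hs.1
      have hT : ∀ T ∈ neighbours S, |D s T| ≤ K * (b * growthWeight b S) * (A * (s - t₀)) ^ n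
          * (S.card + 1 + n).choose n := by
        intro T hT
        refine (ih s ⟨hs.1, hs.2.le⟩ T).trans ?_
        have h1 := growthWeight_le_of_mem_neighbours hb hT
        have h2 : ((T.card + n).choose n : ℝ) ≤ (S.card + 1 + n).choose n := by
          exact_mod_cast Nat.choose_le_choose n (by have := card_le_of_mem_neighbours hT; omega)
        have h3 : 0 ≤ (A * (s - t₀)) ^ n := pow_nonneg (mul_nonneg hA hs0) _
        exact mul_le_mul (mul_le_mul_of_nonneg_right (mul_le_mul_of_nonneg_left h1 hK) h3) h2
          (Nat.cast_nonneg _) (mul_nonneg (mul_nonneg hK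
            (mul_nonneg (zero_le_one.trans hb) (hgw S))) h3)
      have h3 := abs_generator_le hq hα hT
      -- This identity makes the derivative of the new bound equal to the bound for the generator.
      have h4 : ((n : ℝ) + 1) * (S.card + (n + 1)).choose (n + 1)
          = (S.card + 1) * (S.card + 1 + n).choose n := by
        have h5 := Nat.add_one_mul_choose_eq (S.card + n) n
        have h6 := Nat.choose_mul_succ_eq (S.card + n) n
        rw [show S.card + n + 1 - n = S.card + 1 by omega,
          show S.card + n + 1 = S.card + 1 + n by omega] at h6
        rw [show S.card + n + 1 = S.card + (n + 1) by omega] at h5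
        have h7 : (n + 1) * (S.card + (n + 1)).choose (n + 1)
            = (S.card + 1) * (S.card + 1 + n).choose n := by
          rw [mul_comm, ← h5, mul_comm (S.card + 1), ← h6, mul_comm]
          congr 1
          omega
        exact_mod_cast h7
      refine h3.trans (le_of_eq ?_)
      simp only [A] at *
      linear_combination -(K * growthWeight b S * (2 * (1 + q + α) * b * (s - t₀)) ^ n
        * (2 * (1 + q + α) * b)) * h4

/-- The binomial coefficient is at most 2^(|S| + n), so on this interval the bounds decay like
2^(-n). -/
theorem eq_zero_of_backward_of_short_time {K b t₀ t₁ : ℝ} (hK : 0 ≤ K) (hb : 1 ≤ b)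
    (ht₀ : 0 ≤ t₀)
    (h0 : ∀ S, D t₀ S = 0) (hbd : ∀ t ∈ Icc t₀ t₁, ∀ S, |D t S| ≤ K * growthWeight b S)
    (ht₁ : 2 * (1 + q + α) * b * (t₁ - t₀) ≤ 1 / 4) :
    ∀ t ∈ Icc t₀ t₁, ∀ S, D t S = 0 := by
  intro t ht S
  have hgw : 0 ≤ growthWeight b S := pow_nonneg (zero_le_one.trans hb) _
  have hA : 0 ≤ 2 * (1 + q + α) * b := by positivity
  have h1 : ∀ n : ℕ, |D t S| ≤ K * growthWeight b S * 2 ^ S.card * (1 / 2) ^ n := by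
    intro n
    refine (abs_le_of_backward hq hα hcont hderiv hK hb ht₀ h0 hbd n t ht S).trans ?_
    have h2 : 2 * (1 + q + α) * b * (t - t₀) ≤ 1 / 4 :=
      (mul_le_mul_of_nonneg_left (by linarith [ht.2]) hA).trans ht₁
    have h3 : 0 ≤ 2 * (1 + q + α) * b * (t - t₀) := mul_nonneg hA (sub_nonneg.2 ht.1)
    have h4 : ((S.card + n).choose n : ℝ) ≤ 2 ^ (S.card + n) := by
      exact_mod_cast Nat.choose_le_two_pow _ _
    calc _ ≤ K * growthWeight b S * (1 / 4) ^ n * 2 ^ (S.card + n) := by gcongr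
      _ = K * growthWeight b S * 2 ^ S.card * (1 / 2) ^ n := by
        rw [pow_add, show (1 / 2 : ℝ) ^ n = (1 / 4) ^ n * 2 ^ n by rw [← mul_pow]; norm_num]
        ring
  have h2 : Tendsto (fun n : ℕ => K * growthWeight b S * 2 ^ S.card * (1 / 2 : ℝ) ^ n) atTop (𝓝 0) := by
    simpa using (tendsto_pow_atTop_nhds_zero_of_lt_one (r := (1 / 2 : ℝ)) (by norm_num)
      (by norm_num)).const_mul (K * growthWeight b S * 2 ^ S.card)
  exact abs_nonpos_iff.1 (ge_of_tendsto' h2 h1)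

/-- A solution of the backward equation with moderate growth that vanishes at time zero is zero. -/
theorem eq_zero_of_backward (h0 : ∀ S, D 0 S = 0)
    (hbd : ∀ t₁, ∃ K b : ℝ, 0 ≤ K ∧ 1 ≤ b ∧ ∀ t ∈ Icc 0 t₁, ∀ S, |D t S| ≤ K * growthWeight b S)
    {t : ℝ} (ht : 0 ≤ t) (S : Config) : D t S = 0 := by
  obtain ⟨K, b, hK, hb, hKb⟩ := hbd t
  have hA : 0 < 2 * (1 + q + α) * b := by positivity
  -- The length of the steps depends on b alone, which is chosen for the whole interval [0, t];
  -- finitely many steps suffice.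
  set δ := 1 / (4 * (2 * (1 + q + α) * b))
  have hδ : 0 < δ := by positivity
  have hAδ : 2 * (1 + q + α) * b * δ = 1 / 4 := by
    simp only [δ]
    field_simp
  have key : ∀ n : ℕ, ∀ s, 0 ≤ s → s ≤ t → s ≤ n * δ → ∀ S, D s S = 0 := by
    intro n
    induction n with
    | zero =>
      intro s hs _ hs' S
      rw [show s = 0 by
        rw [Nat.cast_zero, zero_mul] at hs'
        exact le_antisymm hs' hs]
      exact h0 S
    | succ n ih =>
      intro s hs hst hsn S
      rcases le_or_gt s (n * δ) with h | h
      · exact ih s hs hst h S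
      · have hn : 0 ≤ n * δ := by positivity
        refine eq_zero_of_backward_of_short_time hq hα hcont hderiv hK hb hn
          (fun S => ih _ hn (h.le.trans hst) le_rfl S)
          (t₁ := s) (fun r hr S => hKb r ⟨hn.trans hr.1, hr.2.trans hst⟩ S) ?_ s ⟨h.le, le_rfl⟩ S
        rw [← hAδ]
        push_cast at hsn
        exact mul_le_mul_of_nonneg_left (by linarith) hA.le
  obtain ⟨n, hn⟩ := exists_nat_ge (t / δ)
  exact key n t ht le_rfl ((div_le_iff₀ hδ).1 hn) S

end uniqueness

/-! ### The backward equation for the transition function -/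

section transition

variable {q α : ℝ} {p : ℝ≥0 → Config → Config → ℝ} (hp : IsTransitionFunction q α 0 p)
include hp

namespace IsTransitionFunction

theorem sum_le_one (t : ℝ≥0) (S : Config) (A : Finset Config) : ∑ T ∈ A, p t S T ≤ 1 :=
  sum_le_hasSum A (fun T _ => hp.nonneg t S T) (hp.hasSum_one t S)

theorem le_one (t : ℝ≥0) (S X : Config) : p t S X ≤ 1 := by
  simpa using hp.sum_le_one t S {X}

theorem sum_mul_le (h t : ℝ≥0) (S X : Config) (A : Finset Config) :
    ∑ T ∈ A, p h S T * p t T X ≤ p (h + t) S X :=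
  sum_le_hasSum A (fun T _ => mul_nonneg (hp.nonneg h S T) (hp.nonneg t T X))
    (hp.chapman_kolmogorov h t S X)

/-- The transitions through configurations outside A are bounded by the probability of being there
at time h. -/
theorem le_sum_mul (h t : ℝ≥0) (S X : Config) (A : Finset Config) :
    p (h + t) S X ≤ ∑ T ∈ A, p h S T * p t T X + (1 - ∑ T ∈ A, p h S T) := by
  have h1 := sum_le_hasSum A (fun T _ => by
    have h1 := mul_nonneg (hp.nonneg h S T) (sub_nonneg.2 (hp.le_one t T X))
    rwa [mul_sub, mul_one] at h1) ((hp.hasSum_one h S).sub (hp.chapman_kolmogorov h t S X))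
  rw [Finset.sum_sub_distrib] at h1
  linarith

/-- The bounds for A = {S}: only leaving S before the remaining time t changes the probability. -/
theorem abs_sub_le (h t : ℝ≥0) (S X : Config) : |p (h + t) S X - p t S X| ≤ 1 - p h S S := by
  have h1 := hp.sum_mul_le h t S X {S}
  have h2 := hp.le_sum_mul h t S X {S}
  rw [Finset.sum_singleton] at h1
  rw [Finset.sum_singleton, Finset.sum_singleton] at h2
  have h3 := mul_nonneg (sub_nonneg.2 (hp.le_one h S S)) (sub_nonneg.2 (hp.le_one t S X))
  have h4 := mul_nonneg (sub_nonneg.2 (hp.le_one h S S)) (hp.nonneg t S X)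
  rw [abs_le]
  constructor <;> nlinarith

theorem sum_zero_mul (g : Config → ℝ) {S : Config} {A : Finset Config} (hS : S ∈ A) :
    ∑ T ∈ A, p 0 S T * g T = g S := by
  simp only [hp.zero, ite_mul, one_mul, zero_mul]
  rw [Finset.sum_ite_eq, if_pos hS]

theorem tendsto_rate (g : Config → ℝ) (S : Config) :
    Tendsto (fun h : ℝ≥0 => ((∑ T ∈ neighbours S, p h S T * g T) - g S) / (h : ℝ)) (𝓝[>] 0)
      (𝓝 (generator q α 0 g S)) := by
  rw [generator_eq_sum subset_rfl]
  refine (tendsto_finsetSum (neighbours S) fun T _ => (hp.hasRate S T).mul_const (g T)).congr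
    fun h => ?_
  conv_rhs => rw [← hp.sum_zero_mul g self_mem_neighbours, ← Finset.sum_sub_distrib, Finset.sum_div]
  exact Finset.sum_congr rfl fun T _ => by ring

/-- The increment lies between the sum over the neighbours and the same sum plus the probability of
not being at a neighbour at time h. The latter is o(h), because the generator annihilates constants;
so no exchange of limits with an infinite sum is needed. -/
theorem tendsto_slope (t : ℝ≥0) (S X : Config) :
    Tendsto (fun h : ℝ≥0 => (p (h + t) S X - p t S X) / (h : ℝ)) (𝓝[>] 0)
      (𝓝 (generator q α 0 (fun T => p t T X) S)) := by
  have h1 := hp.tendsto_rate (fun T => p t T X) S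
  have h2 := hp.tendsto_rate (fun _ => 1) S
  rw [generator_const] at h2
  have h3 := h1.sub h2
  rw [sub_zero] at h3
  refine tendsto_of_tendsto_of_tendsto_of_le_of_le h1 h3 (fun h => ?_) fun h => ?_
  · exact div_le_div_of_nonneg_right (sub_le_sub_right (hp.sum_mul_le h t S X _) _) h.2
  · simp only
    rw [← sub_div]
    refine div_le_div_of_nonneg_right ?_ h.2
    have := hp.le_sum_mul h t S X (neighbours S)
    simp only [mul_one]
    linarith

theorem tendsto_self (S : Config) : Tendsto (fun h : ℝ≥0 => 1 - p h S S) (𝓝 0) (𝓝 0) := by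
  have h1 : Tendsto (fun h : ℝ≥0 => 1 - p h S S) (𝓝[>] 0) (𝓝 0) := by
    have h2 : Tendsto (fun h : ℝ≥0 => (h : ℝ)) (𝓝[>] 0) (𝓝 0) :=
      (NNReal.continuous_coe.tendsto 0).mono_left nhdsWithin_le_nhds
    have h3 := ((hp.hasRate S S).mul h2).neg
    rw [mul_zero, neg_zero] at h3
    refine h3.congr' ?_
    filter_upwards [self_mem_nhdsWithin] with h hh
    have : (h : ℝ) ≠ 0 := NNReal.coe_ne_zero.2 (ne_of_gt hh)
    rw [div_mul_cancel₀ _ this, hp.zero, if_pos rfl]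
    ring
  have h4 : ContinuousWithinAt (fun h : ℝ≥0 => 1 - p h S S) (Ioi 0) 0 := by
    rw [ContinuousWithinAt, hp.zero, if_pos rfl, sub_self]
    exact h1
  rw [continuousWithinAt_Ioi_iff_Ici, ContinuousWithinAt, hp.zero, if_pos rfl, sub_self] at h4
  have : Ici (0 : ℝ≥0) = univ := eq_univ_of_forall fun _ => mem_Ici.2 zero_le
  rwa [this, nhdsWithin_univ] at h4

theorem continuousOn (S X : Config) : ContinuousOn (fun t : ℝ => p t.toNNReal S X) (Ici 0) := by
  intro t ht
  have h1 : Tendsto (fun s : ℝ => 1 - p |s - t|.toNNReal S S) (𝓝[Ici 0] t) (𝓝 0) := by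
    refine (hp.tendsto_self S).comp (Tendsto.mono_left ?_ nhdsWithin_le_nhds)
    have : Continuous fun s : ℝ => |s - t|.toNNReal := by fun_prop
    simpa using this.tendsto t
  refine tendsto_iff_norm_sub_tendsto_zero.2 (tendsto_of_tendsto_of_tendsto_of_le_of_le'
    tendsto_const_nhds h1 (Eventually.of_forall fun s => norm_nonneg _) ?_)
  filter_upwards [self_mem_nhdsWithin] with s hs
  rw [Real.norm_eq_abs]
  rcases le_total t s with h | h
  · have := hp.abs_sub_le (s - t).toNNReal t.toNNReal S X
    rwa [← Real.toNNReal_add (sub_nonneg.2 h) ht, sub_add_cancel,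
      ← abs_of_nonneg (sub_nonneg.2 h)] at this
  · have := hp.abs_sub_le (t - s).toNNReal s.toNNReal S X
    rwa [← Real.toNNReal_add (sub_nonneg.2 h) hs, sub_add_cancel, abs_sub_comm,
      ← abs_of_nonneg (sub_nonneg.2 h), abs_sub_comm t s] at this

theorem hasDerivWithinAt (S X : Config) {t : ℝ} (ht : 0 ≤ t) :
    HasDerivWithinAt (fun t : ℝ => p t.toNNReal S X)
      (generator q α 0 (fun T => p t.toNNReal T X) S) (Ici t) t := by
  rw [← hasDerivWithinAt_Ioi_iff_Ici, hasDerivWithinAt_iff_tendsto_slope' self_notMem_Ioi]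
  have h1 : Tendsto (fun s : ℝ => (s - t).toNNReal) (𝓝[>] t) (𝓝[>] 0) := by
    refine tendsto_nhdsWithin_iff.2 ⟨Tendsto.mono_left ?_ nhdsWithin_le_nhds, ?_⟩
    · have : Continuous fun s : ℝ => (s - t).toNNReal := by fun_prop
      simpa using this.tendsto t
    · filter_upwards [self_mem_nhdsWithin] with s hs
      exact Real.toNNReal_pos.2 (sub_pos.2 hs)
  refine ((hp.tendsto_slope t.toNNReal S X).comp h1).congr' ?_
  filter_upwards [self_mem_nhdsWithin] with s hs
  have hs' : 0 ≤ s - t := (sub_pos.2 hs).le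
  rw [Function.comp_apply, ← Real.toNNReal_add hs' ht, sub_add_cancel, Real.coe_toNNReal _ hs',
    slope_def_field]

end IsTransitionFunction

variable {N : ℕ} {C : Fin N → ℝ → ℂ}

/-- The transition function is given by the contour integral formula. -/
theorem IsTransitionFunction.eq_solution (hC : Admissible q α C) (hq : 0 < q) (hq1 : q ≠ 1)
    (hα : 0 ≤ α) {x : Fin N → ℕ+} (hx : StrictAnti x) {t : ℝ} (ht : 0 ≤ t) (S : Config) :
    (p t.toNNReal S (config x) : ℂ) = solution q α C x t S := by
  have hF : ∀ S t, HasDerivAt (fun t => solution q α C x t S)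
      (complexGenerator q α (solution q α C x t) S) t := hC.hasDerivAt_solution hq hq1 x
  have hre : ∀ S t, HasDerivAt (fun t => (solution q α C x t S).re)
      (generator q α 0 (fun T => (solution q α C x t T).re) S) t := fun S t => by
    rw [← re_complexGenerator]
    exact Complex.reCLM.hasFDerivAt.comp_hasDerivAt t (hF S t)
  have him : ∀ S t, HasDerivAt (fun t => (solution q α C x t S).im)
      (generator q α 0 (fun T => (solution q α C x t T).im) S) t := fun S t => by
    rw [← im_complexGenerator]
    exact Complex.imCLM.hasFDerivAt.comp_hasDerivAt t (hF S t)
  have hF0 := hC.solution_zero hq hq1 hx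
  have hbd := hC.exists_norm_solution_le hq.ne' hq hq1 hα x
  -- Uniqueness is applied to two real functions: the transition function minus the real part of the
  -- solution, and the imaginary part alone.
  apply Complex.ext
  · rw [Complex.ofReal_re, ← sub_eq_zero]
    refine eq_zero_of_backward (D := fun t S => p t.toNNReal S (config x)
      - (solution q α C x t S).re) hq.le hα (fun S => ?_) (fun S t ht => ?_) (fun S => ?_)
      (fun t₁ => ?_) ht S
    · exact (hp.continuousOn S _).sub fun t _ => (hre S t).continuousAt.continuousWithinAt
    · refine ((hp.hasDerivWithinAt S (config x) ht).sub (hre S t).hasDerivWithinAt).congr_deriv ?_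
      have h := generator_add (q := q) (α := α) (γ := 0) (S := S)
        (fun T => p t.toNNReal T (config x)) fun T => -1 * (solution q α C x t T).re
      rw [generator_const_mul] at h
      simp only [sub_eq_add_neg, neg_one_mul] at h ⊢
      exact h.symm
    · simp only [Real.toNNReal_zero, hp.zero, hF0]
      split_ifs <;> simp
    · obtain ⟨K, b, hK, hb, h⟩ := hbd t₁
      refine ⟨1 + K, b, by positivity, hb, fun t ht S => ?_⟩
      -- Probabilities are at most 1, hence below the growth weight.
      have h1 : 1 ≤ growthWeight b S := one_le_pow₀ hb
      have h2 := (Complex.abs_re_le_norm _).trans (h t ht S)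
      have h3 : |p t.toNNReal S (config x)| ≤ 1 := by
        rw [abs_of_nonneg (hp.nonneg _ _ _)]
        exact hp.le_one _ _ _
      refine (abs_sub _ _).trans ?_
      linarith
  · rw [Complex.ofReal_im, eq_comm]
    refine eq_zero_of_backward (D := fun t S => (solution q α C x t S).im) hq.le hα
      (fun S t _ => (him S t).continuousAt.continuousWithinAt)
      (fun S t _ => (him S t).hasDerivWithinAt) (fun S => ?_) (fun t₁ => ?_) ht S
    · simp only [hF0]
      split_ifs <;> simp
    · obtain ⟨K, b, hK, hb, h⟩ := hbd t₁
      exact ⟨K, b, hK, hb, fun t ht S => (Complex.abs_im_le_norm _).trans (h t ht S)⟩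

end transition

/-- The Markov property at the two times 0 and t, divided by the positive probability of the initial
configuration. -/
theorem IsProcess.exists_transitionProb_eq {Ω : Type*} [MeasurableSpace Ω] {μ : Measure Ω}
    [IsFiniteMeasure μ] {q α γ : ℝ} {X : ℝ≥0 → Ω → Config} (hX : IsProcess q α γ X μ) :
    ∃ p, IsTransitionFunction q α γ p ∧ ∀ t S S', μ {ω | X 0 ω = S} ≠ 0 →
      transitionProb X μ t S S' = p t S S' := by
  obtain ⟨p, hp, hm⟩ := hX.markov
  refine ⟨p, hp, fun t S S' hS => ?_⟩
  have h := hm 1 ![0, t] (by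
    intro i j hij
    fin_cases i <;> fin_cases j <;> simp_all) ![S, S']
  have h1 : {ω | ∀ k : Fin 2, X (![0, t] k) ω = ![S, S'] k}
      = {ω | X 0 ω = S} ∩ {ω | X t ω = S'} := by
    ext ω
    simp [Fin.forall_fin_two]
  have h2 : μ.real {ω | X 0 ω = S} ≠ 0 := (measureReal_ne_zero_iff (measure_ne_top _ _)).2 hS
  rw [h1] at h
  rw [transitionProb, Measure.real, ProbabilityTheory.cond_apply (hX.measurableSet 0 S),
    ENNReal.toReal_mul, ENNReal.toReal_inv]
  change (μ.real {ω | X 0 ω = S})⁻¹ * μ.real ({ω | X 0 ω = S} ∩ {ω | X t ω = S'}) = _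
  rw [h]
  simp [h2]

end HalfSpaceASEP

end

theorem theorem2p2 {Ω : Type*} [MeasurableSpace Ω] (μ : Measure Ω) [IsProbabilityMeasure μ]
    (q α : ℝ) (hq : 0 < q) (hq1 : q ≠ 1) (hα : 0 ≤ α)
    (X : ℝ≥0 → Ω → HalfSpaceASEP.Config) (hX : HalfSpaceASEP.IsProcess q α 0 X μ)
    (M N : ℕ) (hMN : M ≤ N)
    (y : Fin M → ℕ+) (hy : StrictAnti y) (x : Fin N → ℕ+) (hx : StrictAnti x)
    (hy0 : μ {ω | X 0 ω = HalfSpaceASEP.config y} ≠ 0)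
    (C : Fin N → ℝ → ℂ) (hC : HalfSpaceASEP.Admissible q α C) (t : ℝ≥0) :
    (HalfSpaceASEP.transitionProb X μ t (HalfSpaceASEP.config y) (HalfSpaceASEP.config x) : ℂ)
      = (HalfSpaceASEP.V q (N - M) : ℂ) * (α : ℂ) ^ (N - M) * Complex.exp (-(α * t))
        * HalfSpaceASEP.nestedInt C (HalfSpaceASEP.integrand q α t hMN y x) := by
  obtain ⟨p, hp, hpt⟩ := hX.exists_transitionProb_eq
  have h := hp.eq_solution hC hq hq1 hα hx (NNReal.coe_nonneg t) (HalfSpaceASEP.config y)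
  rw [Real.toNNReal_coe] at h
  rw [hpt t _ _ hy0, ← hC.solution_config hq hq1 hMN hy x t, h]
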